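/- Let $d\ge 2$ and let $\Omega\subset\mathbb{R}^d$ be a bounded Lipschitz domain, that is, a bounded open set with finitely many connected components whose boundary is locally the graph of a Lipschitz function with $\Omega$ lying on one side of the graph. Let $\operatorname{tr}:H^1(\Omega)\to L^2(\partial\Omega)$ be the trace operator and $\sigma$ the surface measure on $\partial\Omega$; all function spaces are complex. An operator in a Hilbert space $H$ is said to be associated with a sesquilinear form $a$ with dense domain $D(a)\subset H$ if its domain consists of the $u\in D(a)$ for which there is $h\in H$ with $a[u,v]=(h,v)_H$ for all $v\in D(a)$, and it maps $u$ to $h$. For $\alpha\in\mathbb{C}$ let the Robin Laplacian $-\Delta_\Omega^\alpha$ be the operator in $L^2(\Omega)$ associated with $$a_\alpha[u,v]=\int_\Omega\nabla u\cdot\overline{\nabla v}\,dx+\int_{\partial\Omega}\alpha\,\operatorname{tr}u\,\overline{\operatorname{tr}v}\,d\sigma,\qquad u,v\in H^1(\Omega),$$ and let the Dirichlet Laplacian $-\Delta_\Omega^D$ be the operator in $L^2(\Omega)$ associated with the restriction of $a_0$ to $H^1_0(\Omega)$. For $\lambda\in\mathbb{C}$ let $H^1(\lambda)$ be the space of those $u\in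 H^1(\Omega)$ that satisfy $\int_\Omega\nabla u\cdot\overline{\nabla v}\,dx=\lambda\int_\Omega u\overline v\,dx$ for all $v\in H^1_0(\Omega)$. For $\lambda$ in the resolvent set $\rho(-\Delta_\Omega^D)$ let $P(\lambda)$ map $g\in H^{1/2}(\partial\Omega)=\operatorname{tr}H^1(\Omega)$ to the unique $u\in H^1(\lambda)$ with $\operatorname{tr}u=g$, and let the Dirichlet-to-Neumann operator $M(\lambda)$ be the operator in $L^2(\partial\Omega)$ associated with $-q_\lambda$, where $$q_\lambda[g,h]=\int_\Omega\nabla P(\lambda)g\cdot\overline{\nabla P(\lambda)h}-\lambda\,P(\lambda)g\,\overline{P(\lambda)h}\,dx,\qquad g,h\in H^{1/2}(\partial\Omega).$$ Then for every $\alpha\in\mathbb{C}$ and every $\lambda\in\rho(-\Delta_\Omega^D)$: 1. $\lambda\in\sigma(-\Delta_\Omega^\alpha)$ if and only if $\alpha\in\sigma(M(\lambda))$; 2. $\lambda$ is an eigenvalue of $-\Delta_\Omega^\alpha$ if and only if $\alpha$ is an eigenvalue of $M(\lambda)$; 3. a function $u\in H^1(\Omega)$ is an eigenfunction of $-\Delta_\Omega^\alpha$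 corresponding to $\lambda$ if and only if $u\in H^1(\lambda)$ and $\operatorname{tr}u$ is an eigenfunction of $M(\lambda)$ corresponding to $\alpha$. -/

import Mathlib

open MeasureTheory
open scoped ContDiff InnerProductSpace Topology

noncomputable section

namespace RobinDN

/-! ## Unbounded operators associated with sesquilinear forms -/

section Operators

variable {H V : Type*} [NormedAddCommGroup H] [InnerProductSpace ℂ H] [AddCommGroup V] [Module ℂ V]

/-- The pairs `(u, h)` with `u ∈ D(a)` and `a[u, v] = (h, v)` for all `v ∈ D(a)`. The form domain is
given as a vector space `V` with its embedding `j` into `H`; forms are linear in the first and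
conjugate linear in the second variable, so `(h, v)` is Mathlib's `⟪v, h⟫`. -/
def formGraph (j : V →ₗ[ℂ] H) (a : V →ₗ[ℂ] V →ₗ⋆[ℂ] ℂ) : Submodule ℂ (H × H) where
  carrier := {p | ∃ x : V, j x = p.1 ∧ ∀ y : V, a x y = ⟪j y, p.2⟫_ℂ}
  zero_mem' := ⟨0, by simp⟩
  add_mem' := by
    rintro p q ⟨x, hx, hx'⟩ ⟨y, hy, hy'⟩
    exact ⟨x + y, by simp [hx, hy], fun z => by simp [hx', hy']⟩
  smul_mem' := by
    rintro c p ⟨x, hx, hx'⟩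
    exact ⟨c • x, by simp [hx], fun z => by simp [hx']⟩

/-- The operator in `H` associated with the (densely defined) form `a`. -/
def formOperator (j : V →ₗ[ℂ] H) (a : V →ₗ[ℂ] V →ₗ⋆[ℂ] ℂ) : H →ₗ.[ℂ] H :=
  (formGraph j a).toLinearPMap

/-- `z ∈ ρ(A)`: the operator `A - z` is a bijection from `D(A)` onto `H` with bounded inverse `R`. -/
def resolventSet (A : H →ₗ.[ℂ] H) : Set ℂ :=
  {z | ∃ R : H →L[ℂ] H,
    (∀ f : H, ∃ h : R f ∈ A.domain, A ⟨R f, h⟩ - z • R f = f) ∧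
    ∀ u : A.domain, R (A u - z • (u : H)) = u}

/-- The spectrum `σ(A) = ℂ \ ρ(A)`. -/
def opSpectrum (A : H →ₗ.[ℂ] H) : Set ℂ := (resolventSet A)ᶜ

/-- `u` is an eigenfunction of `A` corresponding to `z`. -/
def IsEigenfunction (A : H →ₗ.[ℂ] H) (z : ℂ) (u : H) : Prop :=
  u ≠ 0 ∧ ∃ h : u ∈ A.domain, A ⟨u, h⟩ = z • u

/-- `z` is an eigenvalue of `A`. -/
def IsEigenvalue (A : H →ₗ.[ℂ] H) (z : ℂ) : Prop := ∃ u : H, IsEigenfunction A z u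

/-- The form `(u, v) ↦ (T u, T v)`. -/
def pullInner (T : V →ₗ[ℂ] H) : V →ₗ[ℂ] V →ₗ⋆[ℂ] ℂ :=
  LinearMap.mk₂'ₛₗ (RingHom.id ℂ) (starRingEnd ℂ) (fun u v => ⟪T v, T u⟫_ℂ)
    (fun _ _ _ => by simp) (fun _ _ _ => by simp) (fun _ _ _ => by simp)
    (fun _ _ _ => by simp [mul_comm])

/-- The restriction of the form `a` along a linear map `T` into its domain. -/
def pullForm {W : Type*} [AddCommGroup W] [Module ℂ W] (a : V →ₗ[ℂ] V →ₗ⋆[ℂ] ℂ)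
    (T : W →ₗ[ℂ] V) : W →ₗ[ℂ] W →ₗ⋆[ℂ] ℂ :=
  LinearMap.mk₂'ₛₗ (RingHom.id ℂ) (starRingEnd ℂ) (fun u v => a (T u) (T v))
    (fun _ _ _ => by simp) (fun _ _ _ => by simp) (fun _ _ _ => by simp) (fun _ _ _ => by simp)

end Operators

/-! ## Lipschitz domains -/

/-- A bounded Lipschitz domain: a bounded open set with finitely many connected components which,
near every boundary point and in suitable Cartesian coordinates, is the set of points lying strictly
above the graph of a Lipschitz function. Here `e` is the "upward" unit vector, and `γ` is evaluated
at the orthogonal projection of `y` to the hyperplane `e⊥` only. -/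
structure IsBoundedLipschitzDomain {d : ℕ} (Ω : Set (EuclideanSpace ℝ (Fin d))) : Prop where
  isOpen : IsOpen Ω
  isBounded : Bornology.IsBounded Ω
  finite_components : Finite (ConnectedComponents Ω)
  locally_graph : ∀ p ∈ frontier Ω, ∃ e : EuclideanSpace ℝ (Fin d), ‖e‖ = 1 ∧
    ∃ (γ : EuclideanSpace ℝ (Fin d) → ℝ) (K : NNReal), LipschitzWith K γ ∧
      ∀ᶠ y in 𝓝 p, (y ∈ Ω ↔ γ (y - ⟪e, y⟫_ℝ • e) < ⟪e, y⟫_ℝ)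

/-! ## Function spaces -/

section Spaces

variable {d : ℕ} (Ω : Set (EuclideanSpace ℝ (Fin d)))

/-- `L²(Ω) = L²(Ω; ℂ)`. -/
abbrev L2 : Type := Lp ℂ 2 (volume.restrict Ω)

/-- `L²(Ω; ℂᵈ)`. -/
abbrev L2vec : Type := Lp (EuclideanSpace ℂ (Fin d)) 2 (volume.restrict Ω)

/-- The surface measure `σ` on `∂Ω`: the `(d-1)`-dimensional Hausdorff measure, in its Euclidean
normalisation. -/
def surfaceMeasure : Measure (EuclideanSpace ℝ (Fin d)) :=
  (Measure.euclideanHausdorffMeasure (d - 1)).restrict (frontier Ω)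

/-- `L²(∂Ω) = L²(∂Ω, σ; ℂ)`. -/
abbrev L2bd : Type := Lp ℂ 2 (surfaceMeasure Ω)

/-- The gradient `(∂₁φ, …, ∂_dφ)` of a differentiable complex-valued function. -/
def gradC (φ : EuclideanSpace ℝ (Fin d) → ℂ) (x : EuclideanSpace ℝ (Fin d)) :
    EuclideanSpace ℂ (Fin d) :=
  WithLp.toLp 2 fun i => fderiv ℝ φ x (EuclideanSpace.single i 1)

/-- `ψ ∈ C_c^∞(Ω)`. -/
structure IsTestFunction (ψ : EuclideanSpace ℝ (Fin d) → ℂ) : Prop where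
  smooth : ContDiff ℝ ∞ ψ
  compact : HasCompactSupport ψ
  support : tsupport ψ ⊆ Ω

/-- `G` is the weak gradient of `u` in `Ω`. -/
def IsWeakGradient (u : L2 Ω) (G : L2vec Ω) : Prop :=
  ∀ ψ : EuclideanSpace ℝ (Fin d) → ℂ, IsTestFunction Ω ψ → ∀ i : Fin d,
    ∫ x in Ω, u x * gradC ψ x i = -∫ x in Ω, G x i * ψ x

variable {Ω} in
lemma IsTestFunction.memLp {ψ : EuclideanSpace ℝ (Fin d) → ℂ} (h : IsTestFunction Ω ψ) :
    MemLp ψ 2 (volume.restrict Ω) :=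
  (h.smooth.continuous.memLp_of_hasCompactSupport h.compact).restrict Ω

lemma contDiff_gradC {φ : EuclideanSpace ℝ (Fin d) → ℂ} (h : ContDiff ℝ ∞ φ) :
    ContDiff ℝ ∞ (gradC φ) := by
  refine (PiLp.contDiff_toLp (𝕜 := ℝ)).comp (contDiff_pi.2 fun i => ?_)
  exact (h.fderiv_right (m := ∞) (by simp)).clm_apply contDiff_const

lemma hasCompactSupport_gradC {φ : EuclideanSpace ℝ (Fin d) → ℂ} (h : HasCompactSupport φ) :
    HasCompactSupport (gradC φ) := by
  refine (h.fderiv ℝ).comp_left (g := fun L : EuclideanSpace ℝ (Fin d) →L[ℝ] ℂ =>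
    (WithLp.toLp 2 fun i => L (EuclideanSpace.single i 1) : EuclideanSpace ℂ (Fin d))) ?_
  ext i; simp

lemma memLp_gradC {φ : EuclideanSpace ℝ (Fin d) → ℂ} (h : ContDiff ℝ ∞ φ)
    (hc : HasCompactSupport φ) : MemLp (gradC φ) 2 (volume.restrict Ω) :=
  ((contDiff_gradC h).continuous.memLp_of_hasCompactSupport
    (hasCompactSupport_gradC hc)).restrict Ω

lemma gradC_add {φ ψ : EuclideanSpace ℝ (Fin d) → ℂ} (h : ContDiff ℝ ∞ φ) (h' : ContDiff ℝ ∞ ψ) :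
    gradC (φ + ψ) = gradC φ + gradC ψ := by
  ext x i
  simp [gradC, fderiv_add (h.differentiable (by simp) x) (h'.differentiable (by simp) x)]

lemma gradC_smul (c : ℂ) {φ : EuclideanSpace ℝ (Fin d) → ℂ} (h : ContDiff ℝ ∞ φ) :
    gradC (c • φ) = c • gradC φ := by
  ext x i
  simp [gradC, fderiv_const_smul (h.differentiable (by simp) x) c]

lemma integrable_mul_gradC {u : EuclideanSpace ℝ (Fin d) → ℂ} (hu : MemLp u 2 (volume.restrict Ω))
    {ψ : EuclideanSpace ℝ (Fin d) → ℂ} (hψ : IsTestFunction Ω ψ) (i : Fin d) :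
    Integrable (fun x => u x * gradC ψ x i) (volume.restrict Ω) := by
  have h : MemLp (fun x => gradC ψ x i) 2 (volume.restrict Ω) :=
    (memLp_gradC Ω hψ.smooth hψ.compact).eval_piLp i
  exact hu.integrable_mul h

lemma integrable_comp_mul {G : EuclideanSpace ℝ (Fin d) → EuclideanSpace ℂ (Fin d)}
    (hG : MemLp G 2 (volume.restrict Ω))
    {ψ : EuclideanSpace ℝ (Fin d) → ℂ} (hψ : IsTestFunction Ω ψ) (i : Fin d) :
    Integrable (fun x => G x i * ψ x) (volume.restrict Ω) := by
  have h : MemLp (fun x => G x i) 2 (volume.restrict Ω) := hG.eval_piLp i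
  exact h.integrable_mul hψ.memLp

/-- The Sobolev space `H¹(Ω)`: a function `u ∈ L²(Ω)` having a weak gradient `∇u ∈ L²(Ω; ℂᵈ)`,
recorded as the pair `(u, ∇u)`, with the norm `(‖u‖² + ‖∇u‖²)^(1/2)`. -/
def H1 : Submodule ℂ (WithLp 2 (L2 Ω × L2vec Ω)) where
  carrier := {p | IsWeakGradient Ω p.fst p.snd}
  zero_mem' := by
    intro ψ hψ i
    have h1 : ∫ x in Ω, (0 : L2 Ω) x * gradC ψ x i = 0 := by
      refine integral_eq_zero_of_ae ?_
      filter_upwards [Lp.coeFn_zero ℂ 2 (volume.restrict Ω)] with x hx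
      rw [hx]; simp
    have h2 : ∫ x in Ω, (0 : L2vec Ω) x i * ψ x = 0 := by
      refine integral_eq_zero_of_ae ?_
      filter_upwards [Lp.coeFn_zero (EuclideanSpace ℂ (Fin d)) 2 (volume.restrict Ω)] with x hx
      rw [hx]; simp
    simp only [WithLp.zero_fst, WithLp.zero_snd]
    rw [h1, h2, neg_zero]
  add_mem' := by
    intro p q hp hq ψ hψ i
    have h1 : ∫ x in Ω, (p.fst + q.fst : L2 Ω) x * gradC ψ x i
        = ∫ x in Ω, (p.fst x * gradC ψ x i + q.fst x * gradC ψ x i) := by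
      refine integral_congr_ae ?_
      filter_upwards [Lp.coeFn_add p.fst q.fst] with x hx
      rw [hx, Pi.add_apply, add_mul]
    have h2 : ∫ x in Ω, (p.snd + q.snd : L2vec Ω) x i * ψ x
        = ∫ x in Ω, (p.snd x i * ψ x + q.snd x i * ψ x) := by
      refine integral_congr_ae ?_
      filter_upwards [Lp.coeFn_add p.snd q.snd] with x hx
      rw [hx, Pi.add_apply, PiLp.add_apply, add_mul]
    simp only [WithLp.add_fst, WithLp.add_snd]
    rw [h1, h2, integral_add (integrable_mul_gradC Ω (Lp.memLp _) hψ i)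
      (integrable_mul_gradC Ω (Lp.memLp _) hψ i), integral_add
      (integrable_comp_mul Ω (Lp.memLp _) hψ i) (integrable_comp_mul Ω (Lp.memLp _) hψ i),
      hp ψ hψ i, hq ψ hψ i, neg_add]
  smul_mem' := by
    intro c p hp ψ hψ i
    have h1 : ∫ x in Ω, (c • p.fst : L2 Ω) x * gradC ψ x i
        = ∫ x in Ω, c * (p.fst x * gradC ψ x i) := by
      refine integral_congr_ae ?_
      filter_upwards [Lp.coeFn_smul c p.fst] with x hx
      simp [hx, mul_assoc]
    have h2 : ∫ x in Ω, (c • p.snd : L2vec Ω) x i * ψ x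
        = ∫ x in Ω, c * (p.snd x i * ψ x) := by
      refine integral_congr_ae ?_
      filter_upwards [Lp.coeFn_smul c p.snd] with x hx
      simp [hx, mul_assoc]
    simp only [WithLp.smul_fst, WithLp.smul_snd]
    rw [h1, h2, integral_const_mul, integral_const_mul, hp ψ hψ i, mul_neg]

/-- The embedding `H¹(Ω) → L²(Ω)`, `u ↦ u`. -/
def val : H1 Ω →ₗ[ℂ] L2 Ω where
  toFun u := (u : WithLp 2 (L2 Ω × L2vec Ω)).fst
  map_add' _ _ := rfl
  map_smul' _ _ := rfl

/-- The weak gradient `H¹(Ω) → L²(Ω; ℂᵈ)`, `u ↦ ∇u`. -/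
def grad : H1 Ω →ₗ[ℂ] L2vec Ω where
  toFun u := (u : WithLp 2 (L2 Ω × L2vec Ω)).snd
  map_add' _ _ := rfl
  map_smul' _ _ := rfl

/-- `H¹₀(Ω)`, the closure of `C_c^∞(Ω)` in `H¹(Ω)`. -/
def H10 : Submodule ℂ (H1 Ω) :=
  (Submodule.span ℂ {u : H1 Ω | ∃ ψ, IsTestFunction Ω ψ ∧
    ∀ᵐ x ∂volume.restrict Ω, val Ω u x = ψ x}).topologicalClosure

/-! ## The trace operator -/

/-- The functions in `C_c^∞(ℝᵈ)` whose restriction to `∂Ω` is square integrable; this last condition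
is automatic if `∂Ω` has finite surface measure, as it does for bounded Lipschitz domains. -/
def smoothFunctions : Submodule ℂ (EuclideanSpace ℝ (Fin d) → ℂ) where
  carrier := {φ | ContDiff ℝ ∞ φ ∧ HasCompactSupport φ ∧ MemLp φ 2 (surfaceMeasure Ω)}
  zero_mem' := ⟨contDiff_const, HasCompactSupport.zero, MemLp.zero⟩
  add_mem' := fun h h' => ⟨h.1.add h'.1, h.2.1.add h'.2.1, h.2.2.add h'.2.2⟩
  smul_mem' := fun c _ h =>
    ⟨contDiff_const.smul h.1, h.2.1.smul_left (f := fun _ => c), h.2.2.const_smul c⟩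

lemma isWeakGradient_smooth {φ : EuclideanSpace ℝ (Fin d) → ℂ} (h : ContDiff ℝ ∞ φ)
    (hφ : MemLp φ 2 (volume.restrict Ω)) (hg : MemLp (gradC φ) 2 (volume.restrict Ω)) :
    IsWeakGradient Ω (hφ.toLp φ) (hg.toLp (gradC φ)) := by
  intro ψ hψ i
  have hz : ∀ x, x ∉ Ω → x ∉ tsupport ψ := fun x hx hx' => hx (hψ.support hx')
  have hz0 : ∀ x, x ∉ Ω → ψ x = 0 := fun x hx => image_eq_zero_of_notMem_tsupport (hz x hx)
  have hz1 : ∀ x, x ∉ Ω → fderiv ℝ ψ x = 0 := fun x hx => by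
    by_contra hne
    exact hz x hx (support_fderiv_subset ℝ hne)
  have h1 : ∫ x in Ω, (hφ.toLp φ : L2 Ω) x * gradC ψ x i
      = ∫ x, φ x * fderiv ℝ ψ x (EuclideanSpace.single i 1) := by
    rw [← setIntegral_eq_integral_of_forall_compl_eq_zero (s := Ω)
      (f := fun x => φ x * fderiv ℝ ψ x (EuclideanSpace.single i 1))
      (fun x hx => by simp [hz1 x hx])]
    refine integral_congr_ae ?_
    filter_upwards [hφ.coeFn_toLp] with x hx
    simp [hx, gradC]
  have h2 : ∫ x in Ω, (hg.toLp (gradC φ) : L2vec Ω) x i * ψ x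
      = ∫ x, fderiv ℝ φ x (EuclideanSpace.single i 1) * ψ x := by
    rw [← setIntegral_eq_integral_of_forall_compl_eq_zero (s := Ω)
      (f := fun x => fderiv ℝ φ x (EuclideanSpace.single i 1) * ψ x)
      (fun x hx => by simp [hz0 x hx])]
    refine integral_congr_ae ?_
    filter_upwards [hg.coeFn_toLp] with x hx
    simp [hx, gradC]
  have hcψ : HasCompactSupport fun x => fderiv ℝ ψ x (EuclideanSpace.single i 1) :=
    (hψ.compact.fderiv ℝ).comp_left (g := fun L : EuclideanSpace ℝ (Fin d) →L[ℝ] ℂ =>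
      L (EuclideanSpace.single i 1)) rfl
  have cφ : Continuous fun x => fderiv ℝ φ x (EuclideanSpace.single i 1) :=
    (h.continuous_fderiv (by simp)).clm_apply continuous_const
  have cψ : Continuous fun x => fderiv ℝ ψ x (EuclideanSpace.single i 1) :=
    (hψ.smooth.continuous_fderiv (by simp)).clm_apply continuous_const
  rw [h1, h2]
  exact integral_mul_fderiv_eq_neg_fderiv_mul_of_integrable
    ((cφ.mul hψ.smooth.continuous).integrable_of_hasCompactSupport hψ.compact.mul_left)
    ((h.continuous.mul cψ).integrable_of_hasCompactSupport hcψ.mul_left)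
    ((h.continuous.mul hψ.smooth.continuous).integrable_of_hasCompactSupport hψ.compact.mul_left)
    (fun x _ => h.differentiable (by simp) x) (fun x _ => hψ.smooth.differentiable (by simp) x)

lemma smoothFunctions_memLp (φ : smoothFunctions Ω) :
    MemLp (φ : EuclideanSpace ℝ (Fin d) → ℂ) 2 (volume.restrict Ω) :=
  (φ.2.1.continuous.memLp_of_hasCompactSupport φ.2.2.1).restrict Ω

lemma smoothFunctions_memLp_grad (φ : smoothFunctions Ω) :
    MemLp (gradC (φ : EuclideanSpace ℝ (Fin d) → ℂ)) 2 (volume.restrict Ω) :=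
  memLp_gradC Ω φ.2.1 φ.2.2.1

/-- The restriction `φ ↦ φ|_Ω ∈ H¹(Ω)` of smooth functions. -/
def restrictInterior : smoothFunctions Ω →ₗ[ℂ] H1 Ω where
  toFun φ := ⟨WithLp.toLp 2 ((smoothFunctions_memLp Ω φ).toLp _,
    (smoothFunctions_memLp_grad Ω φ).toLp _), isWeakGradient_smooth Ω φ.2.1 (smoothFunctions_memLp Ω φ)
      (smoothFunctions_memLp_grad Ω φ)⟩
  map_add' φ ψ := by
    refine Subtype.ext (congrArg (WithLp.toLp 2) (Prod.ext ?_ ?_))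
    · exact MemLp.toLp_add (smoothFunctions_memLp Ω φ) (smoothFunctions_memLp Ω ψ)
    · refine Eq.trans ?_ (MemLp.toLp_add (smoothFunctions_memLp_grad Ω φ)
        (smoothFunctions_memLp_grad Ω ψ))
      exact MemLp.toLp_congr (smoothFunctions_memLp_grad Ω (φ + ψ)) _
        (Filter.EventuallyEq.of_eq (gradC_add φ.2.1 ψ.2.1))
  map_smul' c φ := by
    refine Subtype.ext (congrArg (WithLp.toLp 2) (Prod.ext ?_ ?_))
    · exact MemLp.toLp_const_smul c (smoothFunctions_memLp Ω φ)
    · refine Eq.trans ?_ (MemLp.toLp_const_smul c (smoothFunctions_memLp_grad Ω φ))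
      exact MemLp.toLp_congr (smoothFunctions_memLp_grad Ω (c • φ)) _
        (Filter.EventuallyEq.of_eq (gradC_smul c φ.2.1))

/-- The restriction `φ ↦ φ|_∂Ω ∈ L²(∂Ω)` of smooth functions. -/
def restrictBoundary : smoothFunctions Ω →ₗ[ℂ] L2bd Ω where
  toFun φ := φ.2.2.2.toLp _
  map_add' _ _ := MemLp.toLp_add _ _
  map_smul' c _ := MemLp.toLp_const_smul c _

/-- The trace operator `tr : H¹(Ω) → L²(∂Ω)`: the unique continuous linear extension of
`φ|_Ω ↦ φ|_∂Ω`, `φ` smooth. (It exists on bounded Lipschitz domains by the trace theorem.) -/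
def trace : H1 Ω →L[ℂ] L2bd Ω :=
  (restrictBoundary Ω).extendOfNorm (restrictInterior Ω)

/-! ## The Robin and Dirichlet Laplacians -/

/-- The Robin form `a_α[u, v] = ∫_Ω ∇u · conj ∇v dx + ∫_∂Ω α u conj v dσ` on `H¹(Ω)`. -/
def robinForm (α : ℂ) : H1 Ω →ₗ[ℂ] H1 Ω →ₗ⋆[ℂ] ℂ :=
  pullInner (grad Ω) + α • pullInner (trace Ω : H1 Ω →ₗ[ℂ] L2bd Ω)

/-- The Robin Laplacian `-Δ_Ω^α` on `L²(Ω)`. -/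
def robinLaplacian (α : ℂ) : L2 Ω →ₗ.[ℂ] L2 Ω :=
  formOperator (val Ω) (robinForm Ω α)

/-- The Dirichlet Laplacian `-Δ_Ω^D` on `L²(Ω)`, associated with the restriction of `a_0` to
`H¹₀(Ω)`. -/
def dirichletLaplacian : L2 Ω →ₗ.[ℂ] L2 Ω :=
  formOperator (val Ω ∘ₗ (H10 Ω).subtype) (pullForm (robinForm Ω 0) (H10 Ω).subtype)

/-! ## The Dirichlet-to-Neumann operator -/

/-- `H¹(λ)`: the `u ∈ H¹(Ω)` with `-Δu = λu` weakly, that is,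
`∫_Ω ∇u · conj ∇v dx = λ ∫_Ω u conj v dx` for all `v ∈ H¹₀(Ω)`. -/
def helmholtzSpace (lam : ℂ) : Submodule ℂ (H1 Ω) where
  carrier := {u | ∀ v ∈ H10 Ω, ⟪grad Ω v, grad Ω u⟫_ℂ = lam * ⟪val Ω v, val Ω u⟫_ℂ}
  zero_mem' := fun v _ => by simp
  add_mem' := fun h h' v hv => by
    rw [map_add, map_add, inner_add_right, inner_add_right, h v hv, h' v hv, mul_add]
  smul_mem' := fun c u h v hv => by
    rw [map_smul, map_smul, inner_smul_right, inner_smul_right, h v hv, mul_left_comm]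

/-- The Poisson operator `P(λ) : g ↦ u_λ`, where `u_λ ∈ H¹(λ)` is the solution of the Dirichlet
problem with `tr u_λ = g`, given through its graph `{(tr u, u) : u ∈ H¹(λ)}`. Its domain consists of
the `g` for which the Dirichlet problem can be solved, which is the whole of
`H^{1/2}(∂Ω) = tr H¹(Ω)` when `λ` is in the resolvent set of the Dirichlet Laplacian. -/
def poisson (lam : ℂ) : L2bd Ω →ₗ.[ℂ] H1 Ω :=
  ((helmholtzSpace Ω lam).map ((trace Ω : H1 Ω →ₗ[ℂ] L2bd Ω).prod LinearMap.id)).toLinearPMap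

/-- The form `q_λ[g, h] = ∫_Ω ∇P(λ)g · conj ∇P(λ)h - λ P(λ)g conj (P(λ)h) dx` on
`H^{1/2}(∂Ω)`. -/
def dnForm (lam : ℂ) : (poisson Ω lam).domain →ₗ[ℂ] (poisson Ω lam).domain →ₗ⋆[ℂ] ℂ :=
  pullForm (pullInner (grad Ω) - lam • pullInner (val Ω)) (poisson Ω lam).toFun

/-- The (negative) Dirichlet-to-Neumann operator `M(λ)` in `L²(∂Ω)`, associated with `-q_λ`. -/
def dnOperator (lam : ℂ) : L2bd Ω →ₗ.[ℂ] L2bd Ω :=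
  formOperator (poisson Ω lam).domain.subtype (-dnForm Ω lam)

end Spaces

end RobinDN

end

namespace RobinDN

/-! ## Operators associated with bounded forms -/

section FormOperators

variable {H V W : Type*} [NormedAddCommGroup H] [InnerProductSpace ℂ H]
  [AddCommGroup V] [Module ℂ V] [AddCommGroup W] [Module ℂ W]

/-! The whole correspondence is read off one bounded operator on V = H¹(Ω). Let S (`repr`) represent
the form a_α[u,v] − λ(u,v) in the inner product of V, let D = H¹₀(Ω) and W = H¹(λ). Since D is the
kernel of the trace, the boundary term drops out when testing against D, so W is exactly the set of
u with Su orthogonal to D. As λ is in the resolvent set of the Dirichlet Laplacian, the compression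
of S to D is bijective. This gives V = D + W, injectivity of the trace on W, and a block triangular
form of S (`bijective_of_compression`). The compression of S to W represents q_λ + α(tr, tr), that
is, up to sign, the form of M(λ) − α when boundary values are parametrised by W (`formOperator_dn`).

Eigenfunctions: Su = 0 forces u ∈ W, and for u ∈ W the equation Su = 0 has to be tested on W only,
where it says that tr u satisfies the eigenvalue equation of M(λ) for α.

Spectra: λ is in the resolvent set of the Robin Laplacian iff S is bijective. If it is, −tr S⁻¹ tr*
is the resolvent of M(λ) at α. Conversely, if α is in the resolvent set of M(λ), then the
compression to W is bijective, hence so is S. To pass from a resolvent in L² to bijectivity in the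
form domain one needs that the form is coercive after some shift (`bijective_of_mem_resolventSet`).
No symmetry is available, since α and λ are complex. For the Robin form the coercivity is the
inequality ‖tr u‖² ≤ ε‖u‖² + C‖u‖²_{L²}. For the Dirichlet-to-Neumann form it is ‖u‖_{L²} ≤ ε‖u‖ +
C‖tr u‖ on W, which follows by `ehrling` from injectivity of the trace on W and a quantitative form
of the compactness of H¹(Ω) in L²(Ω).

The remaining work is to verify `IsTraceSetting` for Lipschitz domains. In boundary charts,
integration along segments transversal to the graph compares boundary values with values in a strip.
This gives the trace inequality, and also shows that functions with zero trace have mass O(τ²) times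
small gradient energy in a strip of width τ, which pays for the factor 1/τ² of a cut-off: the kernel
of the trace is H¹₀(Ω). Mollifiers pushed into the domain give density of smooth functions. The
compactness estimate combines the strip estimate near the boundary with mollification in the
interior. -/

@[simp] lemma pullInner_apply (T : V →ₗ[ℂ] H) (u v : V) : pullInner T u v = ⟪T v, T u⟫_ℂ := rfl

lemma mem_formGraph {j : V →ₗ[ℂ] H} {a : V →ₗ[ℂ] V →ₗ⋆[ℂ] ℂ} {p : H × H} :
    p ∈ formGraph j a ↔ ∃ x : V, j x = p.1 ∧ ∀ y : V, a x y = ⟪j y, p.2⟫_ℂ := Iff.rfl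

omit [AddCommGroup V] [Module ℂ V] in
lemma eq_zero_of_inner_denseRange {j : V → H} (hj : DenseRange j) {h : H}
    (h0 : ∀ y, ⟪j y, h⟫_ℂ = 0) : h = 0 :=
  hj.eq_zero_of_inner_left (𝕜 := ℂ) fun y => inner_eq_zero_symm.1 (h0 y)

/-- Injectivity of `j` makes the representative in the form domain unique, and density of its range
determines the image. This is what makes the graph of `formOperator` equal to `formGraph`. -/
lemma formGraph_single_valued {j : V →ₗ[ℂ] H} (hj : Function.Injective j) (hd : DenseRange j)
    (a : V →ₗ[ℂ] V →ₗ⋆[ℂ] ℂ) :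
    ∀ p : H × H, p ∈ formGraph j a → p.1 = 0 → p.2 = 0 := by
  rintro p ⟨x, hx, hxa⟩ hp
  have : x = 0 := hj (by rw [hx, hp, map_zero])
  subst this
  exact eq_zero_of_inner_denseRange hd fun y => by rw [← hxa y]; simp

@[simp] lemma pullForm_apply (a : V →ₗ[ℂ] V →ₗ⋆[ℂ] ℂ) (T : W →ₗ[ℂ] V) (u v : W) :
    pullForm a T u v = a (T u) (T v) := rfl

lemma mem_formGraph_iff {j : V →ₗ[ℂ] H} (hj : Function.Injective j) (hd : DenseRange j)
    {a : V →ₗ[ℂ] V →ₗ⋆[ℂ] ℂ} {u h : H} :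
    (u, h) ∈ formGraph j a ↔
      ∃ hu : u ∈ (formOperator j a).domain, formOperator j a ⟨u, hu⟩ = h := by
  rw [← Submodule.toLinearPMap_graph_eq (formGraph j a) (formGraph_single_valued hj hd a),
    LinearPMap.mem_graph_iff]
  constructor
  · rintro ⟨y, rfl, rfl⟩
    exact ⟨y.2, rfl⟩
  · rintro ⟨hu, rfl⟩
    exact ⟨⟨u, hu⟩, rfl, rfl⟩

lemma isEigenfunction_formOperator_iff {j : V →ₗ[ℂ] H} (hj : Function.Injective j)
    (hd : DenseRange j) {a : V →ₗ[ℂ] V →ₗ⋆[ℂ] ℂ} {z : ℂ} {u : H} :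
    IsEigenfunction (formOperator j a) z u ↔
      u ≠ 0 ∧ ∃ x : V, j x = u ∧ ∀ y, a x y = z * ⟪j y, u⟫_ℂ := by
  rw [IsEigenfunction, ← mem_formGraph_iff hj hd, mem_formGraph]
  simp only [inner_smul_right]

/-- Stated through the graph, the resolvent equation becomes an equation for an element of the form
domain, where the bijectivity arguments take place. -/
lemma mem_resolventSet_formOperator_iff {j : V →ₗ[ℂ] H} (hj : Function.Injective j)
    (hd : DenseRange j) {a : V →ₗ[ℂ] V →ₗ⋆[ℂ] ℂ} {z : ℂ} :
    z ∈ resolventSet (formOperator j a) ↔ ∃ R : H →L[ℂ] H,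
      (∀ f, (R f, f + z • R f) ∈ formGraph j a) ∧
      ∀ x h, (∀ y, a x y = ⟪j y, h⟫_ℂ) → R (h - z • j x) = j x := by
  refine exists_congr fun R => and_congr (forall_congr' fun f => ?_) ?_
  · rw [mem_formGraph_iff hj hd]
    simp only [sub_eq_iff_eq_add]
  · constructor
    · intro hR x h hx
      obtain ⟨hu, he⟩ := (mem_formGraph_iff hj hd).1 (mem_formGraph.2 ⟨x, rfl, hx⟩ :
        (j x, h) ∈ formGraph j a)
      have := hR ⟨j x, hu⟩
      rwa [he] at this
    · intro hR u
      obtain ⟨x, hx, hxa⟩ := (mem_formGraph_iff hj hd (a := a) (u := u)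
        (h := formOperator j a u)).2 ⟨u.2, rfl⟩
      have := hR x _ hxa
      rwa [hx] at this

/-- Used to replace boundary values by the solutions in `W`. Surjectivity of the reparametrisation
is enough, since the graph only quantifies over the form domain. -/
lemma formGraph_congr {j : V →ₗ[ℂ] H} {a : V →ₗ[ℂ] V →ₗ⋆[ℂ] ℂ} {j' : W →ₗ[ℂ] H}
    {a' : W →ₗ[ℂ] W →ₗ⋆[ℂ] ℂ} (e : W → V) (he : Function.Surjective e)
    (hj : ∀ x, j (e x) = j' x) (ha : ∀ x y, a (e x) (e y) = a' x y) :
    formGraph j a = formGraph j' a' := by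
  ext p
  simp only [mem_formGraph, he.exists, he.forall, hj, ha]

end FormOperators

/-! ### Representing operators, compressions and Ehrling's inequality -/

section Bounded

variable {H V : Type*} [NormedAddCommGroup H] [InnerProductSpace ℂ H] [CompleteSpace H]
  [NormedAddCommGroup V] [InnerProductSpace ℂ V] [CompleteSpace V]

open ContinuousLinearMap (adjoint adjoint_inner_right)

/-- If `a` is coercive after some shift and `z` is in the resolvent set of the operator associated
with `a`, then the shifted form `a - z` is represented by a bijection of the form domain. -/
lemma bijective_of_mem_resolventSet {j : V →L[ℂ] H} (hj : Function.Injective j)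
    (hd : DenseRange j) {a : V →ₗ[ℂ] V →ₗ⋆[ℂ] ℂ} {z μ : ℂ} {S : V →L[ℂ] V}
    (hS : ∀ x y, ⟪y, S x⟫_ℂ = a x y - z * ⟪j y, j x⟫_ℂ) {c : ℝ} (hc : 0 < c)
    (hco : ∀ x, c * ‖x‖ ^ 2 ≤ ‖a x x - μ * ⟪j x, j x⟫_ℂ‖)
    (hz : z ∈ resolventSet (formOperator (j : V →ₗ[ℂ] H) a)) : Function.Bijective S := by
  obtain ⟨R, hR, hR'⟩ := (mem_resolventSet_formOperator_iff hj hd).1 hz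
  set N : V →L[ℂ] V := adjoint j ∘L j
  have hN : ∀ x y, ⟪y, N x⟫_ℂ = ⟪j y, j x⟫_ℂ := fun x y => adjoint_inner_right j y (j x)
  set S' : V →L[ℂ] V := S + (z - μ) • N
  have hS' : ∀ x y, ⟪y, S' x⟫_ℂ = a x y - μ * ⟪j y, j x⟫_ℂ := fun x y => by
    simp only [S', add_apply, smul_apply, inner_add_right,
      inner_smul_right, hS, hN]
    ring
  -- Lax–Milgram for the coercive shift `a - μ`.
  have hu : IsUnit S' := by
    refine ContinuousLinearMap.isUnit_of_forall_le_norm_inner_map S' (c := ⟨c, hc.le⟩) hc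
      fun x => ?_
    rw [norm_inner_symm, hS', mul_comm]
    exact hco x
  have hsurj := (ContinuousLinearMap.isUnit_iff_bijective.1 hu).2
  constructor
  · rw [injective_iff_map_eq_zero]
    intro x hx
    -- A kernel element satisfies the form equation with right-hand side `z • j x`, so `R` maps 0 to
    -- `j x`.
    have h := hR' x (z • j x) fun y => by
      have := hS x y
      rw [hx, inner_zero_right] at this
      rw [inner_smul_right]
      exact (sub_eq_zero.1 this.symm)
    simp only [ContinuousLinearMap.coe_coe, sub_self, map_zero] at h
    exact hj (by rw [← h, map_zero])
  · intro w
    -- The solution `w₁` of the coercive problem leaves the defect `(z - μ) • N w₁`, which is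
    -- `adjoint j` of an element of `H`. Such right-hand sides are solved by the resolvent, which
    -- gives `w₂`.
    obtain ⟨w₁, hw₁⟩ := hsurj w
    obtain ⟨w₂, hw₂, hw₂'⟩ := hR ((z - μ) • j w₁)
    refine ⟨w₁ + w₂, ext_inner_left ℂ fun y => ?_⟩
    have h1 := hw₂' y
    simp only [ContinuousLinearMap.coe_coe] at hw₂ h1
    have h2 := hS' w₁ y
    rw [hw₁] at h2
    rw [h2, map_add, inner_add_right, hS, hS, h1, ← hw₂, inner_add_right, inner_smul_right,
      inner_smul_right]
    ring

/-- The resolvent is `j S⁻¹ j*`. It is bounded by the open mapping theorem, so coercivity plays no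
role in this direction. -/
lemma mem_resolventSet_of_bijective {j : V →L[ℂ] H} (hj : Function.Injective j)
    (hd : DenseRange j) {a : V →ₗ[ℂ] V →ₗ⋆[ℂ] ℂ} {z : ℂ} {S : V →L[ℂ] V}
    (hS : ∀ x y, ⟪y, S x⟫_ℂ = a x y - z * ⟪j y, j x⟫_ℂ) (hb : Function.Bijective S) :
    z ∈ resolventSet (formOperator (j : V →ₗ[ℂ] H) a) := by
  let e := ContinuousLinearEquiv.ofBijective S (LinearMap.ker_eq_bot.2 hb.1)
    (LinearMap.range_eq_top.2 hb.2)
  have he : ∀ w, S (e.symm w) = w := fun w => e.apply_symm_apply w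
  have he' : ∀ w, e.symm (S w) = w := fun w => e.symm_apply_apply w
  rw [mem_resolventSet_formOperator_iff hj hd]
  refine ⟨j ∘L (e.symm : V →L[ℂ] V) ∘L adjoint j, fun f => ⟨e.symm (adjoint j f), rfl, fun y => ?_⟩,
    fun x h hx => ?_⟩
  · have := hS (e.symm (adjoint j f)) y
    rw [he, adjoint_inner_right] at this
    simp only [ContinuousLinearMap.comp_apply, ContinuousLinearMap.coe_coe,
      ContinuousLinearEquiv.coe_coe, inner_add_right, inner_smul_right]
    rw [this]
    ring
  · have : adjoint j (h - z • j x) = S x := by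
      refine ext_inner_left ℂ fun y => ?_
      rw [hS, hx, adjoint_inner_right, inner_sub_right, inner_smul_right]
      rfl
    simp only [ContinuousLinearMap.comp_apply, ContinuousLinearMap.coe_coe,
      ContinuousLinearEquiv.coe_coe]
    rw [this, he']

/-- The compression of an operator to a complete subspace. -/
noncomputable def compression (U : Submodule ℂ V) [CompleteSpace U] (S : V →L[ℂ] V) : U →L[ℂ] U :=
  U.orthogonalProjectionOnto ∘L S ∘L U.subtypeL

omit [CompleteSpace V] in
@[simp] lemma inner_compression (U : Submodule ℂ V) [CompleteSpace U] (S : V →L[ℂ] V) (x y : U) :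
    ⟪y, compression U S x⟫_ℂ = ⟪(y : V), S x⟫_ℂ := by
  simp [compression]

omit [CompleteSpace V] in
/-- A block triangular operator with bijective diagonal blocks is bijective. -/
lemma bijective_of_compression (D W : Submodule ℂ V) [CompleteSpace D] [CompleteSpace W]
    {S : V →L[ℂ] V} (hW : ∀ u, u ∈ W ↔ ∀ v ∈ D, ⟪v, S u⟫_ℂ = 0)
    (hD : Function.Surjective (compression D S)) (hM : Function.Bijective (compression W S)) :
    Function.Bijective S := by
  constructor
  · rw [injective_iff_map_eq_zero]
    intro u hu
    have huW : u ∈ W := (hW u).2 fun v _ => by rw [hu, inner_zero_right]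
    have : (⟨u, huW⟩ : W) = 0 := hM.1 <| ext_inner_left ℂ fun y => by
      rw [inner_compression, map_zero, inner_zero_right, hu, inner_zero_right]
    exact congrArg Subtype.val this
  · intro k
    -- `z` settles the equation tested against `D`. The correction `w` settles it against `W` and
    -- does not disturb the first, since `S w` is orthogonal to `D`.
    obtain ⟨z, hz⟩ := hD (D.orthogonalProjectionOnto k)
    obtain ⟨w, hw⟩ := hM.2 (W.orthogonalProjectionOnto (k - S z))
    have hz' : ∀ y : D, ⟪(y : V), S z⟫_ℂ = ⟪(y : V), k⟫_ℂ := fun y => by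
      rw [← inner_compression, hz]; simp
    have hw' : ∀ y : W, ⟪(y : V), S w⟫_ℂ = ⟪(y : V), k - S z⟫_ℂ := fun y => by
      rw [← inner_compression, hw]; simp
    refine ⟨w + z, ext_inner_left ℂ fun v => ?_⟩
    -- This proves `V = D + W`: subtracting `t ∈ D` from `v` makes the image under `S` orthogonal to
    -- `D`.
    obtain ⟨t, ht⟩ := hD (D.orthogonalProjectionOnto (S v))
    have hvt : v - t ∈ W := (hW _).2 fun y hy => by
      have : ⟪y, S t⟫_ℂ = ⟪y, S v⟫_ℂ := by
        have := inner_compression D S t ⟨y, hy⟩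
        rw [ht] at this
        rw [← this]; simp
      rw [map_sub, inner_sub_right, this, sub_self]
    have h1 := hw' ⟨v - t, hvt⟩
    have h2 := (hW w).1 w.2 t t.2
    have h3 := hz' t
    have hv : v = (v - t) + t := by abel
    rw [hv, map_add, inner_add_left, inner_add_left, inner_add_right, inner_add_right, h2, h3]
    simp only [inner_sub_right] at h1
    rw [h1]
    ring

/-- Ehrling's inequality: if `J` is controlled by finitely many functionals and by an injective
operator `τ`, up to arbitrarily small multiples of the norm, then it is controlled by `τ`. -/
lemma ehrling {G : Type*} [NormedAddCommGroup G] [InnerProductSpace ℂ G] [CompleteSpace G]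
    {J : V → ℝ} {τ : V →L[ℂ] G} (hτ : Function.Injective τ)
    (hF : ∀ ε > 0, ∃ (s : Finset V) (C : ℝ), ∀ x,
      J x ≤ ε * ‖x‖ + C * ‖τ x‖ + C * ∑ b ∈ s, ‖⟪b, x⟫_ℂ‖) :
    ∀ ε > 0, ∃ C : ℝ, ∀ x, J x ≤ ε * ‖x‖ + C * ‖τ x‖ := by
  intro ε hε
  obtain ⟨s, C, hC⟩ := hF (ε / 2) (by positivity)
  -- The closure of the range of `adjoint τ` is the orthogonal complement of the trivial kernel of
  -- `τ`. Hence each functional `b` is close to some `adjoint τ g`, whose pairing with `x` is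
  -- bounded by `‖g‖ ‖τ x‖`.
  have hdense : DenseRange (adjoint τ) := by
    have h1 := τ.orthogonal_ker
    rw [LinearMap.ker_eq_bot.2 hτ, Submodule.bot_orthogonal_eq_top] at h1
    have h2 : Dense ((adjoint τ).range : Set V) :=
      Submodule.dense_iff_topologicalClosure_eq_top.2 h1.symm
    exact h2
  have happ : ∀ b : V, ∀ δ > 0, ∃ K : ℝ, ∀ x, ‖⟪b, x⟫_ℂ‖ ≤ δ * ‖x‖ + K * ‖τ x‖ := by
    intro b δ hδ
    obtain ⟨g, hg⟩ := hdense.exists_dist_lt b hδ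
    refine ⟨‖g‖, fun x => ?_⟩
    have : ⟪b, x⟫_ℂ = ⟪b - adjoint τ g, x⟫_ℂ + ⟪g, τ x⟫_ℂ := by
      rw [inner_sub_left, ContinuousLinearMap.adjoint_inner_left]; ring
    rw [this]
    refine (norm_add_le _ _).trans (add_le_add ?_ (norm_inner_le_norm _ _))
    refine (norm_inner_le_norm _ _).trans ?_
    rw [dist_eq_norm] at hg
    gcongr
  -- Chosen so that `|C| * s.card * δ ≤ ε / 2`. Adding 1 to each factor covers `C = 0` and empty
  -- `s`.
  set δ : ℝ := ε / (2 * (|C| + 1) * (s.card + 1)) with hδdef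
  have hδ : 0 < δ := by positivity
  choose K hK using fun b => happ b δ hδ
  refine ⟨|C| + |C| * ∑ b ∈ s, K b, fun x => ?_⟩
  have hsum : ∑ b ∈ s, ‖⟪b, x⟫_ℂ‖ ≤ s.card * (δ * ‖x‖) + (∑ b ∈ s, K b) * ‖τ x‖ := by
    refine (Finset.sum_le_sum fun b _ => hK b x).trans ?_
    rw [Finset.sum_add_distrib, Finset.sum_const, nsmul_eq_mul, Finset.sum_mul]
  have hδ' : |C| * (s.card * δ) ≤ ε / 2 := by
    rw [hδdef, mul_div_assoc', mul_div_assoc', div_le_div_iff₀ (by positivity) (by positivity)]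
    have : (|C|) * s.card ≤ (|C| + 1) * (s.card + 1) := by gcongr <;> linarith
    nlinarith
  have h0 : C * ∑ b ∈ s, ‖⟪b, x⟫_ℂ‖ ≤ |C| * (s.card * (δ * ‖x‖) + (∑ b ∈ s, K b) * ‖τ x‖) :=
    (mul_le_mul_of_nonneg_right (le_abs_self C) (by positivity)).trans
      (mul_le_mul_of_nonneg_left hsum (abs_nonneg C))
  have h1 : C * ‖τ x‖ ≤ |C| * ‖τ x‖ := mul_le_mul_of_nonneg_right (le_abs_self C) (norm_nonneg _)
  have h2 := mul_le_mul_of_nonneg_right hδ' (norm_nonneg x)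
  calc J x ≤ _ := hC x
    _ ≤ ε / 2 * ‖x‖ + |C| * ‖τ x‖
        + |C| * (s.card * (δ * ‖x‖) + (∑ b ∈ s, K b) * ‖τ x‖) := by gcongr
    _ ≤ _ := by linarith

end Bounded

/-! ### The correspondence in an abstract trace setting -/

section Abstract

variable {V H G : Type*} [NormedAddCommGroup V] [InnerProductSpace ℂ V] [CompleteSpace V]
  [NormedAddCommGroup H] [InnerProductSpace ℂ H] [CompleteSpace H]
  [NormedAddCommGroup G] [InnerProductSpace ℂ G] [CompleteSpace G]

open ContinuousLinearMap (adjoint adjoint_inner_right)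

/-- The functional analytic properties of `H¹(Ω)`, its embedding `j` into `L²(Ω)`, the trace `τ`,
the form `s` of the Neumann Laplacian and `D = H¹₀(Ω)` on which the Robin and Dirichlet problems
depend. -/
structure IsTraceSetting (j : V →L[ℂ] H) (τ : V →L[ℂ] G) (s : V →ₗ[ℂ] V →ₗ⋆[ℂ] ℂ)
    (D : Submodule ℂ V) : Prop where
  inner_eq : ∀ x y, ⟪y, x⟫_ℂ = s x y + ⟪j y, j x⟫_ℂ
  injective : Function.Injective j
  denseRange : DenseRange (j ∘L D.subtypeL)
  denseRange_trace : DenseRange τ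
  ker_trace : ∀ u, τ u = 0 ↔ u ∈ D
  trace_le : ∀ ε > 0, ∃ C : ℝ, ∀ x, ‖τ x‖ ^ 2 ≤ ε * ‖x‖ ^ 2 + C * ‖j x‖ ^ 2
  le_trace : ∀ ε > 0, ∃ (t : Finset V) (C : ℝ), ∀ x,
    ‖j x‖ ≤ ε * ‖x‖ + C * ‖τ x‖ + C * ∑ b ∈ t, ‖⟪b, x⟫_ℂ‖

namespace IsTraceSetting

variable {j : V →L[ℂ] H} {τ : V →L[ℂ] G} {s : V →ₗ[ℂ] V →ₗ⋆[ℂ] ℂ} {D : Submodule ℂ V}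

omit [CompleteSpace V] [CompleteSpace H] [CompleteSpace G] in
lemma isClosed (h : IsTraceSetting j τ s D) : IsClosed (D : Set V) := by
  have : (D : Set V) = τ ⁻¹' {0} := by
    ext u; simp [h.ker_trace]
  rw [this]
  exact isClosed_singleton.preimage τ.continuous

omit [CompleteSpace V] [CompleteSpace H] [CompleteSpace G] in
lemma denseRange_val (h : IsTraceSetting j τ s D) : DenseRange j := by
  refine h.denseRange.mono ?_
  rintro _ ⟨x, rfl⟩
  exact ⟨x, rfl⟩

omit [CompleteSpace V] [CompleteSpace H] [CompleteSpace G] in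
lemma form_self (h : IsTraceSetting j τ s D) (x : V) :
    s x x = ((‖x‖ ^ 2 - ‖j x‖ ^ 2 : ℝ) : ℂ) := by
  have := h.inner_eq x x
  rw [inner_self_eq_norm_sq_to_K, inner_self_eq_norm_sq_to_K] at this
  push_cast
  exact (sub_eq_of_eq_add this).symm

/-- The operator in the form domain representing `s + α (τ, τ) - z (j, j)`. -/
noncomputable def repr (j : V →L[ℂ] H) (τ : V →L[ℂ] G) (α z : ℂ) : V →L[ℂ] V :=
  ContinuousLinearMap.id ℂ V + α • (adjoint τ ∘L τ) - (1 + z) • (adjoint j ∘L j)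

/-- By `inner_eq` the identity represents `s + (j, j)`, which accounts for the factor `1 + z` in
`repr`. -/
lemma inner_repr (h : IsTraceSetting j τ s D) (α z : ℂ) (x y : V) :
    ⟪y, repr j τ α z x⟫_ℂ = s x y + α * ⟪τ y, τ x⟫_ℂ - z * ⟪j y, j x⟫_ℂ := by
  simp only [repr, sub_apply, add_apply, smul_apply, ContinuousLinearMap.comp_apply,
    inner_sub_right, inner_add_right, inner_smul_right, adjoint_inner_right,
    ContinuousLinearMap.id_apply, h.inner_eq x y]
  ring

omit [CompleteSpace V] [CompleteSpace H] [CompleteSpace G] in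
-- The boundary term is at most `‖α‖ ‖τ x‖²`. The trace inequality with a small parameter absorbs it
-- into half of `‖x‖²` and a multiple of `‖j x‖²`, and the shift `μ` cancels the latter together
-- with the `-‖j x‖²` contained in `s`.
lemma robin_coercive (h : IsTraceSetting j τ s D) (α : ℂ) : ∃ (c : ℝ) (μ : ℂ), 0 < c ∧
    ∀ x, c * ‖x‖ ^ 2 ≤ ‖(s + α • pullInner (τ : V →ₗ[ℂ] G)) x x - μ * ⟪j x, j x⟫_ℂ‖ := by
  obtain ⟨C, hC⟩ := h.trace_le (1 / (2 * (‖α‖ + 1))) (by positivity)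
  refine ⟨1 / 2, ((-(1 + ‖α‖ * |C|) : ℝ) : ℂ), by norm_num, fun x => ?_⟩
  refine le_trans ?_ (Complex.re_le_norm _)
  have hre : ((s + α • pullInner (τ : V →ₗ[ℂ] G)) x x
      - ((-(1 + ‖α‖ * |C|) : ℝ) : ℂ) * ⟪j x, j x⟫_ℂ).re
      = ‖x‖ ^ 2 + α.re * ‖τ x‖ ^ 2 + ‖α‖ * |C| * ‖j x‖ ^ 2 := by
    simp only [LinearMap.add_apply, LinearMap.smul_apply, smul_eq_mul, pullInner_apply,
      ContinuousLinearMap.coe_coe, h.form_self, inner_self_eq_norm_sq_to_K]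
    simp [← Complex.ofReal_pow]
    ring
  rw [hre]
  have h1 : -‖α‖ * ‖τ x‖ ^ 2 ≤ α.re * ‖τ x‖ ^ 2 :=
    mul_le_mul_of_nonneg_right (abs_le.1 (Complex.abs_re_le_norm α)).1 (by positivity)
  have h2 : C * ‖j x‖ ^ 2 ≤ |C| * ‖j x‖ ^ 2 :=
    mul_le_mul_of_nonneg_right (le_abs_self C) (by positivity)
  have h3 : ‖α‖ * (1 / (2 * (‖α‖ + 1))) ≤ 1 / 2 := by
    rw [mul_one_div, div_le_div_iff₀ (by positivity) (by norm_num)]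
    linarith
  have h4 := mul_le_mul_of_nonneg_right h3 (sq_nonneg ‖x‖)
  have h5 := mul_le_mul_of_nonneg_left ((hC x).trans (add_le_add_right h2 _)) (norm_nonneg α)
  nlinarith

variable {lam : ℂ}

/-- The trace vanishes on `D`, so for every `α` the compression represents the Dirichlet form minus
`lam`. With the shift `-1` that form is the squared norm of `V`, so coercivity is immediate. -/
lemma dirichlet_bijective (h : IsTraceSetting j τ s D) [CompleteSpace D]
    (hlam : lam ∈ resolventSet (formOperator ((j : V →ₗ[ℂ] H) ∘ₗ D.subtype)
      (pullForm (s + (0 : ℂ) • pullInner (τ : V →ₗ[ℂ] G)) D.subtype))) (α : ℂ) :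
    Function.Bijective (compression D (repr j τ α lam)) := by
  refine bijective_of_mem_resolventSet (j := j ∘L D.subtypeL) (μ := -1) (c := 1) (z := lam)
    (a := pullForm (s + (0 : ℂ) • pullInner (τ : V →ₗ[ℂ] G)) D.subtype)
    (h.injective.comp Subtype.val_injective) h.denseRange (fun x y => ?_) one_pos (fun x => ?_) hlam
  · have : τ (x : V) = 0 := (h.ker_trace _).2 x.2
    rw [inner_compression, h.inner_repr]
    simp [this]
  · have : s x x + ⟪j x, j x⟫_ℂ = ((‖x‖ ^ 2 : ℝ) : ℂ) := by
      rw [← h.inner_eq, inner_self_eq_norm_sq_to_K]; simp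
    have h1 : pullForm (s + (0 : ℂ) • pullInner (τ : V →ₗ[ℂ] G)) D.subtype x x
        - -1 * ⟪(j ∘L D.subtypeL) x, (j ∘L D.subtypeL) x⟫_ℂ = ((‖x‖ ^ 2 : ℝ) : ℂ) := by
      refine Eq.trans ?_ this
      simp
    rw [h1, one_mul]
    exact (le_abs_self _).trans (Complex.norm_real _).ge

variable {W : Submodule ℂ V}

/-- An element of `W` with zero trace lies in `D` and is in the kernel of the Dirichlet compression.
-/
lemma trace_injOn (h : IsTraceSetting j τ s D) [CompleteSpace D]
    (hW : ∀ u, u ∈ W ↔ ∀ v ∈ D, s u v = lam * ⟪j v, j u⟫_ℂ)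
    (hlam : lam ∈ resolventSet (formOperator ((j : V →ₗ[ℂ] H) ∘ₗ D.subtype)
      (pullForm (s + (0 : ℂ) • pullInner (τ : V →ₗ[ℂ] G)) D.subtype)))
    {u : V} (hu : u ∈ W) (hu0 : τ u = 0) : u = 0 := by
  have hb := (h.dirichlet_bijective hlam 0).1
  have huD := (h.ker_trace u).1 hu0
  have : (⟨u, huD⟩ : D) = 0 := hb <| ext_inner_left ℂ fun y => by
    rw [inner_compression, h.inner_repr, map_zero, inner_zero_right, (hW u).1 hu y y.2]
    simp
  exact congrArg Subtype.val this

/-- Solvability of the Dirichlet problem: subtract from `v` the element `t` of `D` with the same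
image in `D` under the compressed operator. The trace does not change. -/
lemma exists_helmholtz (h : IsTraceSetting j τ s D) [CompleteSpace D]
    (hW : ∀ u, u ∈ W ↔ ∀ v ∈ D, s u v = lam * ⟪j v, j u⟫_ℂ)
    (hlam : lam ∈ resolventSet (formOperator ((j : V →ₗ[ℂ] H) ∘ₗ D.subtype)
      (pullForm (s + (0 : ℂ) • pullInner (τ : V →ₗ[ℂ] G)) D.subtype)))
    (v : V) : ∃ w ∈ W, τ w = τ v := by
  obtain ⟨t, ht⟩ := (h.dirichlet_bijective hlam 0).2
    (D.orthogonalProjectionOnto (repr j τ 0 lam v))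
  have htD : τ t = 0 := (h.ker_trace _).2 t.2
  refine ⟨v - t, (hW _).2 fun y hy => ?_, by rw [map_sub, htD, sub_zero]⟩
  have h1 := inner_compression D (repr j τ 0 lam) t ⟨y, hy⟩
  rw [ht] at h1
  have h2 : ⟪y, repr j τ 0 lam v⟫_ℂ = ⟪y, repr j τ 0 lam t⟫_ℂ := by rw [← h1]; simp
  rw [h.inner_repr, h.inner_repr] at h2
  simp only [map_sub, LinearMap.sub_apply, inner_sub_right]
  linear_combination h2

omit [CompleteSpace V] [CompleteSpace H] in
-- The only obstruction to coercivity is `-(1 + lam.re) ‖j x‖²`. On `W` the trace is injective, so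
-- `ehrling` bounds `‖j x‖` by a small multiple of `‖x‖` plus a multiple of `‖τ x‖`, and the latter
-- is absorbed by the shift `μ`.
lemma dn_coercive (h : IsTraceSetting j τ s D) [CompleteSpace W]
    (hinj : ∀ u ∈ W, τ u = 0 → u = 0) : ∃ (c : ℝ) (μ : ℂ), 0 < c ∧
    ∀ x ∈ W, c * ‖x‖ ^ 2 ≤ ‖-(s x x - lam * ⟪j x, j x⟫_ℂ) - μ * ⟪τ x, τ x⟫_ℂ‖ := by
  have hτ : Function.Injective (τ ∘L W.subtypeL) := by
    rw [injective_iff_map_eq_zero]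
    exact fun x hx => Subtype.ext (hinj x x.2 hx)
  set M : ℝ := 1 + ‖lam‖
  have hM : 0 < M := by positivity
  obtain ⟨C, hC⟩ := ehrling (J := fun x : W => ‖j x‖) hτ (by
    classical
    intro ε hε
    obtain ⟨t, C, hC⟩ := h.le_trace ε hε
    -- On `W` a functional `b` acts as its projection to `W`. Several `b` may have the same
    -- projection, hence the factor `t.card`.
    refine ⟨t.image W.orthogonalProjectionOnto, |C| * (t.card + 1), fun x => ?_⟩
    have hbd : ∀ b ∈ t, ‖⟪b, (x : V)⟫_ℂ‖ ≤
        ∑ b ∈ t.image W.orthogonalProjectionOnto, ‖⟪b, x⟫_ℂ‖ := fun b hb => by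
      have : ⟪b, (x : V)⟫_ℂ = ⟪W.orthogonalProjectionOnto b, x⟫_ℂ := by simp
      rw [this]
      exact Finset.single_le_sum (f := fun b : W => ‖⟪b, x⟫_ℂ‖) (fun _ _ => norm_nonneg _)
        (Finset.mem_image_of_mem _ hb)
    have hsum := Finset.sum_le_card_nsmul t _ _ hbd
    rw [nsmul_eq_mul] at hsum
    set Λ := ∑ b ∈ t.image W.orthogonalProjectionOnto, ‖⟪b, x⟫_ℂ‖
    have hΛ : 0 ≤ Λ := Finset.sum_nonneg fun _ _ => norm_nonneg _
    have h1 : C * ∑ b ∈ t, ‖⟪b, (x : V)⟫_ℂ‖ ≤ |C| * (t.card * Λ) :=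
      (mul_le_mul_of_nonneg_right (le_abs_self C)
        (Finset.sum_nonneg fun _ _ => norm_nonneg _)).trans
        (mul_le_mul_of_nonneg_left hsum (abs_nonneg C))
    have h2 : C * ‖τ x‖ ≤ |C| * ‖τ x‖ :=
      mul_le_mul_of_nonneg_right (le_abs_self C) (norm_nonneg _)
    have h3 : 0 ≤ |C| * t.card * ‖τ x‖ := by positivity
    have h4 : 0 ≤ |C| * Λ := by positivity
    have := hC x
    simp only [ContinuousLinearMap.comp_apply, Submodule.subtypeL_apply, Submodule.coe_norm] at *
    linarith) (1 / (2 * M)) (by positivity)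
  -- Squaring the Ehrling bound with parameter `1 / (2 * M)` gives `M ‖j x‖² ≤ ‖x‖² / (2M) + 2 M C²
  -- ‖τ x‖²`, and `M ≥ 1`.
  refine ⟨1 / 2, ((M * (2 * C ^ 2) : ℝ) : ℂ), by norm_num, fun x hx => ?_⟩
  rw [← norm_neg (_ - _)]
  refine le_trans ?_ (Complex.re_le_norm _)
  have hre : (-(-(s x x - lam * ⟪j x, j x⟫_ℂ)
      - ((M * (2 * C ^ 2) : ℝ) : ℂ) * ⟪τ x, τ x⟫_ℂ)).re
      = ‖x‖ ^ 2 - (1 + lam.re) * ‖j x‖ ^ 2 + M * (2 * C ^ 2) * ‖τ x‖ ^ 2 := by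
    simp only [h.form_self, inner_self_eq_norm_sq_to_K]
    simp [← Complex.ofReal_pow]
    ring
  rw [hre]
  have h1 : ‖j x‖ ≤ 1 / (2 * M) * ‖x‖ + C * ‖τ x‖ := hC ⟨x, hx⟩
  have h2 : ‖j x‖ ^ 2 ≤ 2 * (1 / (2 * M) * ‖x‖) ^ 2 + 2 * (C * ‖τ x‖) ^ 2 := by
    have := pow_le_pow_left₀ (norm_nonneg _) h1 2
    nlinarith [sq_nonneg (1 / (2 * M) * ‖x‖ - C * ‖τ x‖)]
  have h3 : (1 + lam.re) * ‖j x‖ ^ 2 ≤ M * ‖j x‖ ^ 2 :=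
    mul_le_mul_of_nonneg_right (by linarith [Complex.re_le_norm lam]) (by positivity)
  have h4 := mul_le_mul_of_nonneg_left h2 hM.le
  have h5 : M * (2 * (1 / (2 * M) * ‖x‖) ^ 2) ≤ 1 / 2 * ‖x‖ ^ 2 := by
    have hM1 : 1 ≤ M := by simp [M]
    have : M * (2 * (1 / (2 * M) * ‖x‖) ^ 2) = 1 / (2 * M) * ‖x‖ ^ 2 := by
      field_simp
    rw [this]
    gcongr
    linarith
  nlinarith

variable (W τ) in
/-- The abstract Poisson operator. -/
noncomputable def poissonMap : G →ₗ.[ℂ] V :=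
  (W.map ((τ : V →ₗ[ℂ] G).prod LinearMap.id)).toLinearPMap

omit [CompleteSpace V] [CompleteSpace G] in
-- Injectivity of the trace on `W` makes the set of pairs `(τ u, u)` single valued, hence the graph
-- of `poissonMap`.
lemma poissonMap_spec (hinj : ∀ u ∈ W, τ u = 0 → u = 0) {u : V} (hu : u ∈ W) :
    ∃ hd : τ u ∈ (poissonMap τ W).domain, poissonMap τ W ⟨τ u, hd⟩ = u := by
  have hg : ∀ p : G × V, p ∈ W.map ((τ : V →ₗ[ℂ] G).prod LinearMap.id) → p.1 = 0 → p.2 = 0 := by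
    rintro _ ⟨u, hu, rfl⟩ h0
    exact hinj u hu h0
  have : (τ u, u) ∈ (poissonMap τ W).graph := by
    rw [poissonMap, Submodule.toLinearPMap_graph_eq _ hg]
    exact ⟨u, hu, rfl⟩
  obtain ⟨y, hy, hy'⟩ := (LinearPMap.mem_graph_iff _).1 this
  have hd : τ u ∈ (poissonMap τ W).domain := hy.subst (motive := (· ∈ (poissonMap τ W).domain)) y.2
  have hy2 : y = ⟨τ u, hd⟩ := Subtype.ext hy
  rw [hy2] at hy'
  exact ⟨hd, hy'⟩

omit [CompleteSpace V] [CompleteSpace G] in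
lemma exists_of_mem_poissonMap_domain (g : (poissonMap τ W).domain) : ∃ u ∈ W, τ u = g := by
  obtain ⟨_, ⟨u, hu, rfl⟩, h⟩ := g.2
  exact ⟨u, hu, h⟩

omit [CompleteSpace V] [CompleteSpace H] [CompleteSpace G] in
/-- The abstract Dirichlet-to-Neumann operator is associated with a form on `W`. -/
lemma formOperator_dn (hinj : ∀ u ∈ W, τ u = 0 → u = 0) (lam : ℂ) :
    formOperator (poissonMap τ W).domain.subtype
      (-pullForm (s - lam • pullInner (j : V →ₗ[ℂ] H)) (poissonMap τ W).toFun) =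
    formOperator ((τ ∘L W.subtypeL : W →L[ℂ] G) : W →ₗ[ℂ] G)
      (-pullForm (s - lam • pullInner (j : V →ₗ[ℂ] H)) W.subtype) := by
  rw [formOperator, formOperator]
  congr 1
  choose hd hP using fun u : W => poissonMap_spec hinj u.2
  -- Boundary values are parametrised by `u ↦ τ u`, which the Poisson map inverts. The form domain
  -- thereby becomes the Hilbert space `W`.
  refine formGraph_congr (fun u : W => ⟨τ u, hd u⟩) (fun g => ?_) (fun u => rfl) fun u v => ?_
  · obtain ⟨u, hu, h⟩ := exists_of_mem_poissonMap_domain g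
    exact ⟨⟨u, hu⟩, Subtype.ext h⟩
  · have hu : (poissonMap τ W).toFun ⟨τ u, hd u⟩ = u := hP u
    have hv : (poissonMap τ W).toFun ⟨τ v, hd v⟩ = v := hP v
    simp only [LinearMap.neg_apply, pullForm_apply]
    rw [hu, hv]
    rfl

variable (α : ℂ)

/-- The abstract form of the correspondence between Robin and Dirichlet-to-Neumann operators. -/
theorem main (h : IsTraceSetting j τ s D)
    (hW : ∀ u, u ∈ W ↔ ∀ v ∈ D, s u v = lam * ⟪j v, j u⟫_ℂ)
    (hlam : lam ∈ resolventSet (formOperator ((j : V →ₗ[ℂ] H) ∘ₗ D.subtype)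
      (pullForm (s + (0 : ℂ) • pullInner (τ : V →ₗ[ℂ] G)) D.subtype)))
    {R : H →ₗ.[ℂ] H} {M : G →ₗ.[ℂ] G}
    (hR : R = formOperator (j : V →ₗ[ℂ] H) (s + α • pullInner (τ : V →ₗ[ℂ] G)))
    (hM : M = formOperator (poissonMap τ W).domain.subtype
      (-pullForm (s - lam • pullInner (j : V →ₗ[ℂ] H)) (poissonMap τ W).toFun)) :
    (lam ∈ opSpectrum R ↔ α ∈ opSpectrum M) ∧ (IsEigenvalue R lam ↔ IsEigenvalue M α) ∧
      ∀ u : V, IsEigenfunction R lam (j u) ↔ u ∈ W ∧ IsEigenfunction M α (τ u) := by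
  have : CompleteSpace D := h.isClosed.completeSpace_coe
  have hinj := fun u hu => h.trace_injOn hW hlam (u := u) hu
  -- The boundary term vanishes against `D`, so this description of `W` holds for every `α`.
  have hW' : ∀ u, u ∈ W ↔ ∀ v ∈ D, ⟪v, repr j τ α lam u⟫_ℂ = 0 := fun u => by
    rw [hW]
    refine forall₂_congr fun v hv => ?_
    rw [h.inner_repr, (h.ker_trace v).2 hv, inner_zero_left, mul_zero, add_zero, sub_eq_zero]
  have hWc : IsClosed (W : Set V) := by
    have : (W : Set V) = ⋂ v ∈ D, {u | ⟪v, repr j τ α lam u⟫_ℂ = 0} := by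
      ext u; simp [hW']
    rw [this]
    exact isClosed_biInter fun v _ => isClosed_eq
      (continuous_const.inner (repr j τ α lam).continuous) continuous_const
  have : CompleteSpace W := hWc.completeSpace_coe
  rw [formOperator_dn hinj] at hM
  have hτi : Function.Injective (τ ∘L W.subtypeL) := by
    rw [injective_iff_map_eq_zero]
    exact fun x hx => Subtype.ext (hinj x x.2 hx)
  have hτd : DenseRange (τ ∘L W.subtypeL) := by
    refine h.denseRange_trace.mono ?_
    rintro _ ⟨v, rfl⟩
    obtain ⟨w, hw, hwv⟩ := h.exists_helmholtz hW hlam v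
    exact ⟨⟨w, hw⟩, hwv⟩
  have hSR : ∀ x y, ⟪y, repr j τ α lam x⟫_ℂ
      = (s + α • pullInner (τ : V →ₗ[ℂ] G)) x y - lam * ⟪j y, j x⟫_ℂ := fun x y => h.inner_repr ..
  have key : ∀ u : V, IsEigenfunction R lam (j u) ↔ u ∈ W ∧ IsEigenfunction M α (τ u) := by
    intro u
    have h1 : IsEigenfunction R lam (j u) ↔ u ≠ 0 ∧ repr j τ α lam u = 0 := by
      rw [hR, isEigenfunction_formOperator_iff h.injective h.denseRange_val]
      refine and_congr (map_ne_zero_iff _ h.injective) ⟨?_, fun hu => ⟨u, rfl, fun y => ?_⟩⟩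
      · rintro ⟨x, hx, hxa⟩
        obtain rfl := h.injective hx
        refine ext_inner_left ℂ fun y => ?_
        rw [hSR, hxa, inner_zero_right]
        exact sub_self _
      · have := hSR u y
        rw [hu, inner_zero_right] at this
        exact sub_eq_zero.1 this.symm
    rw [h1]
    have h2 : ∀ hu : u ∈ W, (IsEigenfunction M α (τ u) ↔ u ≠ 0 ∧ repr j τ α lam u = 0) := by
      intro hu
      rw [hM, isEigenfunction_formOperator_iff hτi hτd]
      refine and_congr ⟨?_, fun hu0 h0 => hu0 (hinj u hu h0)⟩ ⟨?_, fun hu0 => ⟨⟨u, hu⟩, rfl, ?_⟩⟩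
      · rintro h0 rfl
        exact h0 (map_zero _)
      · rintro ⟨x, hx, hxa⟩
        obtain rfl : x = ⟨u, hu⟩ := hτi hx
        refine ext_inner_left ℂ fun v => ?_
        -- Split `v = w + (v - w)` with `w ∈ W` and `v - w ∈ D`. The second part gives zero since `u
        -- ∈ W`, so testing on `W` suffices.
        obtain ⟨w, hw, hwv⟩ := h.exists_helmholtz hW hlam v
        have hvw : v - w ∈ D := (h.ker_trace _).1 (by rw [map_sub, hwv, sub_self])
        have h3 := (hW' u).1 hu _ hvw
        have h4 := hxa ⟨w, hw⟩
        rw [inner_sub_left, sub_eq_zero] at h3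
        rw [h3, inner_zero_right, h.inner_repr]
        simp only [LinearMap.neg_apply, pullForm_apply, LinearMap.sub_apply, LinearMap.smul_apply,
          pullInner_apply, Submodule.subtype_apply, ContinuousLinearMap.coe_coe, smul_eq_mul,
          ContinuousLinearMap.comp_apply, Submodule.subtypeL_apply] at h4
        linear_combination -h4
      · intro y
        have h4 := h.inner_repr α lam u y
        rw [hu0, inner_zero_right] at h4
        simp only [LinearMap.neg_apply, pullForm_apply, LinearMap.sub_apply, LinearMap.smul_apply,
          pullInner_apply, Submodule.subtype_apply, ContinuousLinearMap.coe_coe, smul_eq_mul,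
          ContinuousLinearMap.comp_apply, Submodule.subtypeL_apply]
        linear_combination h4
    constructor
    · rintro ⟨hu0, hu⟩
      have huW : u ∈ W := (hW' u).2 fun v _ => by rw [hu, inner_zero_right]
      exact ⟨huW, (h2 huW).2 ⟨hu0, hu⟩⟩
    · rintro ⟨huW, hu⟩
      exact (h2 huW).1 hu
  refine ⟨not_congr ⟨fun hz => ?_, fun hz => ?_⟩, ⟨?_, ?_⟩, key⟩
  · obtain ⟨c, μ, hc, hco⟩ := h.robin_coercive α
    rw [hR] at hz
    have hb := bijective_of_mem_resolventSet h.injective h.denseRange_val hSR hc hco hz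
    let e := ContinuousLinearEquiv.ofBijective (repr j τ α lam) (LinearMap.ker_eq_bot.2 hb.1)
      (LinearMap.range_eq_top.2 hb.2)
    have he : ∀ w, repr j τ α lam (e.symm w) = w := fun w => e.apply_symm_apply w
    have he' : ∀ w, e.symm (repr j τ α lam w) = w := fun w => e.symm_apply_apply w
    rw [hM, mem_resolventSet_formOperator_iff hτi hτd]
    -- Solving `S u = adjoint τ f` amounts to the inhomogeneous Robin problem with boundary datum
    -- `f`. The solution lies in `W` because `adjoint τ f` is orthogonal to `D`. The sign comes from
    -- the `-q` in the definition of `M`.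
    refine ⟨-(τ ∘L (e.symm : V →L[ℂ] V) ∘L adjoint τ), fun f => ?_, fun x g hx => ?_⟩
    · set u := e.symm (adjoint τ f) with hu
      have huτ : ∀ y, ⟪y, repr j τ α lam u⟫_ℂ = ⟪τ y, f⟫_ℂ := fun y => by
        rw [hu, he, adjoint_inner_right]
      have huW : u ∈ W := (hW' u).2 fun v hv => by
        rw [huτ, (h.ker_trace v).2 hv, inner_zero_left]
      refine ⟨-⟨u, huW⟩, by simp [hu], fun y => ?_⟩
      have h4 := huτ y
      rw [h.inner_repr] at h4
      simp only [neg_apply, ContinuousLinearMap.comp_apply, ContinuousLinearEquiv.coe_coe,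
        LinearMap.neg_apply, pullForm_apply, LinearMap.sub_apply, LinearMap.smul_apply,
        pullInner_apply, Submodule.subtype_apply, ContinuousLinearMap.coe_coe, smul_eq_mul,
        Submodule.subtypeL_apply, map_neg, neg_neg, inner_add_right, inner_smul_right,
        inner_neg_right, ← hu]
      linear_combination h4
    · have hx' : adjoint τ (g - α • τ x) = -repr j τ α lam x := by
        refine ext_inner_left ℂ fun v => ?_
        obtain ⟨w, hw, hwv⟩ := h.exists_helmholtz hW hlam v
        have hvw : v - w ∈ D := (h.ker_trace _).1 (by rw [map_sub, hwv, sub_self])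
        have h3 := (hW' x).1 x.2 _ hvw
        have h4 := hx ⟨w, hw⟩
        rw [inner_sub_left, sub_eq_zero] at h3
        rw [inner_neg_right, h3, adjoint_inner_right, ← hwv, h.inner_repr, inner_sub_right,
          inner_smul_right]
        simp only [LinearMap.neg_apply, pullForm_apply, LinearMap.sub_apply, LinearMap.smul_apply,
          pullInner_apply, Submodule.subtype_apply, ContinuousLinearMap.coe_coe, smul_eq_mul,
          ContinuousLinearMap.comp_apply, Submodule.subtypeL_apply] at h4
        linear_combination -h4
      simp only [ContinuousLinearMap.coe_coe, ContinuousLinearMap.comp_apply,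
        Submodule.subtypeL_apply, neg_apply, ContinuousLinearEquiv.coe_coe]
      rw [hx', map_neg, he', map_neg, neg_neg]
  · obtain ⟨c, μ, hc, hco⟩ := h.dn_coercive (lam := lam) hinj
    rw [hM] at hz
    -- The general criterion is applied with `W` as form domain and the trace as its embedding. The
    -- form `-q - α (τ, τ)` is represented by minus the compression.
    have hb := bijective_of_mem_resolventSet hτi hτd (S := -compression W (repr j τ α lam))
      (fun x y => by
        rw [neg_apply, inner_neg_right, inner_compression, h.inner_repr]
        simp only [LinearMap.neg_apply, pullForm_apply, LinearMap.sub_apply, LinearMap.smul_apply,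
          pullInner_apply, Submodule.subtype_apply, ContinuousLinearMap.coe_coe, smul_eq_mul,
          ContinuousLinearMap.comp_apply, Submodule.subtypeL_apply]
        ring) hc (fun x => hco x x.2) hz
    have hb' : Function.Bijective (compression W (repr j τ α lam)) := by
      have h5 : (compression W (repr j τ α lam) : W → W)
          = Neg.neg ∘ (-compression W (repr j τ α lam)) := by
        ext x; simp
      rw [h5]
      exact (Equiv.neg W).bijective.comp hb
    rw [hR]
    exact mem_resolventSet_of_bijective h.injective h.denseRange_val hSR
      (bijective_of_compression D W hW' (h.dirichlet_bijective hlam α).2 hb')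
  -- Eigenvectors lie in the form domain, so `f = j x` and the correspondence of eigenfunctions
  -- applies. The converse is analogous, with `g = τ x` for some `x ∈ W`.
  · rintro ⟨f, hf⟩
    have hf' := hf
    rw [hR, isEigenfunction_formOperator_iff h.injective h.denseRange_val] at hf'
    obtain ⟨-, x, rfl, -⟩ := hf'
    exact ⟨τ x, ((key x).1 hf).2⟩
  · rintro ⟨g, hg⟩
    have hg' := hg
    rw [hM, isEigenfunction_formOperator_iff hτi hτd] at hg'
    obtain ⟨-, x, rfl, -⟩ := hg'
    exact ⟨j x, (key x).2 ⟨x.2, hg⟩⟩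

end IsTraceSetting

end Abstract

/-! ## Graphs over a hyperplane -/

section Graph

open scoped ENNReal NNReal

variable {d : ℕ} {e : EuclideanSpace ℝ (Fin d)}

/-- The hyperplane orthogonal to `e`. -/
noncomputable abbrev hyperplane (e : EuclideanSpace ℝ (Fin d)) : Submodule ℝ (EuclideanSpace ℝ (Fin d)) :=
  (Submodule.span ℝ {e})ᗮ

lemma inner_hyperplane (y : hyperplane e) : ⟪e, (y : EuclideanSpace ℝ (Fin d))⟫_ℝ = 0 :=
  Submodule.mem_orthogonal_singleton_iff_inner_right.1 y.2

lemma inner_hyperplane_add (he : ‖e‖ = 1) (y : hyperplane e) (t : ℝ) :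
    ⟪e, (y : EuclideanSpace ℝ (Fin d)) + t • e⟫_ℝ = t := by
  rw [inner_add_right, inner_hyperplane, inner_smul_right, real_inner_self_eq_norm_sq, he]
  simp

lemma hyperplane_add_sub (he : ‖e‖ = 1) (y : hyperplane e) (t : ℝ) :
    (y : EuclideanSpace ℝ (Fin d)) + t • e
      - ⟪e, (y : EuclideanSpace ℝ (Fin d)) + t • e⟫_ℝ • e = y := by
  rw [inner_hyperplane_add he, add_sub_cancel_right]

lemma coe_proj_hyperplane (he : ‖e‖ = 1) (x : EuclideanSpace ℝ (Fin d)) :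
    ((hyperplane e).orthogonalProjectionOnto x : EuclideanSpace ℝ (Fin d)) = x - ⟪e, x⟫_ℝ • e := by
  have := Submodule.starProjection_orthogonal_val (K := Submodule.span ℝ {e}) x
  rwa [Submodule.starProjection_unit_singleton ℝ he] at this

lemma finrank_hyperplane (he : ‖e‖ = 1) (hd : 1 ≤ d) :
    Module.finrank ℝ (hyperplane e) = d - 1 := by
  have : Fact (Module.finrank ℝ (EuclideanSpace ℝ (Fin d)) = d - 1 + 1) :=
    ⟨by rw [finrank_euclideanSpace_fin]; omega⟩
  exact Submodule.finrank_orthogonal_span_singleton (by rintro rfl; simp at he)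

/-- Cartesian coordinates adapted to a unit vector are measure preserving. -/
lemma measurePreserving_hyperplane_add (he : ‖e‖ = 1) :
    MeasurePreserving (fun p : hyperplane e × ℝ => (p.1 : EuclideanSpace ℝ (Fin d)) + p.2 • e)
      (volume.prod volume) volume := by
  have h1 : MeasurePreserving (LinearIsometryEquiv.toSpanUnitSingleton (𝕜 := ℝ) e he)
      volume volume := LinearIsometryEquiv.measurePreserving _
  have h2 := (h1.prod (MeasurePreserving.id (volume : Measure (hyperplane e)))).comp
    (Measure.measurePreserving_swap (μ := (volume : Measure (hyperplane e)))
      (ν := (volume : Measure ℝ)))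
  have h3 := (WithLp.volume_preserving_toLp (Submodule.span ℝ {e}) (hyperplane e)).comp h2
  have h4 := (Submodule.span ℝ {e}).orthogonalDecomposition.symm.measurePreserving.comp h3
  have h5 : (fun p : hyperplane e × ℝ => (p.1 : EuclideanSpace ℝ (Fin d)) + p.2 • e) =
      (Submodule.span ℝ {e}).orthogonalDecomposition.symm ∘ WithLp.toLp 2 ∘
        Prod.map (LinearIsometryEquiv.toSpanUnitSingleton (𝕜 := ℝ) e he) id ∘ Prod.swap := by
    funext p
    have := (Submodule.span ℝ {e}).measurableEquivProd_symm_apply (0 : EuclideanSpace ℝ (Fin d))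
      (⟨p.2 • e, Submodule.smul_mem _ _ (Submodule.mem_span_singleton_self e)⟩, p.1)
    simp only [vadd_eq_add, add_zero] at this
    rw [add_comm, ← this]
    simp [Submodule.measurableEquivProd]
  rw [h5]
  exact h4

/-- Tonelli in coordinates adapted to `e`. The shift by `γ y` is made in the inner integral for
fixed `y`, so no regularity of `γ` is needed. -/
lemma lintegral_eq_graph (he : ‖e‖ = 1) {γ : EuclideanSpace ℝ (Fin d) → ℝ}
    {h : EuclideanSpace ℝ (Fin d) → ℝ≥0∞} (hh : Measurable h) :
    ∫⁻ x, h x = ∫⁻ y : hyperplane e, ∫⁻ t : ℝ, h ((y : EuclideanSpace ℝ (Fin d)) + (γ y + t) • e) := by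
  have h1 := measurePreserving_hyperplane_add he
  rw [← h1.lintegral_comp hh, lintegral_prod (fun p : hyperplane e × ℝ =>
    h ((p.1 : EuclideanSpace ℝ (Fin d)) + p.2 • e)) (hh.comp h1.measurable).aemeasurable]
  refine lintegral_congr fun y => ?_
  exact (lintegral_add_left_eq_self
    (fun t : ℝ => h ((y : EuclideanSpace ℝ (Fin d)) + t • e)) (γ y)).symm

/-- The parametrisation of the graph of `γ` by the hyperplane. -/
noncomputable def graphMap (γ : EuclideanSpace ℝ (Fin d) → ℝ) (y : hyperplane e) : EuclideanSpace ℝ (Fin d) :=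
  y + γ y • e

lemma lipschitzWith_graphMap (he : ‖e‖ = 1) {γ : EuclideanSpace ℝ (Fin d) → ℝ} {K : ℝ≥0}
    (hγ : LipschitzWith K γ) : LipschitzWith (1 + K) (graphMap (e := e) γ) := by
  refine LipschitzWith.of_dist_le_mul fun y z => ?_
  have h1 := hγ.dist_le_mul (y : EuclideanSpace ℝ (Fin d)) z
  have h2 : dist ((γ y) • e) ((γ z) • e) = dist (γ y) (γ z) := by
    rw [dist_eq_norm, ← sub_smul, norm_smul, he, mul_one, dist_eq_norm]
  calc dist (graphMap γ y) (graphMap γ z)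
      ≤ dist (y : EuclideanSpace ℝ (Fin d)) z + dist ((γ y) • e) ((γ z) • e) := dist_add_add_le ..
    _ ≤ dist (y : EuclideanSpace ℝ (Fin d)) z + K * dist (y : EuclideanSpace ℝ (Fin d)) z := by
        rw [h2]; gcongr
    _ = ((1 + K : ℝ≥0) : ℝ) * dist y z := by
        rw [Subtype.dist_eq]; push_cast; ring

lemma proj_graphMap (he : ‖e‖ = 1) (γ : EuclideanSpace ℝ (Fin d) → ℝ) (y : hyperplane e) :
    (hyperplane e).orthogonalProjectionOnto (graphMap γ y) = y :=
  Subtype.ext (by rw [coe_proj_hyperplane he, graphMap, hyperplane_add_sub he])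

lemma volume_hyperplane (he : ‖e‖ = 1) (hd : 1 ≤ d) :
    (volume : Measure (hyperplane e)) = Measure.euclideanHausdorffMeasure (d - 1) := by
  rw [← finrank_hyperplane he hd, InnerProductSpace.euclideanHausdorffMeasure_eq_volume]

lemma euclideanHausdorffMeasure_image_le {X Y : Type*} [MetricSpace X] [MeasurableSpace X]
    [BorelSpace X] [MetricSpace Y] [MeasurableSpace Y] [BorelSpace Y] {f : X → Y} {K : ℝ≥0}
    (hf : LipschitzWith K f) (n : ℕ) (s : Set X) :
    Measure.euclideanHausdorffMeasure n (f '' s)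
      ≤ (K : ℝ≥0∞) ^ n * Measure.euclideanHausdorffMeasure n s := by
  have := hf.hausdorffMeasure_image_le (d := n) (by positivity) s
  rw [ENNReal.rpow_natCast] at this
  simp only [Measure.euclideanHausdorffMeasure_def, Measure.smul_apply]
  rw [mul_smul_comm]
  exact smul_le_smul_of_nonneg_left this (by positivity)

/-- The graph map is `(1 + K)`-Lipschitz, so it enlarges Hausdorff measure by at most `(1 +
K)^(d-1)`. With the next lemma this replaces the area formula. -/
lemma lintegral_surface_le (he : ‖e‖ = 1) (hd : 1 ≤ d) {γ : EuclideanSpace ℝ (Fin d) → ℝ} {K : ℝ≥0}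
    (hγ : LipschitzWith K γ) {A : Set (hyperplane e)} {S : Set (EuclideanSpace ℝ (Fin d))}
    (hS : S ⊆ graphMap γ '' A) {h : EuclideanSpace ℝ (Fin d) → ℝ≥0∞} (hh : Measurable h) :
    ∫⁻ x in S, h x ∂(Measure.euclideanHausdorffMeasure (d - 1)) ≤
      ((1 + K : ℝ≥0) : ℝ≥0∞) ^ (d - 1) * ∫⁻ y in A, h (graphMap γ y) := by
  have hΓ := lipschitzWith_graphMap he hγ
  rw [← lintegral_map hh hΓ.continuous.measurable, ← smul_eq_mul, ← lintegral_smul_measure]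
  refine lintegral_mono' (Measure.le_iff.2 fun T hT => ?_) le_rfl
  have hT' := hΓ.continuous.measurable hT
  rw [Measure.restrict_apply hT, Measure.smul_apply,
    Measure.map_apply hΓ.continuous.measurable hT, Measure.restrict_apply hT',
    volume_hyperplane he hd, smul_eq_mul]
  refine (measure_mono ?_).trans (euclideanHausdorffMeasure_image_le hΓ (d - 1) _)
  rintro x ⟨hxT, hxS⟩
  obtain ⟨y, hy, rfl⟩ := hS hxS
  exact ⟨y, ⟨hxT, hy⟩, rfl⟩

/-- The orthogonal projection is 1-Lipschitz and is a left inverse of the graph map, so Lebesgue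
measure on the base is dominated by surface measure on the graph. -/
lemma lintegral_graph_le (he : ‖e‖ = 1) (hd : 1 ≤ d) {γ : EuclideanSpace ℝ (Fin d) → ℝ} {K : ℝ≥0}
    (hγ : LipschitzWith K γ) {A : Set (hyperplane e)} {S : Set (EuclideanSpace ℝ (Fin d))}
    (hS : graphMap γ '' A ⊆ S) {h : EuclideanSpace ℝ (Fin d) → ℝ≥0∞} (hh : Measurable h) :
    ∫⁻ y in A, h (graphMap γ y) ≤
      ∫⁻ x in S, h x ∂(Measure.euclideanHausdorffMeasure (d - 1)) := by
  have hΓ := lipschitzWith_graphMap he hγ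
  rw [← lintegral_map hh hΓ.continuous.measurable]
  refine lintegral_mono' (Measure.le_iff.2 fun T hT => ?_) le_rfl
  have hT' := hΓ.continuous.measurable hT
  rw [Measure.restrict_apply hT, Measure.map_apply hΓ.continuous.measurable hT,
    Measure.restrict_apply hT', volume_hyperplane he hd]
  have h1 := euclideanHausdorffMeasure_image_le
    ((hyperplane e).lipschitzWith_orthogonalProjectionOnto) (d - 1) (T ∩ S)
  rw [ENNReal.coe_one, one_pow, one_mul] at h1
  refine (measure_mono ?_).trans h1
  rintro y ⟨hyT, hyA⟩
  exact ⟨graphMap γ y, ⟨hyT, hS ⟨y, hyA, rfl⟩⟩, proj_graphMap he γ y⟩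

end Graph

/-! ## One-dimensional estimates -/

section Line

open scoped ENNReal

lemma ennreal_add_sq_le (a b : ℝ≥0∞) : (a + b) ^ 2 ≤ 2 * a ^ 2 + 2 * b ^ 2 := by
  have := ENNReal.rpow_add_le_mul_rpow_add_rpow a b (p := 2) (by norm_num)
  norm_num at this
  rwa [mul_add] at this

/-- Hölder's inequality with the constant function 1 and exponents 2, 2. -/
lemma sq_lintegral_le {X : Type*} [MeasurableSpace X] {μ : Measure X} {f : X → ℝ≥0∞}
    (hf : AEMeasurable f μ) : (∫⁻ x, f x ∂μ) ^ 2 ≤ μ Set.univ * ∫⁻ x, f x ^ 2 ∂μ := by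
  have := ENNReal.lintegral_mul_le_Lp_mul_Lq μ
    Real.HolderConjugate.two_two (f := fun _ => 1) (g := f) aemeasurable_const hf
  simp only [Pi.mul_apply, one_mul, lintegral_const, ENNReal.rpow_two] at this
  refine (pow_le_pow_left' this 2).trans (le_of_eq ?_)
  have h2 : ∀ a : ℝ≥0∞, (a ^ (1 / 2 : ℝ)) ^ 2 = a := fun a => by
    rw [← ENNReal.rpow_natCast, ← ENNReal.rpow_mul]; norm_num
  rw [mul_pow, h2, h2, one_pow, one_mul]

/-- The values of a `C¹` function on an interval differ by at most its variation. -/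
lemma enorm_sq_le_of_hasDerivAt {g g' : ℝ → ℂ} (hg : ∀ t, HasDerivAt g (g' t) t)
    (hc : Continuous g') {s a b : ℝ} (ha : a ∈ Set.Icc 0 s) (hb : b ∈ Set.Icc 0 s) :
    ‖g a‖ₑ ^ 2 ≤ 2 * ‖g b‖ₑ ^ 2 + 2 * ENNReal.ofReal s * ∫⁻ t in Set.Ioo 0 s, ‖g' t‖ₑ ^ 2 := by
  have h1 : g a - g b = ∫ t in b..a, g' t :=
    (intervalIntegral.integral_eq_sub_of_hasDerivAt (fun t _ => hg t)
      (hc.intervalIntegrable _ _)).symm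
  have h2 : ‖g a - g b‖ₑ ≤ ∫⁻ t in Set.Ioo 0 s, ‖g' t‖ₑ := by
    have h5 : ‖∫ t in b..a, g' t‖ₑ = ‖∫ t in Set.uIoc b a, g' t‖ₑ := by
      simpa only [ofReal_norm] using congrArg ENNReal.ofReal
        (intervalIntegral.norm_integral_eq_norm_integral_uIoc (μ := volume) g')
    rw [h1, h5]
    refine (enorm_integral_le_lintegral_enorm _).trans ?_
    rw [Measure.restrict_congr_set Ioo_ae_eq_Ioc]
    refine lintegral_mono_set ?_
    rw [Set.uIoc]
    exact Set.Ioc_subset_Ioc (le_min hb.1 ha.1) (max_le hb.2 ha.2)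
  have h3 := sq_lintegral_le (μ := volume.restrict (Set.Ioo 0 s)) hc.enorm.measurable.aemeasurable
  rw [Measure.restrict_apply_univ, Real.volume_Ioo, sub_zero] at h3
  have h4 : ‖g a‖ₑ ≤ ‖g b‖ₑ + ‖g a - g b‖ₑ := by
    have := enorm_add_le (g b) (g a - g b)
    rwa [add_sub_cancel] at this
  calc ‖g a‖ₑ ^ 2 ≤ (‖g b‖ₑ + ‖g a - g b‖ₑ) ^ 2 := pow_le_pow_left' h4 2
    _ ≤ 2 * ‖g b‖ₑ ^ 2 + 2 * ‖g a - g b‖ₑ ^ 2 :=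
        ennreal_add_sq_le _ _
    _ ≤ _ := by
        rw [mul_assoc]
        gcongr
        exact (pow_le_pow_left' h2 2).trans h3

end Line

/-! ## Boundary charts of Lipschitz domains -/

section Charts

open scoped ENNReal NNReal
open Set Metric

variable {d : ℕ} {Ω : Set (EuclideanSpace ℝ (Fin d))}

/-- The height of a point over the graph of `γ` in direction `e`. -/
noncomputable def height (e : EuclideanSpace ℝ (Fin d)) (γ : EuclideanSpace ℝ (Fin d) → ℝ)
    (x : EuclideanSpace ℝ (Fin d)) : ℝ :=
  ⟪e, x⟫_ℝ - γ (x - ⟪e, x⟫_ℝ • e)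

variable {e : EuclideanSpace ℝ (Fin d)} {γ : EuclideanSpace ℝ (Fin d) → ℝ} {K : ℝ≥0}

lemma norm_sub_inner_smul_le (he : ‖e‖ = 1) (x : EuclideanSpace ℝ (Fin d)) :
    ‖x - ⟪e, x⟫_ℝ • e‖ ≤ ‖x‖ := by
  rw [← coe_proj_hyperplane he]
  exact Submodule.norm_orthogonalProjectionOnto_apply_le _ x

/-- The component along `e` contributes 1 to the constant, and `γ` composed with the norm-decreasing
projection contributes `K`. -/
lemma abs_height_sub_le (he : ‖e‖ = 1) (hγ : LipschitzWith K γ) (x z : EuclideanSpace ℝ (Fin d)) :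
    |height e γ x - height e γ z| ≤ (1 + K) * ‖x - z‖ := by
  have h1 := hγ.dist_le_mul (x - ⟪e, x⟫_ℝ • e) (z - ⟪e, z⟫_ℝ • e)
  rw [Real.dist_eq, dist_eq_norm] at h1
  have h2 : x - ⟪e, x⟫_ℝ • e - (z - ⟪e, z⟫_ℝ • e) = (x - z) - ⟪e, x - z⟫_ℝ • e := by
    rw [inner_sub_right]; module
  have h3 : |⟪e, x - z⟫_ℝ| ≤ ‖x - z‖ := by
    have := abs_real_inner_le_norm e (x - z)
    rwa [he, one_mul] at this
  rw [h2] at h1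
  have h4 := mul_le_mul_of_nonneg_left (norm_sub_inner_smul_le he (x - z)) K.2
  rw [inner_sub_right] at h3
  have h5 : height e γ x - height e γ z = (⟪e, x⟫_ℝ - ⟪e, z⟫_ℝ)
      - (γ (x - ⟪e, x⟫_ℝ • e) - γ (z - ⟪e, z⟫_ℝ • e)) := by simp only [height]; ring
  rw [h5]
  refine (abs_sub _ _).trans ?_
  have h6 : (K : ℝ) * ‖x - z - ⟪e, x - z⟫_ℝ • e‖ ≤ K * ‖x - z‖ := h4
  linarith

lemma continuous_height (he : ‖e‖ = 1) (hγ : LipschitzWith K γ) : Continuous (height e γ) :=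
  (LipschitzWith.of_dist_le_mul (K := 1 + K) fun x z => by
    rw [Real.dist_eq, dist_eq_norm]; exact_mod_cast abs_height_sub_le he hγ x z).continuous

lemma height_add_smul (he : ‖e‖ = 1) (x : EuclideanSpace ℝ (Fin d)) (t : ℝ) :
    height e γ (x + t • e) = height e γ x + t := by
  have h1 : ⟪e, x + t • e⟫_ℝ = ⟪e, x⟫_ℝ + t := by
    rw [inner_add_right, inner_smul_right, real_inner_self_eq_norm_sq, he]; simp
  have h2 : x + t • e - (⟪e, x⟫_ℝ + t) • e = x - ⟪e, x⟫_ℝ • e := by module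
  rw [height, height, h1, h2]; ring

lemma height_graphMap (he : ‖e‖ = 1) (y : hyperplane e) : height e γ (graphMap γ y) = 0 := by
  rw [height, graphMap, hyperplane_add_sub he, inner_hyperplane_add he, sub_self]

lemma graphMap_proj_add (he : ‖e‖ = 1) (x : EuclideanSpace ℝ (Fin d)) :
    graphMap γ ((hyperplane e).orthogonalProjectionOnto x) + height e γ x • e = x := by
  rw [graphMap, coe_proj_hyperplane he, height]
  module

/-- A boundary chart: in the ball of radius `R` around `p` the set `Ω` is the epigraph of `γ`. -/
structure IsChart (Ω : Set (EuclideanSpace ℝ (Fin d))) (p e : EuclideanSpace ℝ (Fin d))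
    (γ : EuclideanSpace ℝ (Fin d) → ℝ) (K : ℝ≥0) (R : ℝ) : Prop where
  isOpen : IsOpen Ω
  norm_eq : ‖e‖ = 1
  lipschitz : LipschitzWith K γ
  pos : 0 < R
  mem_frontier : p ∈ frontier Ω
  mem_iff : ∀ y ∈ ball p R, y ∈ Ω ↔ 0 < height e γ y

lemma IsBoundedLipschitzDomain.exists_chart (hΩ : IsBoundedLipschitzDomain Ω)
    {p : EuclideanSpace ℝ (Fin d)} (hp : p ∈ frontier Ω) : ∃ e γ K R, IsChart Ω p e γ K R := by
  obtain ⟨e, he, γ, K, hγ, h⟩ := hΩ.locally_graph p hp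
  obtain ⟨R, hR, hR'⟩ := Metric.eventually_nhds_iff_ball.1 h
  exact ⟨e, γ, K, R, hΩ.isOpen, he, hγ, hR, hp, fun y hy => by rw [hR' y hy, height, sub_pos]⟩

namespace IsChart

variable {p : EuclideanSpace ℝ (Fin d)} {R : ℝ}

/-- Positive height would put `y` into the open set `Ω`. Negative height persists nearby and would
keep a neighbourhood of `y` away from `Ω`. -/
lemma height_eq_zero (h : IsChart Ω p e γ K R) {y : EuclideanSpace ℝ (Fin d)} (hy : y ∈ ball p R)
    (hf : y ∈ frontier Ω) : height e γ y = 0 := by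
  refine le_antisymm ?_ ?_
  · by_contra! hpos
    have : y ∈ Ω := (h.mem_iff y hy).2 hpos
    rw [h.isOpen.frontier_eq] at hf
    exact hf.2 this
  · by_contra! hneg
    have h1 : ∀ᶠ z in 𝓝 y, z ∈ ball p R ∧ height e γ z < 0 :=
      (isOpen_ball.eventually_mem hy).and
        ((continuous_height h.norm_eq h.lipschitz).continuousAt.eventually_lt_const hneg)
    obtain ⟨z, hz, hzΩ⟩ := (mem_closure_iff_frequently.1 hf.1).and_eventually h1 |>.exists
    exact absurd ((h.mem_iff z hzΩ.1).1 hz) (not_lt.2 hzΩ.2.le)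

/-- Moving up along `e` enters `Ω` at once, so `y` is a limit of points of `Ω` without belonging to
it. -/
lemma mem_frontier_of_height (h : IsChart Ω p e γ K R) {y : EuclideanSpace ℝ (Fin d)}
    (hy : y ∈ ball p R) (hf : height e γ y = 0) : y ∈ frontier Ω := by
  rw [h.isOpen.frontier_eq]
  refine ⟨?_, fun hy' => ((h.mem_iff y hy).1 hy').ne' hf⟩
  have hc : ContinuousWithinAt (fun t : ℝ => y + t • e) (Ioi 0) 0 := by fun_prop
  have h0 : Filter.Tendsto (fun t : ℝ => y + t • e) (𝓝[>] 0) (𝓝 y) := by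
    simpa [ContinuousWithinAt] using hc
  refine mem_closure_of_tendsto h0 ?_
  filter_upwards [h0 (isOpen_ball.mem_nhds hy), self_mem_nhdsWithin] with t ht ht'
  rw [h.mem_iff _ ht, height_add_smul h.norm_eq, hf, zero_add]
  exact ht'

/-- The radius of the smaller ball in which the estimates are carried out. -/
noncomputable def radius (K : ℝ≥0) (R : ℝ) : ℝ := R / (3 + K)

lemma radius_pos (h : IsChart Ω p e γ K R) : 0 < radius K R := div_pos h.pos (by positivity)

lemma radius_mul (K : ℝ≥0) (R : ℝ) : radius K R * (3 + K) = R :=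
  div_mul_cancel₀ _ (by positivity)

/-- The parameter domain of the chart. -/
def base (e p : EuclideanSpace ℝ (Fin d)) (K : ℝ≥0) (R : ℝ) : Set (hyperplane e) :=
  ball ((hyperplane e).orthogonalProjectionOnto p) (radius K R)

lemma proj_mem_base {x : EuclideanSpace ℝ (Fin d)} (hx : x ∈ ball p (radius K R)) :
    (hyperplane e).orthogonalProjectionOnto x ∈ base e p K R := by
  rw [base, mem_ball, dist_eq_norm, ← map_sub]
  refine (Submodule.norm_orthogonalProjectionOnto_apply_le _ _).trans_lt ?_
  rwa [mem_ball, dist_eq_norm] at hx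

/-- The centre `p` lies on the graph. The base contributes less than `(1 + K) r` and the vertical
shift at most `r`, where `r` is `radius K R`, and `(3 + K) r = R`. -/
lemma graphMap_add_mem_ball (h : IsChart Ω p e γ K R) {y : hyperplane e} (hy : y ∈ base e p K R)
    {t : ℝ} (ht : |t| ≤ radius K R) : graphMap γ y + t • e ∈ ball p R := by
  have h1 := (lipschitzWith_graphMap h.norm_eq h.lipschitz).dist_le_mul y
    ((hyperplane e).orthogonalProjectionOnto p)
  have h2 := graphMap_proj_add (γ := γ) h.norm_eq p
  rw [h.height_eq_zero (mem_ball_self h.pos) h.mem_frontier, zero_smul, add_zero] at h2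
  rw [h2] at h1
  have h3 : dist (graphMap γ y + t • e) (graphMap γ y) ≤ radius K R := by
    rw [dist_self_add_left, norm_smul, h.norm_eq, mul_one]; exact ht
  have h4 := dist_triangle (graphMap γ y + t • e) (graphMap γ y) p
  have h5 : dist y ((hyperplane e).orthogonalProjectionOnto p) < radius K R := hy
  have h6 := radius_mul K R
  have h7 := h.radius_pos
  rw [mem_ball]
  push_cast at h1
  nlinarith [K.2]

lemma graphMap_mem_frontier (h : IsChart Ω p e γ K R) {y : hyperplane e} (hy : y ∈ base e p K R) :
    graphMap γ y ∈ frontier Ω := by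
  have := h.graphMap_add_mem_ball hy (t := 0) (by rw [abs_zero]; exact h.radius_pos.le)
  rw [zero_smul, add_zero] at this
  exact h.mem_frontier_of_height this (height_graphMap h.norm_eq y)

lemma graphMap_add_mem (h : IsChart Ω p e γ K R) {y : hyperplane e} (hy : y ∈ base e p K R)
    {t : ℝ} (ht : 0 < t) (ht' : t ≤ radius K R) : graphMap γ y + t • e ∈ Ω := by
  rw [h.mem_iff _ (h.graphMap_add_mem_ball hy (by rwa [abs_of_pos ht])),
    height_add_smul h.norm_eq, height_graphMap h.norm_eq, zero_add]
  exact ht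

lemma radius_lt (h : IsChart Ω p e γ K R) : 2 * radius K R < R := by
  have h6 := radius_mul K R
  have h7 := h.radius_pos
  nlinarith [mul_nonneg h7.le K.2]

lemma frontier_inter_ball_subset (h : IsChart Ω p e γ K R) :
    frontier Ω ∩ ball p (radius K R) ⊆ graphMap γ '' base e p K R := by
  rintro x ⟨hx, hxb⟩
  have hxR : x ∈ ball p R := ball_subset_ball (by linarith [h.radius_lt, h.radius_pos]) hxb
  refine ⟨_, proj_mem_base hxb, ?_⟩
  have := graphMap_proj_add (γ := γ) h.norm_eq x
  rwa [h.height_eq_zero hxR hx, zero_smul, add_zero] at this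

end IsChart

/-- The points of `Ω` at distance less than `τ` from the complement. -/
def strip (Ω : Set (EuclideanSpace ℝ (Fin d))) (τ : ℝ) : Set (EuclideanSpace ℝ (Fin d)) :=
  Ω ∩ {x | infDist x Ωᶜ < τ}

lemma isOpen_strip (hΩ : IsOpen Ω) (τ : ℝ) : IsOpen (strip Ω τ) :=
  hΩ.inter (isOpen_lt (continuous_infDist_pt _) continuous_const)

lemma measurable_gradC {φ : EuclideanSpace ℝ (Fin d) → ℂ} (h : ContDiff ℝ ∞ φ) :
    Measurable (gradC φ) := (contDiff_gradC h).continuous.measurable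

lemma fderiv_apply_eq_sum (φ : EuclideanSpace ℝ (Fin d) → ℂ) (x v : EuclideanSpace ℝ (Fin d)) :
    fderiv ℝ φ x v = ∑ i, v i * gradC φ x i := by
  have : v = ∑ i, v i • EuclideanSpace.single i (1 : ℝ) := by
    ext j; simp [Finset.sum_apply, Pi.single_apply]
  conv_lhs => rw [this]
  simp [gradC, map_sum]

/-- Cauchy–Schwarz in ℂᵈ, after regarding the real direction `v` as a complex vector of the same
norm. -/
lemma norm_fderiv_apply_le (φ : EuclideanSpace ℝ (Fin d) → ℂ) (x v : EuclideanSpace ℝ (Fin d)) :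
    ‖fderiv ℝ φ x v‖ ≤ ‖v‖ * ‖gradC φ x‖ := by
  rw [fderiv_apply_eq_sum]
  have : ∑ i, (v i : ℂ) * gradC φ x i =
      ⟪(WithLp.toLp 2 fun i => (v i : ℂ) : EuclideanSpace ℂ (Fin d)), gradC φ x⟫_ℂ := by
    simp [PiLp.inner_apply, mul_comm]
  rw [this]
  refine (norm_inner_le_norm _ _).trans (le_of_eq ?_)
  congr 1
  simp [EuclideanSpace.norm_eq]

/-- The variation along a segment is controlled by the gradient. -/
lemma enorm_sq_segment_le (he : ‖e‖ = 1) {φ : EuclideanSpace ℝ (Fin d) → ℂ} (hφ : ContDiff ℝ ∞ φ)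
    (x : EuclideanSpace ℝ (Fin d)) {s a b : ℝ} (ha : a ∈ Icc 0 s) (hb : b ∈ Icc 0 s) :
    ‖φ (x + a • e)‖ₑ ^ 2 ≤ 2 * ‖φ (x + b • e)‖ₑ ^ 2
      + 2 * ENNReal.ofReal s * ∫⁻ t in Ioo 0 s, ‖gradC φ (x + t • e)‖ₑ ^ 2 := by
  have hd : ∀ t : ℝ, HasDerivAt (fun t : ℝ => φ (x + t • e)) (fderiv ℝ φ (x + t • e) e) t := by
    intro t
    have h1 : HasDerivAt (fun t : ℝ => x + t • e) e t := by
      simpa using ((hasDerivAt_id t).smul_const e).const_add x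
    exact ((hφ.differentiable (by simp) (x + t • e)).hasFDerivAt).comp_hasDerivAt t h1
  have hc : Continuous fun t : ℝ => fderiv ℝ φ (x + t • e) e :=
    ((hφ.continuous_fderiv (by simp)).comp (by fun_prop)).clm_apply continuous_const
  refine (enorm_sq_le_of_hasDerivAt hd hc ha hb).trans ?_
  gcongr with t
  rw [← ofReal_norm, ← ofReal_norm]
  refine ENNReal.ofReal_le_ofReal ?_
  simpa [he] using norm_fderiv_apply_le φ (x + t • e) e

/-- The map `(y, t) ↦ graphMap γ y + t • e` preserves volume. Containment of the image of a product
set in `B` gives one inequality, and the next lemma gives the other. -/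
lemma lintegral_chart_le (he : ‖e‖ = 1) {A : Set (hyperplane e)}
    {I : Set ℝ} {B : Set (EuclideanSpace ℝ (Fin d))} (hA : MeasurableSet A) (hI : MeasurableSet I)
    (hB : MeasurableSet B) {h : EuclideanSpace ℝ (Fin d) → ℝ≥0∞} (hh : Measurable h)
    (hAB : ∀ y ∈ A, ∀ t ∈ I, graphMap γ y + t • e ∈ B) :
    ∫⁻ y in A, ∫⁻ t in I, h (graphMap γ y + t • e) ≤ ∫⁻ x in B, h x := by
  classical
  rw [← lintegral_indicator hB, lintegral_eq_graph he (γ := γ) (hh.indicator hB),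
    ← lintegral_indicator hA]
  refine lintegral_mono fun y => ?_
  rw [indicator_apply]
  split_ifs with hy
  · rw [← lintegral_indicator hI]
    refine lintegral_mono fun t => ?_
    rw [indicator_apply]
    split_ifs with ht
    · have := hAB y hy t ht
      rw [graphMap, add_assoc, ← add_smul] at this ⊢
      rw [indicator_of_mem this]
    · exact zero_le
  · exact zero_le

lemma lintegral_le_chart (he : ‖e‖ = 1) {A : Set (hyperplane e)}
    {I : Set ℝ} {B : Set (EuclideanSpace ℝ (Fin d))} (hA : MeasurableSet A) (hI : MeasurableSet I)
    (hB : MeasurableSet B) {h : EuclideanSpace ℝ (Fin d) → ℝ≥0∞} (hh : Measurable h)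
    (hAB : ∀ x ∈ B, (hyperplane e).orthogonalProjectionOnto x ∈ A ∧ height e γ x ∈ I) :
    ∫⁻ x in B, h x ≤ ∫⁻ y in A, ∫⁻ t in I, h (graphMap γ y + t • e) := by
  classical
  rw [← lintegral_indicator hB, lintegral_eq_graph he (γ := γ) (hh.indicator hB),
    ← lintegral_indicator hA]
  refine lintegral_mono fun y => ?_
  have key : ∀ t : ℝ, (y : EuclideanSpace ℝ (Fin d)) + (γ y + t) • e ∈ B → y ∈ A ∧ t ∈ I := by
    intro t ht
    have h1 := hAB _ ht
    have h2 : (y : EuclideanSpace ℝ (Fin d)) + (γ y + t) • e = graphMap γ y + t • e := by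
      rw [graphMap, add_smul, add_assoc]
    have h3 : (hyperplane e).orthogonalProjectionOnto e = 0 := by
      refine Subtype.ext ?_
      rw [coe_proj_hyperplane he, real_inner_self_eq_norm_sq, he]
      simp
    rwa [h2, map_add, map_smul, h3, smul_zero, add_zero, proj_graphMap he, height_add_smul he,
      height_graphMap he, zero_add] at h1
  rw [indicator_apply]
  split_ifs with hy
  · rw [← lintegral_indicator hI]
    refine lintegral_mono fun t => ?_
    by_cases ht : (y : EuclideanSpace ℝ (Fin d)) + (γ y + t) • e ∈ B
    · rw [indicator_of_mem ht, indicator_of_mem (key t ht).2, graphMap, add_smul, add_assoc]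
    · rw [indicator_of_notMem ht]; exact zero_le
  · have : (fun t : ℝ => B.indicator h ((y : EuclideanSpace ℝ (Fin d)) + (γ y + t) • e)) = 0 :=
      funext fun t => indicator_of_notMem (fun ht => hy (key t ht).1) _
    rw [this]
    exact lintegral_zero_fun.le

end Charts

/-! ### Trace and strip inequalities for smooth functions -/

section Estimates

open scoped ENNReal NNReal
open Set Metric

variable {d : ℕ} {Ω : Set (EuclideanSpace ℝ (Fin d))}

lemma infDist_compl_lt {x z : EuclideanSpace ℝ (Fin d)} {τ : ℝ} (hz : z ∉ Ω) (h : dist x z < τ) :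
    infDist x Ωᶜ < τ :=
  (infDist_le_dist_of_mem (show z ∈ Ωᶜ from hz)).trans_lt h

namespace IsChart

variable {p e : EuclideanSpace ℝ (Fin d)} {γ : EuclideanSpace ℝ (Fin d) → ℝ} {K : ℝ≥0} {R : ℝ}

lemma graphMap_add_mem_strip (h : IsChart Ω p e γ K R) {y : hyperplane e} (hy : y ∈ base e p K R)
    {t τ : ℝ} (ht : t ∈ Ioo 0 τ) (hτ : τ ≤ radius K R) : graphMap γ y + t • e ∈ strip Ω τ := by
  refine ⟨h.graphMap_add_mem hy ht.1 (ht.2.le.trans hτ), infDist_compl_lt (z := graphMap γ y) ?_ ?_⟩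
  · have := h.graphMap_mem_frontier hy
    rw [h.isOpen.frontier_eq] at this
    exact this.2
  · rw [dist_self_add_left, norm_smul, h.norm_eq, mul_one, Real.norm_eq_abs, abs_of_pos ht.1]
    exact ht.2

/-- The local trace inequality. -/
lemma trace_estimate (h : IsChart Ω p e γ K R) (hd : 1 ≤ d) {τ : ℝ} (hτ : 0 < τ)
    (hτ' : τ ≤ radius K R) {φ : EuclideanSpace ℝ (Fin d) → ℂ} (hφ : ContDiff ℝ ∞ φ) :
    ENNReal.ofReal τ * ∫⁻ x in ball p (radius K R), ‖φ x‖ₑ ^ 2 ∂surfaceMeasure Ω ≤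
      (((1 + K : ℝ≥0) : ℝ≥0∞) ^ (d - 1) * 2) * ((∫⁻ x in Ω, ‖φ x‖ₑ ^ 2)
        + ENNReal.ofReal τ ^ 2 * ∫⁻ x in Ω, ‖gradC φ x‖ₑ ^ 2) := by
  have hm : Measurable fun x => ‖φ x‖ₑ ^ 2 := (hφ.continuous.measurable.enorm).pow_const 2
  have hm' : Measurable fun x => ‖gradC φ x‖ₑ ^ 2 := (measurable_gradC hφ).enorm.pow_const 2
  have hA : MeasurableSet (base e p K R) := measurableSet_ball
  have hΓc : Continuous (graphMap (e := e) γ) :=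
    (lipschitzWith_graphMap h.norm_eq h.lipschitz).continuous
  have hΓ : Measurable fun y : hyperplane e => ‖φ (graphMap γ y)‖ₑ ^ 2 :=
    hm.comp hΓc.measurable
  have hmem : ∀ y ∈ base e p K R, ∀ t ∈ Ioo (0 : ℝ) τ, graphMap γ y + t • e ∈ Ω :=
    fun y hy t ht => h.graphMap_add_mem hy ht.1 (ht.2.le.trans hτ')
  have h1 : ∫⁻ x in ball p (radius K R), ‖φ x‖ₑ ^ 2 ∂surfaceMeasure Ω ≤
      ((1 + K : ℝ≥0) : ℝ≥0∞) ^ (d - 1) * ∫⁻ y in base e p K R, ‖φ (graphMap γ y)‖ₑ ^ 2 := by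
    rw [surfaceMeasure, Measure.restrict_restrict measurableSet_ball, inter_comm]
    exact lintegral_surface_le h.norm_eq hd h.lipschitz h.frontier_inter_ball_subset hm
  -- The boundary value is compared with the value at each height `t`, then integrated over `t` in
  -- `(0, τ)`. This produces the factor `τ` on the left.
  have h2 : ∀ y : hyperplane e, ENNReal.ofReal τ * ‖φ (graphMap γ y)‖ₑ ^ 2 ≤
      2 * (∫⁻ t in Ioo 0 τ, ‖φ (graphMap γ y + t • e)‖ₑ ^ 2)
        + 2 * ENNReal.ofReal τ ^ 2 * ∫⁻ t in Ioo 0 τ, ‖gradC φ (graphMap γ y + t • e)‖ₑ ^ 2 := by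
    intro y
    have h3 : ∀ t ∈ Ioo 0 τ, ‖φ (graphMap γ y)‖ₑ ^ 2 ≤ 2 * ‖φ (graphMap γ y + t • e)‖ₑ ^ 2
        + 2 * ENNReal.ofReal τ * ∫⁻ t in Ioo 0 τ, ‖gradC φ (graphMap γ y + t • e)‖ₑ ^ 2 := by
      intro t ht
      have := enorm_sq_segment_le h.norm_eq hφ (graphMap γ y) (s := τ) (a := 0)
        ⟨le_rfl, hτ.le⟩ ⟨ht.1.le, ht.2.le⟩
      rwa [zero_smul, add_zero] at this
    have hmt : Measurable fun t : ℝ => ‖φ (graphMap γ y + t • e)‖ₑ ^ 2 :=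
      hm.comp (by fun_prop : Measurable fun t : ℝ => graphMap γ y + t • e)
    have h4 := setLIntegral_mono (μ := volume) ((hmt.const_mul 2).add_const _) h3
    rw [setLIntegral_const, Real.volume_Ioo, sub_zero, lintegral_add_right _ measurable_const,
      lintegral_const_mul _ hmt, setLIntegral_const, Real.volume_Ioo,
      sub_zero] at h4
    rw [mul_comm]
    refine h4.trans (le_of_eq ?_)
    ring
  have hmy : ∀ {f : EuclideanSpace ℝ (Fin d) → ℝ≥0∞}, Measurable f →
      Measurable fun y : hyperplane e => ∫⁻ t in Ioo 0 τ, f (graphMap γ y + t • e) := by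
    intro f hf
    exact (hf.comp (Continuous.measurable (by fun_prop) : Measurable fun q : hyperplane e × ℝ =>
      graphMap γ q.1 + q.2 • e)).lintegral_prod_right'
  have h5 := lintegral_chart_le h.norm_eq hA measurableSet_Ioo h.isOpen.measurableSet hm hmem
  have h6 := lintegral_chart_le h.norm_eq hA measurableSet_Ioo h.isOpen.measurableSet hm' hmem
  calc _ ≤ ((1 + K : ℝ≥0) : ℝ≥0∞) ^ (d - 1) *
        ∫⁻ y in base e p K R, ENNReal.ofReal τ * ‖φ (graphMap γ y)‖ₑ ^ 2 := by
        rw [lintegral_const_mul _ hΓ, mul_left_comm]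
        gcongr
    _ ≤ ((1 + K : ℝ≥0) : ℝ≥0∞) ^ (d - 1) *
        (2 * (∫⁻ y in base e p K R, ∫⁻ t in Ioo 0 τ, ‖φ (graphMap γ y + t • e)‖ₑ ^ 2)
        + 2 * ENNReal.ofReal τ ^ 2 *
          ∫⁻ y in base e p K R, ∫⁻ t in Ioo 0 τ, ‖gradC φ (graphMap γ y + t • e)‖ₑ ^ 2) := by
        rw [← lintegral_const_mul _ (hmy hm), ← lintegral_const_mul _ (hmy hm'),
          ← lintegral_add_left ((hmy hm).const_mul 2)]
        gcongr with y
        exact h2 y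
    _ ≤ ((1 + K : ℝ≥0) : ℝ≥0∞) ^ (d - 1) * (2 * (∫⁻ x in Ω, ‖φ x‖ₑ ^ 2)
        + 2 * ENNReal.ofReal τ ^ 2 * ∫⁻ x in Ω, ‖gradC φ x‖ₑ ^ 2) := by
        gcongr
    _ = _ := by ring

/-- The local estimate in a boundary strip. -/
lemma strip_estimate (h : IsChart Ω p e γ K R) (hd : 1 ≤ d) {τ : ℝ} (hτ : 0 < τ)
    (hτ' : τ ≤ radius K R) {φ : EuclideanSpace ℝ (Fin d) → ℂ} (hφ : ContDiff ℝ ∞ φ) :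
    ∫⁻ x in strip Ω (τ / (1 + K)) ∩ ball p (radius K R), ‖φ x‖ₑ ^ 2 ≤
      2 * (ENNReal.ofReal τ * (∫⁻ x, ‖φ x‖ₑ ^ 2 ∂surfaceMeasure Ω)
        + ENNReal.ofReal τ ^ 2 * ∫⁻ x in strip Ω τ, ‖gradC φ x‖ₑ ^ 2) := by
  have hm : Measurable fun x => ‖φ x‖ₑ ^ 2 := (hφ.continuous.measurable.enorm).pow_const 2
  have hm' : Measurable fun x => ‖gradC φ x‖ₑ ^ 2 := (measurable_gradC hφ).enorm.pow_const 2
  have hA : MeasurableSet (base e p K R) := measurableSet_ball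
  have hΓc : Continuous (graphMap (e := e) γ) :=
    (lipschitzWith_graphMap h.norm_eq h.lipschitz).continuous
  have hΓ : Measurable fun y : hyperplane e => ‖φ (graphMap γ y)‖ₑ ^ 2 :=
    hm.comp hΓc.measurable
  have hp : p ∈ Ωᶜ := by
    have := h.mem_frontier
    rw [h.isOpen.frontier_eq] at this
    exact this.2
  -- A point of the strip has a point `z ∉ Ω` within `τ / (1 + K)`. This `z` is still in the chart
  -- and has height at most 0, and height is `(1 + K)`-Lipschitz, so `x` has height below `τ`.
  have hmemB : ∀ x ∈ strip Ω (τ / (1 + K)) ∩ ball p (radius K R),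
      (hyperplane e).orthogonalProjectionOnto x ∈ base e p K R ∧ height e γ x ∈ Ioo 0 τ := by
    rintro x ⟨⟨hxΩ, hxτ⟩, hxb⟩
    have hxR : x ∈ ball p R := ball_subset_ball (by linarith [h.radius_lt, h.radius_pos]) hxb
    refine ⟨proj_mem_base hxb, (h.mem_iff x hxR).1 hxΩ, ?_⟩
    obtain ⟨z, hz, hxz⟩ := (infDist_lt_iff ⟨p, hp⟩).1 hxτ
    have hτK : τ / (1 + K) ≤ τ := div_le_self hτ.le (by linarith [K.2, show (0:ℝ) ≤ K from K.2])
    have hzR : z ∈ ball p R := by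
      have h1 := dist_triangle_left z p x
      have h2 : dist x p < radius K R := hxb
      have h3 := h.radius_lt
      rw [mem_ball]
      linarith
    have h1 : height e γ z ≤ 0 := by
      by_contra! hpos
      exact hz ((h.mem_iff z hzR).2 hpos)
    have h2 := (abs_le.1 (abs_height_sub_le h.norm_eq h.lipschitz x z)).2
    rw [← dist_eq_norm] at h2
    have hK : (0 : ℝ) < 1 + K := by positivity
    have h3 := (lt_div_iff₀ hK).1 hxz
    linarith
  have h1 := lintegral_le_chart h.norm_eq hA measurableSet_Ioo
    ((isOpen_strip h.isOpen _).inter isOpen_ball).measurableSet hm hmemB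
  have h2 : ∀ y : hyperplane e, ∫⁻ t in Ioo 0 τ, ‖φ (graphMap γ y + t • e)‖ₑ ^ 2 ≤
      2 * ENNReal.ofReal τ * ‖φ (graphMap γ y)‖ₑ ^ 2
        + 2 * ENNReal.ofReal τ ^ 2 * ∫⁻ t in Ioo 0 τ, ‖gradC φ (graphMap γ y + t • e)‖ₑ ^ 2 := by
    intro y
    have h3 : ∀ t ∈ Ioo 0 τ, ‖φ (graphMap γ y + t • e)‖ₑ ^ 2 ≤ 2 * ‖φ (graphMap γ y)‖ₑ ^ 2
        + 2 * ENNReal.ofReal τ * ∫⁻ t in Ioo 0 τ, ‖gradC φ (graphMap γ y + t • e)‖ₑ ^ 2 := by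
      intro t ht
      have := enorm_sq_segment_le h.norm_eq hφ (graphMap γ y) (s := τ) (b := 0)
        ⟨ht.1.le, ht.2.le⟩ ⟨le_rfl, hτ.le⟩
      rwa [zero_smul, add_zero] at this
    have h4 := setLIntegral_mono (μ := volume) measurable_const h3
    rw [setLIntegral_const, Real.volume_Ioo, sub_zero] at h4
    refine h4.trans (le_of_eq ?_)
    ring
  have hmy : Measurable fun y : hyperplane e =>
      ∫⁻ t in Ioo 0 τ, ‖gradC φ (graphMap γ y + t • e)‖ₑ ^ 2 :=
    (hm'.comp (Continuous.measurable (by fun_prop) : Measurable fun q : hyperplane e × ℝ =>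
      graphMap γ q.1 + q.2 • e)).lintegral_prod_right'
  have h5 := lintegral_graph_le h.norm_eq hd h.lipschitz
    (image_subset_iff.2 fun y hy => h.graphMap_mem_frontier hy) hm
  -- The segments used stay in the strip of width `τ`, so only the gradient there enters. This
  -- localisation is what `mem_H10` relies on.
  have h6 := lintegral_chart_le h.norm_eq hA measurableSet_Ioo
    (isOpen_strip h.isOpen τ).measurableSet hm'
    fun y hy t ht => h.graphMap_add_mem_strip hy ht hτ'
  calc _ ≤ _ := h1
    _ ≤ ∫⁻ y in base e p K R, (2 * ENNReal.ofReal τ * ‖φ (graphMap γ y)‖ₑ ^ 2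
        + 2 * ENNReal.ofReal τ ^ 2 *
          ∫⁻ t in Ioo 0 τ, ‖gradC φ (graphMap γ y + t • e)‖ₑ ^ 2) := lintegral_mono h2
    _ = 2 * ENNReal.ofReal τ * (∫⁻ y in base e p K R, ‖φ (graphMap γ y)‖ₑ ^ 2)
        + 2 * ENNReal.ofReal τ ^ 2 * ∫⁻ y in base e p K R,
          ∫⁻ t in Ioo 0 τ, ‖gradC φ (graphMap γ y + t • e)‖ₑ ^ 2 := by
        rw [lintegral_add_left (hΓ.const_mul _),
          lintegral_const_mul _ hΓ, lintegral_const_mul _ hmy]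
    _ ≤ 2 * ENNReal.ofReal τ * (∫⁻ x, ‖φ x‖ₑ ^ 2 ∂surfaceMeasure Ω)
        + 2 * ENNReal.ofReal τ ^ 2 * ∫⁻ x in strip Ω τ, ‖gradC φ x‖ₑ ^ 2 := by
        gcongr
        exact h5
    _ = _ := by ring

end IsChart

/-- A finite atlas of boundary charts. -/
lemma IsBoundedLipschitzDomain.exists_atlas (hΩ : IsBoundedLipschitzDomain Ω) :
    ∃ (ι : Type) (_ : Fintype ι) (p e : ι → EuclideanSpace ℝ (Fin d))
      (γ : ι → EuclideanSpace ℝ (Fin d) → ℝ) (K : ι → ℝ≥0) (R : ι → ℝ),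
      (∀ i, IsChart Ω (p i) (e i) (γ i) (K i) (R i)) ∧
      frontier Ω ⊆ ⋃ i, ball (p i) (IsChart.radius (K i) (R i)) := by
  have hc : IsCompact (frontier Ω) :=
    isCompact_of_isClosed_isBounded isClosed_frontier
      (hΩ.isBounded.closure.subset frontier_subset_closure)
  choose e γ K R h using fun p : frontier Ω => hΩ.exists_chart p.2
  obtain ⟨t, ht⟩ := hc.elim_finite_subcover
    (fun p : frontier Ω => ball (p : EuclideanSpace ℝ (Fin d)) (IsChart.radius (K p) (R p)))
    (fun _ => isOpen_ball) fun x hx => mem_iUnion.2 ⟨⟨x, hx⟩, mem_ball_self (h _).radius_pos⟩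
  obtain ⟨n, ⟨f⟩⟩ := Finite.exists_equiv_fin t
  refine ⟨Fin n, inferInstance, fun i => ((f.symm i : frontier Ω) : EuclideanSpace ℝ (Fin d)),
    fun i => e (f.symm i), fun i => γ (f.symm i),
    fun i => K (f.symm i), fun i => R (f.symm i), fun i => h _, fun x hx => ?_⟩
  obtain ⟨q, hq, hxq⟩ := mem_iUnion₂.1 (ht hx)
  exact mem_iUnion.2 ⟨f ⟨q, hq⟩, by simpa using hxq⟩

lemma exists_pos_le_of_fintype {ι : Type*} [Finite ι] (f : ι → ℝ) (hf : ∀ i, 0 < f i) :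
    ∃ c > 0, ∀ i, c ≤ f i := by
  cases isEmpty_or_nonempty ι
  · exact ⟨1, one_pos, fun i => isEmptyElim i⟩
  · obtain ⟨i, hi⟩ := Finite.exists_min f
    exact ⟨f i, hf i, hi⟩

/-- The trace inequality for smooth functions. -/
lemma IsBoundedLipschitzDomain.trace_estimate (hΩ : IsBoundedLipschitzDomain Ω) (hd : 1 ≤ d) :
    ∃ (C : ℝ≥0) (τ₀ : ℝ), 0 < τ₀ ∧ ∀ τ, 0 < τ → τ ≤ τ₀ → ∀ φ : EuclideanSpace ℝ (Fin d) → ℂ,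
      ContDiff ℝ ∞ φ → ENNReal.ofReal τ * ∫⁻ x, ‖φ x‖ₑ ^ 2 ∂surfaceMeasure Ω ≤
        C * ((∫⁻ x in Ω, ‖φ x‖ₑ ^ 2) + ENNReal.ofReal τ ^ 2 * ∫⁻ x in Ω, ‖gradC φ x‖ₑ ^ 2) := by
  obtain ⟨ι, _, p, e, γ, K, R, h, hcov⟩ := hΩ.exists_atlas
  obtain ⟨τ₀, hτ₀, hτ₀'⟩ := exists_pos_le_of_fintype _ fun i => (h i).radius_pos
  refine ⟨∑ i, (1 + K i) ^ (d - 1) * 2, τ₀, hτ₀, fun τ hτ hτ' φ hφ => ?_⟩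
  have h1 : ∫⁻ x, ‖φ x‖ₑ ^ 2 ∂surfaceMeasure Ω ≤
      ∑ i, ∫⁻ x in ball (p i) (IsChart.radius (K i) (R i)), ‖φ x‖ₑ ^ 2 ∂surfaceMeasure Ω := by
    have h2 : surfaceMeasure Ω ≤
        (surfaceMeasure Ω).restrict (⋃ i, ball (p i) (IsChart.radius (K i) (R i))) := by
      rw [surfaceMeasure, Measure.restrict_restrict (MeasurableSet.iUnion fun i =>
        measurableSet_ball), inter_eq_self_of_subset_right hcov]
    refine (lintegral_mono' h2 le_rfl).trans ((lintegral_iUnion_le _ _).trans ?_)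
    rw [tsum_fintype]
  refine (mul_le_mul_right h1 _).trans ?_
  push_cast
  rw [Finset.mul_sum, Finset.sum_mul]
  refine Finset.sum_le_sum fun i _ => ?_
  simpa using (h i).trace_estimate hd hτ (hτ'.trans (hτ₀' i)) hφ

/-- The trace inequality for the constant function 1 bounds `τ` times the surface area by a multiple
of the volume. -/
lemma IsBoundedLipschitzDomain.isFiniteMeasure_surfaceMeasure (hΩ : IsBoundedLipschitzDomain Ω)
    (hd : 1 ≤ d) : IsFiniteMeasure (surfaceMeasure Ω) := by
  obtain ⟨C, τ, hτ, h⟩ := hΩ.trace_estimate hd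
  have h1 := h τ hτ le_rfl (fun _ => 1) contDiff_const
  have h2 : gradC (fun _ : EuclideanSpace ℝ (Fin d) => (1 : ℂ)) = 0 := by
    ext x i; simp [gradC]
  simp only [h2, enorm_one, one_pow, lintegral_const, one_mul, Pi.zero_apply, enorm_zero,
    Measure.restrict_apply MeasurableSet.univ, univ_inter] at h1
  norm_num at h1
  refine ⟨lt_of_mul_lt_mul_left' (a := ENNReal.ofReal τ) (h1.trans_lt ?_)⟩
  rw [ENNReal.mul_top (by simpa using hτ)]
  exact ENNReal.mul_lt_top ENNReal.coe_lt_top hΩ.isBounded.measure_lt_top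

/-- The estimate in a boundary strip for smooth functions. -/
lemma IsBoundedLipschitzDomain.strip_estimate (hΩ : IsBoundedLipschitzDomain Ω) (hd : 1 ≤ d) :
    ∃ (C : ℝ≥0) (c τ₀ : ℝ), 0 < c ∧ 0 < τ₀ ∧ ∀ τ, 0 < τ → τ ≤ τ₀ →
      ∀ φ : EuclideanSpace ℝ (Fin d) → ℂ, ContDiff ℝ ∞ φ →
      ∫⁻ x in strip Ω (c * τ), ‖φ x‖ₑ ^ 2 ≤
        C * (ENNReal.ofReal τ * (∫⁻ x, ‖φ x‖ₑ ^ 2 ∂surfaceMeasure Ω)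
          + ENNReal.ofReal τ ^ 2 * ∫⁻ x in strip Ω τ, ‖gradC φ x‖ₑ ^ 2) := by
  obtain ⟨ι, _, p, e, γ, K, R, h, hcov⟩ := hΩ.exists_atlas
  obtain ⟨τ₁, hτ₁, hτ₁'⟩ := exists_pos_le_of_fintype _ fun i => (h i).radius_pos
  obtain ⟨c, hc, hc'⟩ := exists_pos_le_of_fintype (fun i => 1 / (1 + (K i : ℝ)))
    fun i => by positivity
  set U := ⋃ i, ball (p i) (IsChart.radius (K i) (R i))
  have hU : IsOpen U := isOpen_iUnion fun i => isOpen_ball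
  -- The part of the closure outside the charts is a compact subset of `Ω`, hence at positive
  -- distance from the complement.
  obtain ⟨ε, hε, hεU⟩ : ∃ ε > 0, strip Ω ε ⊆ U := by
    have hcomp : IsCompact (closure Ω \ U) :=
      hΩ.isBounded.isCompact_closure.diff hU
    have hsub : closure Ω \ U ⊆ Ω := by
      rintro x ⟨hx, hxU⟩
      by_contra hxΩ
      exact hxU (hcov (by rw [hΩ.isOpen.frontier_eq]; exact ⟨hx, hxΩ⟩))
    rcases (closure Ω \ U).eq_empty_or_nonempty with h0 | hne
    · refine ⟨1, one_pos, fun x hx => ?_⟩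
      by_contra hxU
      exact (h0 ▸ (⟨subset_closure hx.1, hxU⟩ : x ∈ closure Ω \ U) : x ∈ (∅ : Set _))
    rcases Ωᶜ.eq_empty_or_nonempty with hΩc | hΩc
    · refine ⟨1, one_pos, ?_⟩
      obtain ⟨x, hx⟩ := hne
      have : Ω = univ := by rwa [compl_empty_iff] at hΩc
      have hb := hΩ.isBounded
      rw [this] at hb
      have : Nontrivial (EuclideanSpace ℝ (Fin d)) := by
        have : Nonempty (Fin d) := ⟨⟨0, hd⟩⟩
        infer_instance
      exact absurd hb (NormedSpace.unbounded_univ ℝ _)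
    · obtain ⟨x₀, hx₀, hmin⟩ := hcomp.exists_isMinOn hne (continuous_infDist_pt Ωᶜ).continuousOn
      refine ⟨infDist x₀ Ωᶜ, ?_, fun x hx => ?_⟩
      · exact (hΩ.isOpen.isClosed_compl.notMem_iff_infDist_pos hΩc).1 fun h => h (hsub hx₀)
      · by_contra hxU
        exact not_lt.2 (isMinOn_iff.1 hmin x ⟨subset_closure hx.1, hxU⟩) (show infDist x Ωᶜ < _ from hx.2)
  -- `τ ≤ ε / c` puts the strip of width `c * τ` inside the charts, and `c ≤ 1 / (1 + K i)` puts it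
  -- inside each local strip.
  refine ⟨∑ _i : ι, 2, c, min τ₁ (ε / c), hc, by positivity, fun τ hτ hτ' φ hφ => ?_⟩
  have h1 : strip Ω (c * τ) ⊆ ⋃ i, strip Ω (τ / (1 + K i)) ∩ ball (p i)
      (IsChart.radius (K i) (R i)) := by
    intro x hx
    have hxε : x ∈ strip Ω ε := ⟨hx.1, hx.2.trans_le (by
      have := (le_div_iff₀ hc).1 (hτ'.trans (min_le_right _ _))
      rwa [mul_comm] at this)⟩
    obtain ⟨i, hi⟩ := mem_iUnion.1 (hεU hxε)
    refine mem_iUnion.2 ⟨i, ⟨hx.1, (show infDist x Ωᶜ < _ from hx.2).trans_le ?_⟩, hi⟩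
    have := mul_le_mul_of_nonneg_right (hc' i) hτ.le
    rwa [one_div, inv_mul_eq_div] at this
  refine (lintegral_mono_set h1).trans ((lintegral_iUnion_le _ _).trans ?_)
  rw [tsum_fintype]
  push_cast
  rw [Finset.sum_mul]
  exact Finset.sum_le_sum fun i _ => by
    simpa using (h i).strip_estimate hd hτ ((hτ'.trans (min_le_left _ _)).trans (hτ₁' i)) hφ

end Estimates

/-! ## Mollification -/

section Mollifiers

open scoped ENNReal NNReal
open Set Metric

lemma eLpNorm_two_sq {X F : Type*} [MeasurableSpace X] {μ : Measure X} [NormedAddCommGroup F]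
    (f : X → F) : eLpNorm f 2 μ ^ 2 = ∫⁻ x, ‖f x‖ₑ ^ 2 ∂μ := by
  have := eLpNorm_nnreal_pow_eq_lintegral (μ := μ) (f := f) (p := 2) (by norm_num)
  simpa using this

lemma enorm_Lp_sq {X F : Type*} [MeasurableSpace X] {μ : Measure X} [NormedAddCommGroup F]
    (f : Lp F 2 μ) : ‖f‖ₑ ^ 2 = ∫⁻ x, ‖f x‖ₑ ^ 2 ∂μ := by
  rw [Lp.enorm_def, eLpNorm_two_sq]

lemma enorm_toLp_sq {X F : Type*} [MeasurableSpace X] {μ : Measure X} [NormedAddCommGroup F]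
    {f : X → F} (hf : MemLp f 2 μ) : ‖hf.toLp f‖ₑ ^ 2 = ∫⁻ x, ‖f x‖ₑ ^ 2 ∂μ := by
  rw [Lp.enorm_toLp, eLpNorm_two_sq]

variable {E : Type*} [NormedAddCommGroup E] [InnerProductSpace ℝ E] [FiniteDimensional ℝ E]
  [MeasurableSpace E] [BorelSpace E] {F : Type*} [NormedAddCommGroup F] [NormedSpace ℝ F]

/-- A smooth compactly supported probability density. -/
structure IsMollifier (ρ : E → ℝ) : Prop where
  smooth : ContDiff ℝ ∞ ρ
  compact : HasCompactSupport ρ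
  nonneg : ∀ x, 0 ≤ ρ x
  integral_eq : ∫ x, ρ x = 1

lemma exists_isMollifier (c : E) {r : ℝ} (hr : 0 < r) :
    ∃ ρ : E → ℝ, IsMollifier ρ ∧ tsupport ρ = closedBall c r := by
  let b : ContDiffBump c := ⟨r / 2, r, by positivity, by linarith⟩
  exact ⟨b.normed volume, ⟨b.contDiff_normed, b.hasCompactSupport_normed, b.nonneg_normed,
    b.integral_normed⟩, b.tsupport_normed_eq⟩

/-- The convolution of `f` with the density `ρ`. -/
noncomputable def mollify (ρ : E → ℝ) (f : E → F) (x : E) : F := ∫ t, ρ t • f (x - t)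

lemma mollify_eq_swap (ρ : E → ℝ) (f : E → F) (x : E) :
    mollify ρ f x = ∫ t, ρ (x - t) • f t :=
  convolution_lsmul_swap (𝕜 := ℝ) (μ := volume) (f := ρ) (g := f) (x := x)

namespace IsMollifier

variable {ρ : E → ℝ}

lemma integrable (h : IsMollifier ρ) : Integrable ρ :=
  h.smooth.continuous.integrable_of_hasCompactSupport h.compact

lemma lintegral_eq (h : IsMollifier ρ) : ∫⁻ x, ENNReal.ofReal (ρ x) = 1 := by
  rw [← ofReal_integral_eq_lintegral_ofReal h.integrable (Filter.Eventually.of_forall h.nonneg),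
    h.integral_eq, ENNReal.ofReal_one]

lemma integrable_mollify (h : IsMollifier ρ) {f : E → F} (hf : LocallyIntegrable f) (x : E) :
    Integrable fun t => ρ t • f (x - t) :=
  h.compact.convolutionExists_left (L := ContinuousLinearMap.lsmul ℝ ℝ) h.smooth.continuous hf x

lemma contDiff_mollify (h : IsMollifier ρ) {f : E → F} (hf : LocallyIntegrable f) :
    ContDiff ℝ ∞ (mollify ρ f) :=
  h.compact.contDiff_convolution_left (μ := volume) (L := ContinuousLinearMap.lsmul ℝ ℝ)
    h.smooth hf

lemma fderiv_mollify (h : IsMollifier ρ) {f : E → F} (hf : LocallyIntegrable f) (x v : E) :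
    fderiv ℝ (mollify ρ f) x v = ∫ t, (fderiv ℝ ρ (x - t) v) • f t := by
  have h1 := h.compact.hasFDerivAt_convolution_left (μ := volume) (ContinuousLinearMap.lsmul ℝ ℝ)
    (h.smooth.of_le (by simp)) hf x
  have h2 : fderiv ℝ (mollify ρ f) x = _ := h1.fderiv
  rw [h2, convolution_eq_swap]
  have h3 : Integrable fun t => ((ContinuousLinearMap.lsmul ℝ ℝ : ℝ →L[ℝ] F →L[ℝ] F).precompL E)
      (fderiv ℝ ρ (x - t)) (f t) :=
    ((h.compact.fderiv ℝ).convolutionExists_left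
      (L := (ContinuousLinearMap.lsmul ℝ ℝ : ℝ →L[ℝ] F →L[ℝ] F).precompL E)
      (h.smooth.continuous_fderiv (by simp)) hf x).integrable_swap
  rw [ContinuousLinearMap.integral_apply h3]
  simp [ContinuousLinearMap.precompL_apply]

/-- Jensen's inequality for the mollification error. -/
lemma enorm_mollify_sub_sq_le [CompleteSpace F] [MeasurableSpace F] [BorelSpace F]
    [SecondCountableTopology F] (h : IsMollifier ρ) {f : E → F} (hm : Measurable f)
    (hf : LocallyIntegrable f) (x : E) :
    ‖mollify ρ f x - f x‖ₑ ^ 2 ≤ ∫⁻ t, ENNReal.ofReal (ρ t) * ‖f (x - t) - f x‖ₑ ^ 2 := by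
  have h1 : mollify ρ f x - f x = ∫ t, ρ t • (f (x - t) - f x) := by
    simp only [smul_sub]
    rw [integral_sub (h.integrable_mollify hf x) (h.integrable.smul_const _),
      integral_smul_const, h.integral_eq, one_smul]
    rfl
  have hmd : Measurable fun t => ENNReal.ofReal (ρ t) :=
    h.smooth.continuous.measurable.ennreal_ofReal
  have hmf : Measurable fun t => ‖f (x - t) - f x‖ₑ :=
    ((hm.comp (measurable_const.sub measurable_id)).sub_const _).enorm
  -- With `ρ` as the density of a probability measure, `sq_lintegral_le` has constant 1.
  have h2 : ‖mollify ρ f x - f x‖ₑ ≤ ∫⁻ t, ‖f (x - t) - f x‖ₑ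
      ∂(volume.withDensity fun t => ENNReal.ofReal (ρ t)) := by
    rw [h1, lintegral_withDensity_eq_lintegral_mul _ hmd hmf]
    refine (enorm_integral_le_lintegral_enorm _).trans (le_of_eq (lintegral_congr fun t => ?_))
    rw [enorm_smul, Pi.mul_apply, Real.enorm_eq_ofReal (h.nonneg t)]
  refine (pow_le_pow_left' h2 2).trans ((sq_lintegral_le hmf.aemeasurable).trans (le_of_eq ?_))
  rw [withDensity_apply _ MeasurableSet.univ, setLIntegral_univ, h.lintegral_eq, one_mul,
    lintegral_withDensity_eq_lintegral_mul _ hmd (hmf.pow_const 2)]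
  rfl

/-- The mollification error in `L²(A)` is at most the modulus of continuity. -/
lemma lintegral_mollify_sub_le [CompleteSpace F] [MeasurableSpace F] [BorelSpace F]
    [SecondCountableTopology F] (h : IsMollifier ρ) {f : E → F} (hm : Measurable f)
    (hf : LocallyIntegrable f) {A : Set E} {M : ℝ≥0∞}
    (hM : ∀ t ∈ tsupport ρ, ∫⁻ x in A, ‖f (x - t) - f x‖ₑ ^ 2 ≤ M) :
    ∫⁻ x in A, ‖mollify ρ f x - f x‖ₑ ^ 2 ≤ M := by
  have hmd : Measurable fun t => ENNReal.ofReal (ρ t) :=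
    h.smooth.continuous.measurable.ennreal_ofReal
  have hmf : Measurable fun q : E × E => ‖f (q.1 - q.2) - f q.1‖ₑ ^ 2 :=
    ((hm.comp (measurable_fst.sub measurable_snd)).sub (hm.comp measurable_fst)).enorm.pow_const 2
  have hmt : ∀ t, Measurable fun x => ‖f (x - t) - f x‖ₑ ^ 2 := fun t =>
    ((hm.comp (measurable_id.sub_const t)).sub hm).enorm.pow_const 2
  calc ∫⁻ x in A, ‖mollify ρ f x - f x‖ₑ ^ 2
      ≤ ∫⁻ x in A, ∫⁻ t, ENNReal.ofReal (ρ t) * ‖f (x - t) - f x‖ₑ ^ 2 :=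
        lintegral_mono fun x => h.enorm_mollify_sub_sq_le hm hf x
    _ = ∫⁻ t, ∫⁻ x in A, ENNReal.ofReal (ρ t) * ‖f (x - t) - f x‖ₑ ^ 2 :=
        lintegral_lintegral_swap (f := fun x t => ENNReal.ofReal (ρ t) * ‖f (x - t) - f x‖ₑ ^ 2)
          ((hmd.comp measurable_snd).mul hmf).aemeasurable
    _ = ∫⁻ t, ENNReal.ofReal (ρ t) * ∫⁻ x in A, ‖f (x - t) - f x‖ₑ ^ 2 := by
        refine lintegral_congr fun t => lintegral_const_mul _ (hmt t)
    _ ≤ ∫⁻ t, ENNReal.ofReal (ρ t) * M := by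
        refine lintegral_mono fun t => ?_
        by_cases ht : t ∈ tsupport ρ
        · dsimp only
          gcongr
          exact hM t ht
        · simp [image_eq_zero_of_notMem_tsupport ht]
    _ = M := by rw [lintegral_mul_const _ hmd, h.lintegral_eq, one_mul]

end IsMollifier

omit [NormedSpace ℝ F] in
/-- Translations are continuous in `L²`. -/
lemma exists_lintegral_translate_sub_le {f : E → F} (hf : MemLp f 2 volume) {ε : ℝ≥0∞} (hε : 0 < ε) :
    ∃ δ > 0, ∀ t, ‖t‖ < δ → ∫⁻ x, ‖f (x - t) - f x‖ₑ ^ 2 ≤ ε := by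
  let g : E → C(E, E) := fun t => ⟨fun x => x - t, by fun_prop⟩
  have hg : Continuous g := ContinuousMap.continuous_of_continuous_uncurry _ (by
    exact continuous_snd.sub continuous_fst)
  have hgm : ∀ t, MeasurePreserving (g t) (volume : Measure E) volume :=
    fun t => measurePreserving_sub_right volume t
  have hc := Continuous.compMeasurePreservingLp (f := fun _ : E => hf.toLp f) continuous_const hg
    hgm (by norm_num)
  have hc' : Filter.Tendsto (fun t => ‖Lp.compMeasurePreserving (g t) (hgm t) (hf.toLp f)
      - Lp.compMeasurePreserving (g 0) (hgm 0) (hf.toLp f)‖ₑ ^ 2) (𝓝 0) (𝓝 0) := by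
    have := ((ENNReal.continuous_pow 2).comp (hc.sub (continuous_const
      (y := Lp.compMeasurePreserving (g 0) (hgm 0) (hf.toLp f)))).enorm).tendsto 0
    simpa [Function.comp_def] using this
  obtain ⟨δ, hδ, hδ'⟩ := Metric.eventually_nhds_iff.1 (hc'.eventually_le_const hε)
  refine ⟨δ, hδ, fun t ht => ?_⟩
  refine le_trans (le_of_eq ?_) (hδ' (by simpa using ht))
  rw [enorm_Lp_sq]
  refine lintegral_congr_ae ?_
  have h0 : ∀ t, Lp.compMeasurePreserving (g t) (hgm t) (hf.toLp f) =ᵐ[volume]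
      fun x => f (x - t) := fun t =>
    (Lp.coeFn_compMeasurePreserving _ (hgm t)).trans
      ((hgm t).quasiMeasurePreserving.ae_eq_comp hf.coeFn_toLp)
  filter_upwards [h0 t, h0 0, Lp.coeFn_sub (Lp.compMeasurePreserving (g t) (hgm t) (hf.toLp f))
    (Lp.compMeasurePreserving (g 0) (hgm 0) (hf.toLp f))] with x h1 h2 h3
  rw [h3, Pi.sub_apply, h1, h2, sub_zero]

end Mollifiers

/-! ## Density of smooth functions in `H¹(Ω)` -/

section Density

open scoped ENNReal NNReal
open Set Metric

variable {d : ℕ} {Ω : Set (EuclideanSpace ℝ (Fin d))}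

/-- Near every point of its closure, a Lipschitz domain can be translated into itself. -/
lemma IsBoundedLipschitzDomain.exists_mollifier (hΩ : IsBoundedLipschitzDomain Ω)
    {p : EuclideanSpace ℝ (Fin d)} (hp : p ∈ closure Ω) :
    ∃ r > 0, ∀ δ > 0, ∃ ρ : EuclideanSpace ℝ (Fin d) → ℝ, IsMollifier ρ ∧
      (∀ t ∈ tsupport ρ, ‖t‖ < δ) ∧ ∀ x ∈ Ω ∩ ball p r, ∀ t ∈ tsupport ρ, x - t ∈ Ω := by
  by_cases hpΩ : p ∈ Ω
  · obtain ⟨R, hR, hRΩ⟩ := Metric.isOpen_iff.1 hΩ.isOpen p hpΩ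
    refine ⟨R / 2, by positivity, fun δ hδ => ?_⟩
    have hs : 0 < min (R / 2) (δ / 2) := by positivity
    obtain ⟨ρ, hρ, hρs⟩ := exists_isMollifier (0 : EuclideanSpace ℝ (Fin d)) hs
    refine ⟨ρ, hρ, fun t ht => ?_, fun x hx t ht => hRΩ ?_⟩
    · rw [hρs, mem_closedBall_zero_iff] at ht
      exact (ht.trans (min_le_right _ _)).trans_lt (by linarith)
    · rw [hρs, mem_closedBall_zero_iff] at ht
      have h1 := hx.2
      rw [mem_ball, dist_eq_norm] at h1 ⊢
      have h2 : x - t - p = (x - p) - t := by abel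
      rw [h2]
      have := norm_sub_le (x - p) t
      linarith [ht.trans (min_le_left _ _)]
  · have hpf : p ∈ frontier Ω := by rw [hΩ.isOpen.frontier_eq]; exact ⟨hp, hpΩ⟩
    obtain ⟨e, γ, K, R, h⟩ := hΩ.exists_chart hpf
    refine ⟨R / 2, half_pos h.pos, fun δ hδ => ?_⟩
    set s : ℝ := min (R / 4) (δ / 2) / 2 with hs
    have hR := h.pos
    have hspos : 0 < s := by positivity
    have hsR : s + s ≤ R / 4 := by rw [hs, add_halves]; exact min_le_left _ _
    have hsδ : s + s ≤ δ / 2 := by rw [hs, add_halves]; exact min_le_right _ _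
    have hK : (0 : ℝ) ≤ K := K.2
    -- The mollifier is supported in the ball of radius `c` around `-(s • e)`, so `x - t` is `x + s
    -- • e` up to an error `c`. The shift raises the height by `s`, and the error costs at most `(1
    -- + K) * c = s / 2`.
    set c : ℝ := s / (2 * (1 + K)) with hc
    have hcpos : 0 < c := by positivity
    have hcK : (1 + K) * c = s / 2 := by rw [hc]; field_simp
    have hcs : c ≤ s := by nlinarith
    obtain ⟨ρ, hρ, hρs⟩ := exists_isMollifier (-(s • e)) hcpos
    have hmem : ∀ t ∈ tsupport ρ, ‖-t - s • e‖ ≤ c := fun t ht => by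
      rw [hρs, mem_closedBall, dist_eq_norm] at ht
      rw [← norm_neg]
      have h1 : -(-t - s • e) = t - -(s • e) := by abel
      rwa [h1]
    have hse : ‖s • e‖ = s := by rw [norm_smul, h.norm_eq, mul_one, Real.norm_of_nonneg hspos.le]
    have hnorm : ∀ t ∈ tsupport ρ, ‖t‖ ≤ s + s := fun t ht => by
      have h1 := norm_add_le (-t - s • e) (s • e)
      rw [sub_add_cancel, norm_neg, hse] at h1
      linarith [hmem t ht]
    refine ⟨ρ, hρ, fun t ht => by linarith [hnorm t ht], fun x hx t ht => ?_⟩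
    have hxR : x ∈ ball p R := ball_subset_ball (by linarith) hx.2
    have hxt : x - t ∈ ball p R := by
      have h1 := hx.2
      rw [mem_ball, dist_eq_norm] at h1 ⊢
      have h2 : x - t - p = (x - p) - t := by abel
      rw [h2]
      have := norm_sub_le (x - p) t
      linarith [hnorm t ht]
    rw [h.mem_iff _ hxt]
    have h3 := (h.mem_iff x hxR).1 hx.1
    have h4 := (abs_le.1 (abs_height_sub_le h.norm_eq h.lipschitz (x - t) (x + s • e))).1
    have h5 : x - t - (x + s • e) = -t - s • e := by abel
    rw [h5, height_add_smul h.norm_eq] at h4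
    have h6 := mul_le_mul_of_nonneg_left (hmem t ht) (by positivity : (0 : ℝ) ≤ 1 + K)
    linarith

lemma exists_eLpNorm_mollify_sub_le {F : Type*} [NormedAddCommGroup F] [NormedSpace ℝ F]
    [CompleteSpace F] [MeasurableSpace F] [BorelSpace F] [SecondCountableTopology F]
    {f : EuclideanSpace ℝ (Fin d) → F} (hm : Measurable f) (hf : MemLp f 2 volume)
    {ε : ℝ≥0∞} (hε : 0 < ε) :
    ∃ δ > 0, ∀ ρ, IsMollifier ρ → (∀ t ∈ tsupport ρ, ‖t‖ < δ) →
      eLpNorm (mollify ρ f - f) 2 volume ≤ ε := by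
  obtain ⟨δ, hδ, h⟩ := exists_lintegral_translate_sub_le hf (ε := ε ^ 2) (by positivity)
  refine ⟨δ, hδ, fun ρ hρ hρδ => ?_⟩
  have h1 := hρ.lintegral_mollify_sub_le hm (hf.locallyIntegrable (by norm_num)) (A := univ)
    (M := ε ^ 2) fun t ht => by rw [setLIntegral_univ]; exact h t (hρδ t ht)
  rw [setLIntegral_univ] at h1
  rw [← ENNReal.pow_le_pow_left_iff two_ne_zero, eLpNorm_two_sq]
  exact h1

/-- Mollification commutes with the weak gradient at points where only values in `Ω` enter. -/
lemma gradC_mollify (hΩ : IsOpen Ω) {u : L2 Ω} {G : L2vec Ω} (h : IsWeakGradient Ω u G)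
    {ρ : EuclideanSpace ℝ (Fin d) → ℝ} (hρ : IsMollifier ρ)
    (hu : LocallyIntegrable (Ω.indicator u)) (hG : LocallyIntegrable (Ω.indicator G))
    {x : EuclideanSpace ℝ (Fin d)} (hx : ∀ t ∈ tsupport ρ, x - t ∈ Ω) :
    gradC (mollify ρ (Ω.indicator u)) x = mollify ρ (Ω.indicator G) x := by
  ext i
  -- The weak gradient is tested with the reflected kernel, whose support lies in `Ω` by `hx`. The
  -- sign from the reflection cancels the sign in the definition of the weak gradient.
  set ψ : EuclideanSpace ℝ (Fin d) → ℂ := fun t => (ρ (x - t) : ℂ) with hψ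
  have hcomp : ψ = (fun t => (ρ t : ℂ)) ∘ (Homeomorph.subLeft x) := rfl
  have hψt : IsTestFunction Ω ψ := by
    have h1 : HasCompactSupport fun t => (ρ t : ℂ) :=
      hρ.compact.comp_left (g := ((↑) : ℝ → ℂ)) Complex.ofReal_zero
    refine ⟨?_, ?_, ?_⟩
    · exact Complex.ofRealCLM.contDiff.comp (hρ.smooth.comp (contDiff_const.sub contDiff_id))
    · rw [hcomp]
      exact h1.comp_homeomorph _
    · rw [hcomp, tsupport_comp_eq_preimage]
      intro t ht
      have h2 : x - t ∈ tsupport ρ := by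
        have h3 : Function.support (fun t => (ρ t : ℂ)) ⊆ Function.support ρ :=
          fun y hy => by simpa using hy
        exact closure_mono h3 ht
      simpa using hx _ h2
  have hgψ : ∀ t, gradC ψ t i = -((fderiv ℝ ρ (x - t) (EuclideanSpace.single i 1) : ℝ) : ℂ) := by
    intro t
    have h1 : HasFDerivAt (fun t => ρ (x - t))
        ((fderiv ℝ ρ (x - t)).comp (-ContinuousLinearMap.id ℝ _)) t :=
      ((hρ.smooth.differentiable (by simp) (x - t)).hasFDerivAt).comp t
        (by simpa using (hasFDerivAt_id t).const_sub x)
    have h2 : HasFDerivAt ψ _ t := Complex.ofRealCLM.hasFDerivAt.comp t h1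
    simp [gradC, h2.fderiv]
  have h1 := h ψ hψt i
  have hl : gradC (mollify ρ (Ω.indicator u)) x i = -∫ t in Ω, u t * gradC ψ t i := by
    simp only [gradC]
    rw [hρ.fderiv_mollify hu, ← integral_neg, ← integral_indicator hΩ.measurableSet]
    refine integral_congr_ae (Filter.Eventually.of_forall fun t => ?_)
    by_cases ht : t ∈ Ω
    · simp only [indicator_of_mem ht]
      have := hgψ t
      simp only [gradC] at this
      rw [this, Complex.real_smul]
      ring
    · simp only [indicator_of_notMem ht, smul_zero]
  have hr : mollify ρ (Ω.indicator G) x i = ∫ t in Ω, G t i * ψ t := by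
    have h2 := ((EuclideanSpace.proj i : EuclideanSpace ℂ (Fin d) →L[ℂ] ℂ).restrictScalars
      ℝ).integral_comp_comm (hρ.integrable_mollify hG x)
    have h3 : mollify ρ (Ω.indicator G) x i = mollify ρ (fun t => Ω.indicator G t i) x := by
      rw [mollify, mollify]
      simpa using h2.symm
    rw [h3, mollify_eq_swap, ← integral_indicator hΩ.measurableSet]
    refine integral_congr_ae (Filter.Eventually.of_forall fun t => ?_)
    by_cases ht : t ∈ Ω
    · simp only [indicator_of_mem ht, hψ]
      rw [Complex.real_smul, mul_comm]
    · simp [indicator_of_notMem ht]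
  rw [hl, hr, h1, neg_neg]

lemma gradC_mul {χ f : EuclideanSpace ℝ (Fin d) → ℂ} (hχ : ContDiff ℝ ∞ χ) (hf : ContDiff ℝ ∞ f)
    (x : EuclideanSpace ℝ (Fin d)) :
    gradC (fun x => χ x * f x) x = f x • gradC χ x + χ x • gradC f x := by
  have h1 := (hχ.differentiable (by simp) x).hasFDerivAt.mul
    (hf.differentiable (by simp) x).hasFDerivAt
  ext i
  have h2 : fderiv ℝ (fun x => χ x * f x) x = _ := h1.fderiv
  simp [gradC, h2, add_comm]

lemma exists_norm_le_of_hasCompactSupport {F : Type*} [NormedAddCommGroup F]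
    {f : EuclideanSpace ℝ (Fin d) → F} (hf : Continuous f) (hc : HasCompactSupport f) :
    ∃ B : ℝ≥0, ∀ x, ‖f x‖ ≤ B := by
  obtain ⟨C, hC⟩ := hc.exists_bound_of_continuous hf
  exact ⟨⟨max C 0, le_max_right _ _⟩, fun x => (hC x).trans (le_max_left _ _)⟩

/-- Local approximation of `χ u` by smooth functions. -/
lemma exists_smooth_approx_mul (hΩ : IsOpen Ω) {u : L2 Ω} {G : L2vec Ω}
    (h : IsWeakGradient Ω u G) {χ : EuclideanSpace ℝ (Fin d) → ℂ} (hχ : ContDiff ℝ ∞ χ)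
    (hχc : HasCompactSupport χ)
    (hmol : ∀ δ > 0, ∃ ρ : EuclideanSpace ℝ (Fin d) → ℝ, IsMollifier ρ ∧
      (∀ t ∈ tsupport ρ, ‖t‖ < δ) ∧ ∀ x ∈ Ω ∩ tsupport χ, ∀ t ∈ tsupport ρ, x - t ∈ Ω)
    {ε : ℝ≥0∞} (hε : 0 < ε) :
    ∃ φ : EuclideanSpace ℝ (Fin d) → ℂ, ContDiff ℝ ∞ φ ∧ HasCompactSupport φ ∧
      eLpNorm (fun x => φ x - χ x * u x) 2 (volume.restrict Ω) ≤ ε ∧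
      eLpNorm (fun x => gradC φ x - (u x • gradC χ x + χ x • G x)) 2 (volume.restrict Ω) ≤ ε := by
  have hu : MemLp (Ω.indicator u) 2 volume :=
    (memLp_indicator_iff_restrict hΩ.measurableSet).2 (Lp.memLp u)
  have hG : MemLp (Ω.indicator G) 2 volume :=
    (memLp_indicator_iff_restrict hΩ.measurableSet).2 (Lp.memLp G)
  have hum : Measurable (Ω.indicator u) :=
    (Lp.stronglyMeasurable u).measurable.indicator hΩ.measurableSet
  have hGm : Measurable (Ω.indicator G) :=
    (Lp.stronglyMeasurable G).measurable.indicator hΩ.measurableSet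
  have hul := hu.locallyIntegrable (by norm_num)
  have hGl := hG.locallyIntegrable (by norm_num)
  obtain ⟨B₁, hB₁⟩ := exists_norm_le_of_hasCompactSupport hχ.continuous hχc
  obtain ⟨B₂, hB₂⟩ := exists_norm_le_of_hasCompactSupport (contDiff_gradC hχ).continuous
    (hasCompactSupport_gradC hχc)
  -- A common bound for `χ` and its gradient, kept positive so that one can divide by it.
  set B : ℝ≥0 := B₁ + B₂ + 1
  have hB1 : ∀ x, ‖χ x‖ ≤ B := fun x => (hB₁ x).trans (by
    have := B₂.2; simp only [B, NNReal.coe_add]; simp only [NNReal.val_eq_coe] at this; simp; linarith)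
  have hB2 : ∀ x, ‖gradC χ x‖ ≤ B := fun x => (hB₂ x).trans (by
    have := B₁.2; simp only [B, NNReal.coe_add]; simp only [NNReal.val_eq_coe] at this; simp; linarith)
  have hη : 0 < ε / 2 / B := ENNReal.div_pos (ENNReal.half_pos hε.ne').ne' ENNReal.coe_ne_top
  have hηB : (B : ℝ≥0∞) * (ε / 2 / B) ≤ ε / 2 :=
    (ENNReal.mul_div_cancel (by simp [B]) ENNReal.coe_ne_top).le
  obtain ⟨δ₁, hδ₁, h₁⟩ := exists_eLpNorm_mollify_sub_le hum hu hη
  obtain ⟨δ₂, hδ₂, h₂⟩ := exists_eLpNorm_mollify_sub_le hGm hG hη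
  obtain ⟨ρ, hρ, hρδ, hρΩ⟩ := hmol (min δ₁ δ₂) (lt_min hδ₁ hδ₂)
  have h₁' := h₁ ρ hρ fun t ht => (hρδ t ht).trans_le (min_le_left _ _)
  have h₂' := h₂ ρ hρ fun t ht => (hρδ t ht).trans_le (min_le_right _ _)
  have hmu := hρ.contDiff_mollify hul
  have hmG := hρ.contDiff_mollify hGl
  refine ⟨fun x => χ x * mollify ρ (Ω.indicator u) x, hχ.mul hmu, hχc.mul_right, ?_, ?_⟩
  · calc eLpNorm (fun x => χ x * mollify ρ (Ω.indicator u) x - χ x * u x) 2 (volume.restrict Ω)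
        ≤ B * eLpNorm (mollify ρ (Ω.indicator u) - Ω.indicator u) 2 (volume.restrict Ω) := by
          refine eLpNorm_le_nnreal_smul_eLpNorm_of_ae_le_mul ?_ 2
          filter_upwards [ae_restrict_mem hΩ.measurableSet] with x hx
          rw [← mul_sub, nnnorm_mul, Pi.sub_apply, indicator_of_mem hx]
          gcongr
          exact hB1 x
      _ ≤ B * (ε / 2 / B) := by
          gcongr
          exact (eLpNorm_restrict_le _ _ _ _).trans h₁'
      _ ≤ ε := hηB.trans ENNReal.half_le_self
  -- On the support of `χ` the mollifier only sees values in `Ω`, so it commutes with the gradient.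
  -- Elsewhere `χ` vanishes and the gradient of the mollification does not matter.
  · have hpt : ∀ x ∈ Ω, gradC (fun x => χ x * mollify ρ (Ω.indicator u) x) x
        - (u x • gradC χ x + χ x • G x) =
        (mollify ρ (Ω.indicator u) x - Ω.indicator u x) • gradC χ x
          + χ x • (mollify ρ (Ω.indicator G) x - Ω.indicator G x) := by
      intro x hx
      rw [gradC_mul hχ hmu, indicator_of_mem hx, indicator_of_mem hx]
      by_cases hxχ : x ∈ tsupport χ
      · rw [gradC_mollify hΩ h hρ hul hGl (hρΩ x ⟨hx, hxχ⟩)]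
        module
      · rw [image_eq_zero_of_notMem_tsupport hxχ]
        module
    have hc1 : AEStronglyMeasurable (fun x => (mollify ρ (Ω.indicator u) x - Ω.indicator u x) •
        gradC χ x) (volume.restrict Ω) :=
      ((hmu.continuous.measurable.sub hum).aestronglyMeasurable).smul
        (contDiff_gradC hχ).continuous.aestronglyMeasurable
    have hc2 : AEStronglyMeasurable (fun x => χ x • (mollify ρ (Ω.indicator G) x
        - Ω.indicator G x)) (volume.restrict Ω) :=
      hχ.continuous.aestronglyMeasurable.smul
        (hmG.continuous.measurable.sub hGm).aestronglyMeasurable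
    calc _ = eLpNorm ((fun x => (mollify ρ (Ω.indicator u) x - Ω.indicator u x) • gradC χ x)
          + fun x => χ x • (mollify ρ (Ω.indicator G) x - Ω.indicator G x)) 2
          (volume.restrict Ω) := by
          refine eLpNorm_congr_ae ?_
          filter_upwards [ae_restrict_mem hΩ.measurableSet] with x hx
          exact hpt x hx
      _ ≤ _ := eLpNorm_add_le hc1 hc2 (by norm_num)
      _ ≤ B * eLpNorm (mollify ρ (Ω.indicator u) - Ω.indicator u) 2 volume
          + B * eLpNorm (mollify ρ (Ω.indicator G) - Ω.indicator G) 2 volume := by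
          refine add_le_add ?_ ?_
          · refine le_trans ?_ (mul_le_mul_right (eLpNorm_restrict_le _ _ _ Ω) _)
            refine eLpNorm_le_nnreal_smul_eLpNorm_of_ae_le_mul
              (Filter.Eventually.of_forall fun x => ?_) 2
            rw [nnnorm_smul, mul_comm, Pi.sub_apply]
            gcongr
            exact hB2 x
          · refine le_trans ?_ (mul_le_mul_right (eLpNorm_restrict_le _ _ _ Ω) _)
            refine eLpNorm_le_nnreal_smul_eLpNorm_of_ae_le_mul
              (Filter.Eventually.of_forall fun x => ?_) 2
            rw [nnnorm_smul, Pi.sub_apply]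
            gcongr
            exact hB1 x
      _ ≤ ε / 2 + ε / 2 := by
          refine add_le_add (le_trans ?_ hηB) (le_trans ?_ hηB)
          · gcongr
          · gcongr
      _ = ε := ENNReal.add_halves ε

end Density

/-! ### Density of smooth functions and the trace operator -/

section Global

open scoped ENNReal NNReal Manifold
open Set Metric

variable {d : ℕ} {Ω : Set (EuclideanSpace ℝ (Fin d))}

lemma gradC_sum {ι : Type*} (s : Finset ι) {φ : ι → EuclideanSpace ℝ (Fin d) → ℂ}
    (hφ : ∀ i, ContDiff ℝ ∞ (φ i)) (x : EuclideanSpace ℝ (Fin d)) :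
    gradC (fun x => ∑ i ∈ s, φ i x) x = ∑ i ∈ s, gradC (φ i) x := by
  ext k
  have h1 : fderiv ℝ (fun x => ∑ i ∈ s, φ i x) x = ∑ i ∈ s, fderiv ℝ (φ i) x :=
    fderiv_fun_sum fun i _ => (hφ i).differentiable (by simp) x
  simp [gradC, h1]

/-- Smooth functions approximate functions in `H¹(Ω)`. -/
lemma IsBoundedLipschitzDomain.exists_smooth_approx (hΩ : IsBoundedLipschitzDomain Ω)
    {u : L2 Ω} {G : L2vec Ω} (h : IsWeakGradient Ω u G) {ε : ℝ≥0∞} (hε : 0 < ε) :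
    ∃ φ : EuclideanSpace ℝ (Fin d) → ℂ, ContDiff ℝ ∞ φ ∧ HasCompactSupport φ ∧
      eLpNorm (fun x => φ x - u x) 2 (volume.restrict Ω) ≤ ε ∧
      eLpNorm (fun x => gradC φ x - G x) 2 (volume.restrict Ω) ≤ ε := by
  choose r hr hmol using fun p : closure Ω => hΩ.exists_mollifier p.2
  have hcomp : IsCompact (closure Ω) := hΩ.isBounded.isCompact_closure
  obtain ⟨t, ht⟩ := hcomp.elim_finite_subcover
    (fun p : closure Ω => ball (p : EuclideanSpace ℝ (Fin d)) (r p)) (fun _ => isOpen_ball)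
    fun x hx => mem_iUnion.2 ⟨⟨x, hx⟩, mem_ball_self (hr _)⟩
  obtain ⟨f, hf⟩ := SmoothPartitionOfUnity.exists_isSubordinate
    𝓘(ℝ, EuclideanSpace ℝ (Fin d)) isClosed_closure
    (fun p : t => ball ((p : closure Ω) : EuclideanSpace ℝ (Fin d)) (r p)) (fun _ => isOpen_ball)
    (fun x hx => by
      obtain ⟨q, hq, hxq⟩ := mem_iUnion₂.1 (ht hx)
      exact mem_iUnion.2 ⟨⟨q, hq⟩, hxq⟩)
  set χ : t → EuclideanSpace ℝ (Fin d) → ℂ := fun i x => (f i x : ℂ) with hχdef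
  have hχ : ∀ i, ContDiff ℝ ∞ (χ i) := fun i =>
    Complex.ofRealCLM.contDiff.comp (f i).contMDiff.contDiff
  have hχs : ∀ i, tsupport (χ i) ⊆ ball ((i : closure Ω) : EuclideanSpace ℝ (Fin d)) (r i) :=
    fun i => (closure_mono fun y hy => by simpa [hχdef] using hy).trans (hf i)
  have hχc : ∀ i, HasCompactSupport (χ i) := fun i =>
    isCompact_of_isClosed_isBounded (isClosed_tsupport _) (isBounded_ball.subset (hχs i))
  have hsum : ∀ x ∈ Ω, ∑ i, χ i x = 1 := fun x hx => by
    have := f.sum_eq_one (subset_closure hx)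
    rw [finsum_eq_sum_of_fintype] at this
    simp only [hχdef]
    exact_mod_cast this
  -- Differentiating the partition of unity shows that the terms `u ∇χ i` of the product rule cancel
  -- on `Ω`.
  have hgsum : ∀ x ∈ Ω, ∑ i, gradC (χ i) x = 0 := fun x hx => by
    rw [← gradC_sum _ hχ]
    have h1 : (fun x => ∑ i, χ i x) =ᶠ[𝓝 x] fun _ => (1 : ℂ) := by
      filter_upwards [hΩ.isOpen.mem_nhds hx] with y hy using hsum y hy
    have h2 : fderiv ℝ (fun x => ∑ i, χ i x) x = 0 := by rw [h1.fderiv_eq]; simp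
    ext k
    simp only [gradC, h2]
    simp
  set n : ℝ≥0∞ := ((Fintype.card t : ℕ) : ℝ≥0∞)
  have hη : 0 < ε / (n + 1) := ENNReal.div_pos hε.ne' (by simp [n])
  have hηn : n * (ε / (n + 1)) ≤ ε := by
    calc n * (ε / (n + 1)) ≤ (n + 1) * (ε / (n + 1)) := by gcongr; exact le_self_add
      _ = ε := ENNReal.mul_div_cancel (by simp) (by simp [n])
  choose φ hφ hφc hφ1 hφ2 using fun i : t => exists_smooth_approx_mul hΩ.isOpen h (hχ i) (hχc i)
    (fun δ hδ => by
      obtain ⟨ρ, h1, h2, h3⟩ := hmol i δ hδ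
      exact ⟨ρ, h1, h2, fun x hx => h3 x ⟨hx.1, hχs i hx.2⟩⟩) hη
  have hum : AEStronglyMeasurable u (volume.restrict Ω) := Lp.aestronglyMeasurable u
  have hGm : AEStronglyMeasurable G (volume.restrict Ω) := Lp.aestronglyMeasurable G
  refine ⟨fun x => ∑ i, φ i x, ContDiff.sum fun i _ => hφ i, ?_, ?_, ?_⟩
  · have : (fun x => ∑ i, φ i x) = ∑ i, φ i := by ext x; simp
    rw [this]
    exact HasCompactSupport.finset_sum fun i _ => hφc i
  · calc _ = eLpNorm (∑ i, fun x => φ i x - χ i x * u x) 2 (volume.restrict Ω) := by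
          refine eLpNorm_congr_ae ?_
          filter_upwards [ae_restrict_mem hΩ.isOpen.measurableSet] with x hx
          simp only [Finset.sum_apply, Finset.sum_sub_distrib]
          rw [← Finset.sum_mul, hsum x hx, one_mul]
      _ ≤ ∑ i, eLpNorm (fun x => φ i x - χ i x * u x) 2 (volume.restrict Ω) :=
          eLpNorm_sum_le (fun i _ => (hφ i).continuous.aestronglyMeasurable.sub
            ((hχ i).continuous.aestronglyMeasurable.mul hum)) (by norm_num)
      _ ≤ n * (ε / (n + 1)) := by
          refine (Finset.sum_le_card_nsmul _ _ _ fun i _ => hφ1 i).trans ?_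
          simp [n]
      _ ≤ ε := hηn
  · calc _ = eLpNorm (∑ i, fun x => gradC (φ i) x - (u x • gradC (χ i) x + χ i x • G x)) 2
          (volume.restrict Ω) := by
          refine eLpNorm_congr_ae ?_
          filter_upwards [ae_restrict_mem hΩ.isOpen.measurableSet] with x hx
          simp only [Finset.sum_apply, Finset.sum_sub_distrib, Finset.sum_add_distrib]
          rw [← Finset.smul_sum, ← Finset.sum_smul, hsum x hx, hgsum x hx, gradC_sum _ hφ]
          simp
      _ ≤ ∑ i, eLpNorm (fun x => gradC (φ i) x - (u x • gradC (χ i) x + χ i x • G x)) 2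
          (volume.restrict Ω) :=
          eLpNorm_sum_le (fun i _ => (contDiff_gradC (hφ i)).continuous.aestronglyMeasurable.sub
            ((hum.smul (contDiff_gradC (hχ i)).continuous.aestronglyMeasurable).add
              ((hχ i).continuous.aestronglyMeasurable.smul hGm))) (by norm_num)
      _ ≤ n * (ε / (n + 1)) := by
          refine (Finset.sum_le_card_nsmul _ _ _ fun i _ => hφ2 i).trans ?_
          simp [n]
      _ ≤ ε := hηn

lemma enorm_H1_sq (u : H1 Ω) : ‖u‖ₑ ^ 2 = ‖val Ω u‖ₑ ^ 2 + ‖grad Ω u‖ₑ ^ 2 := by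
  have h1 : ‖u‖ ^ 2 = ‖val Ω u‖ ^ 2 + ‖grad Ω u‖ ^ 2 := WithLp.prod_norm_sq_eq_of_L2 _
  simp only [← ofReal_norm, ← ENNReal.ofReal_pow (norm_nonneg _)]
  rw [h1, ENNReal.ofReal_add (by positivity) (by positivity)]

lemma norm_H1_sq (u : H1 Ω) : ‖u‖ ^ 2 = ‖val Ω u‖ ^ 2 + ‖grad Ω u‖ ^ 2 :=
  WithLp.prod_norm_sq_eq_of_L2 _

lemma IsBoundedLipschitzDomain.memLp_boundary (hΩ : IsBoundedLipschitzDomain Ω) (hd : 1 ≤ d)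
    {φ : EuclideanSpace ℝ (Fin d) → ℂ} (hφ : Continuous φ) (hc : HasCompactSupport φ) :
    MemLp φ 2 (surfaceMeasure Ω) := by
  have := hΩ.isFiniteMeasure_surfaceMeasure hd
  exact hφ.memLp_of_hasCompactSupport hc

lemma enorm_val_restrictInterior_sq (φ : smoothFunctions Ω) :
    ‖val Ω (restrictInterior Ω φ)‖ₑ ^ 2
      = ∫⁻ x in Ω, ‖(φ : EuclideanSpace ℝ (Fin d) → ℂ) x‖ₑ ^ 2 :=
  enorm_toLp_sq (smoothFunctions_memLp Ω φ)

lemma enorm_grad_restrictInterior_sq (φ : smoothFunctions Ω) :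
    ‖grad Ω (restrictInterior Ω φ)‖ₑ ^ 2
      = ∫⁻ x in Ω, ‖gradC (φ : EuclideanSpace ℝ (Fin d) → ℂ) x‖ₑ ^ 2 :=
  enorm_toLp_sq (smoothFunctions_memLp_grad Ω φ)

lemma enorm_restrictBoundary_sq (φ : smoothFunctions Ω) :
    ‖restrictBoundary Ω φ‖ₑ ^ 2
      = ∫⁻ x, ‖(φ : EuclideanSpace ℝ (Fin d) → ℂ) x‖ₑ ^ 2 ∂surfaceMeasure Ω :=
  enorm_toLp_sq φ.2.2.2

lemma val_restrictInterior_coeFn (φ : smoothFunctions Ω) :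
    val Ω (restrictInterior Ω φ) =ᵐ[volume.restrict Ω] (φ : EuclideanSpace ℝ (Fin d) → ℂ) :=
  (smoothFunctions_memLp Ω φ).coeFn_toLp

lemma grad_restrictInterior_coeFn (φ : smoothFunctions Ω) :
    grad Ω (restrictInterior Ω φ) =ᵐ[volume.restrict Ω]
      gradC (φ : EuclideanSpace ℝ (Fin d) → ℂ) :=
  (smoothFunctions_memLp_grad Ω φ).coeFn_toLp

lemma IsBoundedLipschitzDomain.denseRange_restrictInterior (hΩ : IsBoundedLipschitzDomain Ω)
    (hd : 1 ≤ d) : DenseRange (restrictInterior Ω) := by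
  intro u
  rw [EMetric.mem_closure_iff]
  intro ε hε
  obtain ⟨φ, hφ, hφc, h1, h2⟩ := hΩ.exists_smooth_approx (u := val Ω u) (G := grad Ω u) u.2
    -- The radius in `mem_closure_iff` may be `⊤`; the minimum with 1 keeps the bound finite.
    (ε := min (ε / 4) 1) (lt_min (ENNReal.div_pos hε.ne' (by norm_num)) one_pos)
  set ψ : smoothFunctions Ω := ⟨φ, hφ, hφc, hΩ.memLp_boundary hd hφ.continuous hφc⟩
  refine ⟨_, ⟨ψ, rfl⟩, ?_⟩
  have h3 : ‖val Ω (restrictInterior Ω ψ - u)‖ₑ ≤ min (ε / 4) 1 := by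
    rw [map_sub, Lp.enorm_def]
    refine le_trans (le_of_eq (eLpNorm_congr_ae ?_)) h1
    filter_upwards [Lp.coeFn_sub (val Ω (restrictInterior Ω ψ)) (val Ω u),
      val_restrictInterior_coeFn ψ] with x hx hx'
    rw [hx, Pi.sub_apply, hx']
  have h4 : ‖grad Ω (restrictInterior Ω ψ - u)‖ₑ ≤ min (ε / 4) 1 := by
    rw [map_sub, Lp.enorm_def]
    refine le_trans (le_of_eq (eLpNorm_congr_ae ?_)) h2
    filter_upwards [Lp.coeFn_sub (grad Ω (restrictInterior Ω ψ)) (grad Ω u),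
      grad_restrictInterior_coeFn ψ] with x hx hx'
    rw [hx, Pi.sub_apply, hx']
  have h5 : ‖restrictInterior Ω ψ - u‖ₑ ≤ 2 * min (ε / 4) 1 := by
    rw [← ENNReal.pow_le_pow_left_iff two_ne_zero, enorm_H1_sq]
    calc _ ≤ min (ε / 4) 1 ^ 2 + min (ε / 4) 1 ^ 2 := by gcongr
      _ ≤ (2 * min (ε / 4) 1) ^ 2 := by
        rw [mul_pow, ← two_mul]; gcongr; norm_num
  rw [edist_comm, edist_eq_enorm_sub]
  refine h5.trans_lt ?_
  rcases eq_or_ne ε ⊤ with rfl | hε'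
  · exact ENNReal.mul_lt_top (by norm_num) ((min_le_right _ _).trans_lt (by norm_num))
  · calc 2 * min (ε / 4) 1 ≤ 2 * (ε / 4) := by gcongr; exact min_le_left _ _
      _ = ε / 2 := by
        rw [show (4 : ℝ≥0∞) = 2 * 2 by norm_num, ← mul_div_assoc,
          ENNReal.mul_div_mul_left _ _ (by norm_num) (by norm_num)]
      _ < ε := ENNReal.half_lt_self hε.ne' hε'

/-- The trace inequality in terms of norms. -/
lemma IsBoundedLipschitzDomain.restrictBoundary_le (hΩ : IsBoundedLipschitzDomain Ω)
    (hd : 1 ≤ d) : ∃ (C τ₀ : ℝ), 0 ≤ C ∧ 0 < τ₀ ∧ ∀ τ, 0 < τ → τ ≤ τ₀ → ∀ φ : smoothFunctions Ω,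
      ‖restrictBoundary Ω φ‖ ^ 2 ≤ C * (τ⁻¹ * ‖val Ω (restrictInterior Ω φ)‖ ^ 2
        + τ * ‖grad Ω (restrictInterior Ω φ)‖ ^ 2) := by
  obtain ⟨C, τ₀, hτ₀, h⟩ := hΩ.trace_estimate hd
  refine ⟨C, τ₀, C.2, hτ₀, fun τ hτ hτ' φ => ?_⟩
  have h1 := h τ hτ hτ' φ φ.2.1
  rw [← enorm_restrictBoundary_sq, ← enorm_val_restrictInterior_sq,
    ← enorm_grad_restrictInterior_sq] at h1
  have h2 := ENNReal.toReal_mono (by finiteness) h1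
  rw [ENNReal.toReal_mul, ENNReal.toReal_mul, ENNReal.toReal_add (by finiteness) (by finiteness),
    ENNReal.toReal_mul] at h2
  simp only [ENNReal.toReal_pow, toReal_enorm, ENNReal.toReal_ofReal hτ.le,
    ENNReal.coe_toReal] at h2
  have h3 : ‖restrictBoundary Ω φ‖ ^ 2 = τ⁻¹ * (τ * ‖restrictBoundary Ω φ‖ ^ 2) := by
    rw [inv_mul_cancel_left₀ hτ.ne']
  rw [h3]
  refine (mul_le_mul_of_nonneg_left h2 (inv_nonneg.2 hτ.le)).trans (le_of_eq ?_)
  field_simp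

lemma IsBoundedLipschitzDomain.exists_restrictBoundary_le (hΩ : IsBoundedLipschitzDomain Ω)
    (hd : 1 ≤ d) : ∃ C, ∀ φ, ‖restrictBoundary Ω φ‖ ≤ C * ‖restrictInterior Ω φ‖ := by
  obtain ⟨C, τ, hC, hτ, h⟩ := hΩ.restrictBoundary_le hd
  refine ⟨√(C * (τ⁻¹ + τ)), fun φ => ?_⟩
  rw [← abs_of_nonneg (norm_nonneg (restrictInterior Ω φ)), ← Real.sqrt_sq_eq_abs,
    ← Real.sqrt_mul (by positivity)]
  refine Real.le_sqrt_of_sq_le ((h τ hτ le_rfl φ).trans ?_)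
  rw [mul_assoc]
  refine mul_le_mul_of_nonneg_left ?_ hC
  rw [norm_H1_sq]
  have h1 : 0 ≤ τ⁻¹ * ‖grad Ω (restrictInterior Ω φ)‖ ^ 2 := by positivity
  have h2 : 0 ≤ τ * ‖val Ω (restrictInterior Ω φ)‖ ^ 2 := by positivity
  linarith

/-- Density and the norm bound are the two conditions under which `extendOfNorm` really extends the
restriction map. -/
lemma IsBoundedLipschitzDomain.trace_restrictInterior (hΩ : IsBoundedLipschitzDomain Ω)
    (hd : 1 ≤ d) (φ : smoothFunctions Ω) :
    trace Ω (restrictInterior Ω φ) = restrictBoundary Ω φ :=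
  LinearMap.extendOfNorm_eq (hΩ.denseRange_restrictInterior hd) (hΩ.exists_restrictBoundary_le hd) φ

end Global

/-! ### Hilbert space properties of the Sobolev space and its trace -/

section Sobolev

open scoped ENNReal NNReal ComplexConjugate
open Set Metric

variable {d : ℕ} {Ω : Set (EuclideanSpace ℝ (Fin d))}

/-- The integral is the inner product with the conjugate of `f`. Continuity in `u` is what makes
`H1` closed. -/
lemma continuous_integral_mul {f : EuclideanSpace ℝ (Fin d) → ℂ}
    (hf : MemLp f 2 (volume.restrict Ω)) :
    Continuous fun u : L2 Ω => ∫ x in Ω, u x * f x := by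
  have h : (fun u : L2 Ω => ∫ x in Ω, u x * f x) = fun u : L2 Ω => ⟪hf.star.toLp (star f), u⟫_ℂ := by
    ext u
    rw [L2.inner_def]
    refine integral_congr_ae ?_
    filter_upwards [hf.star.coeFn_toLp] with x hx
    rw [hx]
    simp [RCLike.inner_apply]
  rw [h]
  fun_prop

lemma continuous_integral_comp_mul {f : EuclideanSpace ℝ (Fin d) → ℂ}
    (hf : MemLp f 2 (volume.restrict Ω)) (i : Fin d) :
    Continuous fun G : L2vec Ω => ∫ x in Ω, G x i * f x := by
  have hm : MemLp (fun x => EuclideanSpace.single i (conj (f x))) 2 (volume.restrict Ω) := by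
    refine MemLp.of_le (g := f) hf ?_ (Filter.Eventually.of_forall fun x => by simp)
    have hc : Continuous fun z : ℂ => (EuclideanSpace.single i (conj z) : EuclideanSpace ℂ (Fin d)) :=
      (PiLp.continuous_toLp 2 _).comp
        (continuous_pi fun k => by
          rcases eq_or_ne k i with rfl | h
          · simpa using Complex.continuous_conj
          · simpa [h] using continuous_const)
    exact hc.comp_aestronglyMeasurable hf.aestronglyMeasurable
  have h : (fun G : L2vec Ω => ∫ x in Ω, G x i * f x) = fun G : L2vec Ω => ⟪hm.toLp _, G⟫_ℂ := by
    ext G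
    rw [L2.inner_def]
    refine integral_congr_ae ?_
    filter_upwards [hm.coeFn_toLp] with x hx
    rw [hx, EuclideanSpace.inner_single_left]
    simp [mul_comm]
  rw [h]
  fun_prop

lemma isClosed_H1 : IsClosed (H1 Ω : Set (WithLp 2 (L2 Ω × L2vec Ω))) := by
  have h : (H1 Ω : Set (WithLp 2 (L2 Ω × L2vec Ω))) = ⋂ (ψ : EuclideanSpace ℝ (Fin d) → ℂ)
      (_ : IsTestFunction Ω ψ) (i : Fin d), {p : WithLp 2 (L2 Ω × L2vec Ω) |
        ∫ x in Ω, p.fst x * gradC ψ x i = -∫ x in Ω, p.snd x i * ψ x} := by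
    ext p
    simp only [mem_iInter]
    rfl
  rw [h]
  refine isClosed_iInter fun ψ => isClosed_iInter fun hψ => isClosed_iInter fun i => ?_
  have h1 : MemLp (fun x => gradC ψ x i) 2 (volume.restrict Ω) :=
    (memLp_gradC Ω hψ.smooth hψ.compact).eval_piLp i
  exact isClosed_eq ((continuous_integral_mul h1).comp (WithLp.prod_continuous_ofLp 2 _ _).fst)
    ((continuous_integral_comp_mul hψ.memLp i).comp (WithLp.prod_continuous_ofLp 2 _ _).snd).neg

instance : CompleteSpace (H1 Ω) := isClosed_H1.completeSpace_coe

lemma norm_val_le (u : H1 Ω) : ‖val Ω u‖ ≤ ‖u‖ :=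
  abs_le_of_sq_le_sq' (by rw [norm_H1_sq u]; nlinarith [sq_nonneg ‖grad Ω u‖]) (norm_nonneg _) |>.2

lemma norm_grad_le (u : H1 Ω) : ‖grad Ω u‖ ≤ ‖u‖ :=
  abs_le_of_sq_le_sq' (by rw [norm_H1_sq u]; nlinarith [sq_nonneg ‖val Ω u‖]) (norm_nonneg _) |>.2

variable (Ω) in
/-- The embedding `H¹(Ω) → L²(Ω)` as a continuous map. -/
noncomputable def valL : H1 Ω →L[ℂ] L2 Ω :=
  (val Ω).mkContinuous 1 fun u => by simpa using norm_val_le u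

lemma valL_apply (u : H1 Ω) : valL Ω u = val Ω u := rfl

lemma inner_H1 (u v : H1 Ω) :
    ⟪v, u⟫_ℂ = pullInner (grad Ω) u v + ⟪valL Ω v, valL Ω u⟫_ℂ := by
  rw [pullInner_apply, add_comm]
  exact WithLp.prod_inner_apply _ _

lemma IsTestFunction.conj {ψ : EuclideanSpace ℝ (Fin d) → ℂ} (h : IsTestFunction Ω ψ) :
    IsTestFunction Ω (fun x => conj (ψ x)) where
  smooth := Complex.conjCLE.contDiff.comp h.smooth
  compact := h.compact.comp_left (map_zero _)
  support := (closure_mono fun x hx => by simpa using hx).trans h.support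

/-- The fundamental lemma of the calculus of variations. -/
lemma IsBoundedLipschitzDomain.ae_eq_zero (hΩ : IsBoundedLipschitzDomain Ω)
    {f : EuclideanSpace ℝ (Fin d) → ℂ} (hf : MemLp f 2 (volume.restrict Ω))
    (h : ∀ ψ, IsTestFunction Ω ψ → ∫ x in Ω, f x * ψ x = 0) :
    f =ᵐ[volume.restrict Ω] 0 := by
  have : IsFiniteMeasure (volume.restrict Ω) :=
    isFiniteMeasure_restrict.2 hΩ.isBounded.measure_lt_top.ne
  have hi : IntegrableOn f Ω := hf.integrable (by norm_num)
  rw [Filter.EventuallyEq, ae_restrict_iff' hΩ.isOpen.measurableSet]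
  refine hΩ.isOpen.ae_eq_zero_of_integral_contDiff_smul_eq_zero hi.locallyIntegrableOn
    fun g hg hgc hgs => ?_
  have hψ : IsTestFunction Ω fun x => (g x : ℂ) :=
    ⟨Complex.ofRealCLM.contDiff.comp hg, hgc.comp_left Complex.ofReal_zero,
      (closure_mono fun x hx => by simpa using hx).trans hgs⟩
  rw [← h _ hψ, ← setIntegral_eq_integral_of_forall_compl_eq_zero (s := Ω)]
  · refine integral_congr_ae (Filter.Eventually.of_forall fun x => ?_)
    simp [mul_comm]
  · intro x hx
    rw [image_eq_zero_of_notMem_tsupport fun hx' => hx (hgs hx'), zero_smul]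

/-- The weak gradient is determined by the function, by the fundamental lemma, so the pair `(u, ∇u)`
carries no extra data. -/
lemma IsBoundedLipschitzDomain.injective_val (hΩ : IsBoundedLipschitzDomain Ω) :
    Function.Injective (val Ω) := by
  refine (injective_iff_map_eq_zero _).2 fun u hu => ?_
  have h0 : (val Ω u : EuclideanSpace ℝ (Fin d) → ℂ) =ᵐ[volume.restrict Ω] 0 := by
    rw [hu]; exact Lp.coeFn_zero _ _ _
  have hG : ∀ i, (fun x => grad Ω u x i) =ᵐ[volume.restrict Ω] 0 := fun i => by
    refine hΩ.ae_eq_zero ((Lp.memLp (grad Ω u)).eval_piLp i) fun ψ hψ => ?_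
    have h1 : ∫ x in Ω, val Ω u x * gradC ψ x i = -∫ x in Ω, grad Ω u x i * ψ x := u.2 ψ hψ i
    have h2 : ∫ x in Ω, val Ω u x * gradC ψ x i = 0 := by
      refine integral_eq_zero_of_ae ?_
      filter_upwards [h0] with x hx
      rw [hx]; simp
    rwa [h2, eq_comm, neg_eq_zero] at h1
  have hG' : grad Ω u = 0 := by
    refine (Lp.eq_zero_iff_ae_eq_zero).2 ?_
    filter_upwards [ae_all_iff.2 hG] with x hx
    ext i
    exact hx i
  have := norm_H1_sq u
  rw [hu, hG'] at this
  simpa using this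

lemma IsTestFunction.eq_zero_of_mem_frontier (hΩ : IsOpen Ω) {ψ : EuclideanSpace ℝ (Fin d) → ℂ}
    (h : IsTestFunction Ω ψ) {x : EuclideanSpace ℝ (Fin d)} (hx : x ∈ frontier Ω) : ψ x = 0 :=
  image_eq_zero_of_notMem_tsupport fun hx' => (hΩ.frontier_eq ▸ hx).2 (h.support hx')

lemma IsTestFunction.ae_eq_zero (hΩ : IsOpen Ω) {ψ : EuclideanSpace ℝ (Fin d) → ℂ}
    (h : IsTestFunction Ω ψ) : ψ =ᵐ[surfaceMeasure Ω] 0 := by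
  filter_upwards [ae_restrict_mem isClosed_frontier.measurableSet] with x hx
  exact h.eq_zero_of_mem_frontier hΩ hx

lemma IsTestFunction.mem_smoothFunctions (hΩ : IsOpen Ω) {ψ : EuclideanSpace ℝ (Fin d) → ℂ}
    (h : IsTestFunction Ω ψ) : ψ ∈ smoothFunctions Ω :=
  ⟨h.smooth, h.compact, (memLp_congr_ae (h.ae_eq_zero hΩ)).2 MemLp.zero⟩

lemma restrictInterior_mem_H10 (φ : smoothFunctions Ω)
    (h : IsTestFunction Ω (φ : EuclideanSpace ℝ (Fin d) → ℂ)) :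
    restrictInterior Ω φ ∈ H10 Ω :=
  Submodule.le_topologicalClosure _ (Submodule.subset_span ⟨_, h, val_restrictInterior_coeFn φ⟩)

/-- A function orthogonal to all test functions vanishes. Conjugate test functions turn the inner
product into the bilinear pairing of `ae_eq_zero`. -/
lemma IsBoundedLipschitzDomain.denseRange_val_H10 (hΩ : IsBoundedLipschitzDomain Ω) :
    DenseRange (valL Ω ∘L (H10 Ω).subtypeL) := by
  have h : (LinearMap.range (val Ω ∘ₗ (H10 Ω).subtype)).topologicalClosure = ⊤ := by
    rw [Submodule.topologicalClosure_eq_top_iff, eq_bot_iff]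
    intro f hf
    rw [Submodule.mem_orthogonal] at hf
    refine (Lp.eq_zero_iff_ae_eq_zero).2 (hΩ.ae_eq_zero (Lp.memLp f) fun ψ hψ => ?_)
    have h1 := hf _ ⟨⟨_, restrictInterior_mem_H10 ⟨_, hψ.conj.mem_smoothFunctions hΩ.isOpen⟩ hψ.conj⟩,
      rfl⟩
    rw [L2.inner_def] at h1
    rw [← h1]
    refine integral_congr_ae ?_
    filter_upwards [val_restrictInterior_coeFn
      (⟨_, hψ.conj.mem_smoothFunctions hΩ.isOpen⟩ : smoothFunctions Ω)] with x hx
    change _ = ⟪val Ω (restrictInterior Ω _) x, f x⟫_ℂ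
    rw [hx]
    simp [RCLike.inner_apply]
  have h2 : Dense (LinearMap.range (val Ω ∘ₗ (H10 Ω).subtype) : Set (L2 Ω)) :=
    Submodule.dense_iff_topologicalClosure_eq_top.2 h
  exact h2

/-- Smooth compactly supported functions are dense in L² of the finite surface measure, and each is
a trace. -/
lemma IsBoundedLipschitzDomain.denseRange_trace (hΩ : IsBoundedLipschitzDomain Ω) (hd : 1 ≤ d) :
    DenseRange (trace Ω) := by
  have := hΩ.isFiniteMeasure_surfaceMeasure hd
  refine (Lp.dense_hasCompactSupport_contDiff (F := ℂ) (μ := surfaceMeasure Ω) (p := 2)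
    (by norm_num)).mono ?_
  rintro f ⟨g, hfg, hgc, hg⟩
  have hgL := hΩ.memLp_boundary hd hg.continuous hgc
  refine ⟨restrictInterior Ω ⟨g, hg, hgc, hgL⟩, ?_⟩
  rw [hΩ.trace_restrictInterior hd]
  exact Lp.ext (hgL.coeFn_toLp.trans hfg.symm)

/-- Test functions vanish on the boundary, and the kernel of the continuous trace is closed. -/
lemma IsBoundedLipschitzDomain.trace_eq_zero (hΩ : IsBoundedLipschitzDomain Ω) (hd : 1 ≤ d)
    {u : H1 Ω} (hu : u ∈ H10 Ω) : trace Ω u = 0 := by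
  have h : H10 Ω ≤ LinearMap.ker (trace Ω : H1 Ω →ₗ[ℂ] L2bd Ω) := by
    refine Submodule.topologicalClosure_minimal _ (Submodule.span_le.2 ?_)
      (isClosed_singleton.preimage (trace Ω).continuous)
    rintro u ⟨ψ, hψ, hu⟩
    have h1 : u = restrictInterior Ω ⟨ψ, hψ.mem_smoothFunctions hΩ.isOpen⟩ :=
      hΩ.injective_val (Lp.ext (Filter.EventuallyEq.trans hu (val_restrictInterior_coeFn
        (⟨ψ, hψ.mem_smoothFunctions hΩ.isOpen⟩ : smoothFunctions Ω)).symm))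
    change trace Ω u = 0
    rw [h1, hΩ.trace_restrictInterior hd]
    exact (Lp.eq_zero_iff_ae_eq_zero).2 ((MemLp.coeFn_toLp
      (hψ.mem_smoothFunctions hΩ.isOpen).2.2).trans (hψ.ae_eq_zero hΩ.isOpen))
  exact h hu

/-- The width `τ` of the layer is free: small `τ` makes the gradient coefficient `C * τ` at most
`ε`, at the cost of the L² coefficient `C / τ`. Density extends the bound to all of H¹(Ω). -/
lemma IsBoundedLipschitzDomain.trace_le (hΩ : IsBoundedLipschitzDomain Ω) (hd : 1 ≤ d) {ε : ℝ}
    (hε : 0 < ε) : ∃ C : ℝ, ∀ u, ‖trace Ω u‖ ^ 2 ≤ ε * ‖u‖ ^ 2 + C * ‖valL Ω u‖ ^ 2 := by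
  obtain ⟨C, τ₀, hC, hτ₀, h⟩ := hΩ.restrictBoundary_le hd
  set τ := min τ₀ (ε / (C + 1))
  have hτ : 0 < τ := lt_min hτ₀ (by positivity)
  have hτε : C * τ ≤ ε := by
    calc C * τ ≤ (C + 1) * (ε / (C + 1)) := by
          gcongr
          · linarith
          · exact min_le_right _ _
      _ = ε := by field_simp
  refine ⟨C * τ⁻¹, fun u => ?_⟩
  refine (hΩ.denseRange_restrictInterior hd).induction_on
    (p := fun u => ‖trace Ω u‖ ^ 2 ≤ ε * ‖u‖ ^ 2 + C * τ⁻¹ * ‖valL Ω u‖ ^ 2) u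
    (isClosed_le (by fun_prop) (by fun_prop)) fun φ => ?_
  rw [hΩ.trace_restrictInterior hd, valL_apply]
  have h1 := h τ hτ (min_le_left _ _) φ
  have h2 : C * τ * ‖grad Ω (restrictInterior Ω φ)‖ ^ 2 ≤ ε * ‖restrictInterior Ω φ‖ ^ 2 := by
    gcongr
    exact norm_grad_le _
  linarith

end Sobolev

/-! ### Cut-offs near the boundary -/

section Cutoff

open scoped ENNReal NNReal
open Set Metric

variable {d : ℕ} {Ω : Set (EuclideanSpace ℝ (Fin d))}

/-- Cut-off functions near the boundary. -/
lemma exists_cutoff (hΩ : Bornology.IsBounded Ω) {ε : ℝ} (hε : 0 < ε) :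
    ∃ η : EuclideanSpace ℝ (Fin d) → ℂ, IsTestFunction Ω η ∧ (∀ x, ‖1 - η x‖ ≤ 1) ∧
      (∀ x, 3 * ε ≤ infDist x Ωᶜ → η x = 1 ∧ gradC η x = 0) ∧
      ∀ x, ‖gradC η x‖ ^ 2 ≤ d * (1 / ε) ^ 2 := by
  obtain ⟨ρ, hρ, hρs⟩ := exists_isMollifier (0 : EuclideanSpace ℝ (Fin d)) (half_pos hε)
  -- The truncated distance is 1-Lipschitz, vanishes up to distance `ε` and equals `ε` from distance
  -- `2 * ε` on. Mollifying at scale `ε / 2` keeps these properties with the thresholds `ε / 2` and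
  -- `5 / 2 * ε`, and dividing by `ε` gives the cut-off.
  set ζ : EuclideanSpace ℝ (Fin d) → ℝ := fun x => max (min (infDist x Ωᶜ - ε) ε) 0 with hζ
  have hl : LipschitzWith 1 ζ :=
    (((lipschitz_infDist_pt Ωᶜ).sub (LipschitzWith.const ε)).weaken (by simp)
      |>.min_const ε).max_const 0
  have hζ0 : ∀ x, 0 ≤ ζ x := fun x => le_max_right _ _
  have hζ1 : ∀ x, ζ x ≤ ε := fun x => max_le (min_le_right _ _) hε.le
  have hloc : LocallyIntegrable ζ := hl.continuous.locallyIntegrable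
  have hsup : ∀ t ∈ tsupport ρ, ‖t‖ ≤ ε / 2 := fun t ht => by
    rw [hρs] at ht; simpa using ht
  have hconst : ∀ x k, (∀ t, ‖t‖ ≤ ε / 2 → ζ (x - t) = k) → mollify ρ ζ x = k := by
    intro x k h
    have : mollify ρ ζ x = ∫ t, ρ t • k := by
      refine integral_congr_ae (Filter.Eventually.of_forall fun t => ?_)
      by_cases ht : t ∈ tsupport ρ
      · simp only [h t (hsup t ht)]
      · simp [image_eq_zero_of_notMem_tsupport ht]
    rw [this, integral_smul_const, hρ.integral_eq, one_smul]
  have hdist : ∀ x t : EuclideanSpace ℝ (Fin d), |infDist (x - t) Ωᶜ - infDist x Ωᶜ| ≤ ‖t‖ := by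
    intro x t
    have := (lipschitz_infDist_pt Ωᶜ).dist_le_mul (x - t) x
    simpa [Real.dist_eq, dist_eq_norm] using this
  have hm0 : ∀ x, infDist x Ωᶜ < ε / 2 → mollify ρ ζ x = 0 := fun x hx =>
    hconst x 0 fun t ht => by
      have := (abs_le.1 (hdist x t)).2
      refine max_eq_right ((min_le_left _ _).trans ?_)
      linarith
  have hm1 : ∀ x, 5 / 2 * ε < infDist x Ωᶜ → mollify ρ ζ x = ε := fun x hx =>
    hconst x ε fun t ht => by
      have := (abs_le.1 (hdist x t)).1
      have h1 : ε ≤ infDist (x - t) Ωᶜ - ε := by linarith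
      simp only [hζ, min_eq_right h1, max_eq_left hε.le]
  have hle : ∀ x, mollify ρ ζ x ∈ Icc 0 ε := fun x => by
    refine ⟨integral_nonneg fun t => mul_nonneg (hρ.nonneg t) (hζ0 _), ?_⟩
    calc mollify ρ ζ x ≤ ∫ t, ρ t • ε :=
          integral_mono (hρ.integrable_mollify hloc x) (hρ.integrable.smul_const ε)
            fun t => mul_le_mul_of_nonneg_left (hζ1 _) (hρ.nonneg t)
      _ = ε := by rw [integral_smul_const, hρ.integral_eq, one_smul]
  have hml : ∀ x y, ‖mollify ρ ζ x - mollify ρ ζ y‖ ≤ ‖x - y‖ := fun x y => by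
    have h1 : mollify ρ ζ x - mollify ρ ζ y = ∫ t, ρ t • (ζ (x - t) - ζ (y - t)) := by
      simp only [smul_sub]
      rw [integral_sub (hρ.integrable_mollify hloc x) (hρ.integrable_mollify hloc y)]
      rfl
    rw [h1]
    refine (norm_integral_le_of_norm_le (hρ.integrable.smul_const ‖x - y‖)
      (Filter.Eventually.of_forall fun t => ?_)).trans (le_of_eq ?_)
    · rw [norm_smul, Real.norm_of_nonneg (hρ.nonneg t), smul_eq_mul]
      refine mul_le_mul_of_nonneg_left ?_ (hρ.nonneg t)
      have := hl.dist_le_mul (x - t) (y - t)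
      simpa [dist_eq_norm] using this
    · rw [integral_smul_const, hρ.integral_eq, one_smul]
  have hsm : ContDiff ℝ ∞ fun x => ((1 / ε * mollify ρ ζ x : ℝ) : ℂ) :=
    Complex.ofRealCLM.contDiff.comp (contDiff_const.mul (hρ.contDiff_mollify hloc))
  have hts : tsupport (fun x => ((1 / ε * mollify ρ ζ x : ℝ) : ℂ)) ⊆ Ω := by
    have h1 : tsupport (fun x => ((1 / ε * mollify ρ ζ x : ℝ) : ℂ)) ⊆ {x | ε / 2 ≤ infDist x Ωᶜ} := by
      refine closure_minimal (fun x hx => ?_)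
        (isClosed_le continuous_const (continuous_infDist_pt _))
      by_contra hlt
      exact hx (by simp [hm0 x (not_le.1 hlt)])
    intro x hx
    by_contra hxΩ
    have h2 : infDist x Ωᶜ = 0 := infDist_zero_of_mem hxΩ
    have h3 : ε / 2 ≤ infDist x Ωᶜ := h1 hx
    linarith
  refine ⟨fun x => ((1 / ε * mollify ρ ζ x : ℝ) : ℂ), ⟨hsm, isCompact_of_isClosed_isBounded
    (isClosed_tsupport _) (hΩ.subset hts), hts⟩, fun x => ?_, fun x hx => ⟨?_, ?_⟩, fun x => ?_⟩
  · have h1 : 0 ≤ 1 / ε * mollify ρ ζ x := mul_nonneg (by positivity) (hle x).1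
    have h2 : 1 / ε * mollify ρ ζ x ≤ 1 := by
      rw [one_div, inv_mul_le_iff₀ hε, mul_one]
      exact (hle x).2
    rw [← Complex.ofReal_one, ← Complex.ofReal_sub, Complex.norm_real, Real.norm_eq_abs, abs_le]
    constructor <;> linarith
  · dsimp only
    rw [hm1 x (by linarith), one_div, inv_mul_cancel₀ hε.ne', Complex.ofReal_one]
  · have h1 : (fun x => ((1 / ε * mollify ρ ζ x : ℝ) : ℂ)) =ᶠ[𝓝 x] fun _ => (1 : ℂ) := by
      filter_upwards [(isOpen_lt continuous_const (continuous_infDist_pt Ωᶜ)).mem_nhds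
        (show 5 / 2 * ε < infDist x Ωᶜ by linarith)] with y hy
      rw [hm1 y hy, one_div, inv_mul_cancel₀ hε.ne', Complex.ofReal_one]
    have h2 : fderiv ℝ (fun x => ((1 / ε * mollify ρ ζ x : ℝ) : ℂ)) x = 0 := by
      rw [h1.fderiv_eq]; simp
    ext k
    simp only [gradC, h2]
    simp
  · have h1 : ‖fderiv ℝ (fun x => ((1 / ε * mollify ρ ζ x : ℝ) : ℂ)) x‖ ≤ 1 / ε := by
      refine norm_fderiv_le_of_lip' ℝ (by positivity) (Filter.Eventually.of_forall fun y => ?_)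
      rw [← Complex.ofReal_sub, Complex.norm_real, ← mul_sub, norm_mul,
        Real.norm_of_nonneg (by positivity : 0 ≤ 1 / ε)]
      exact mul_le_mul_of_nonneg_left (hml y x) (by positivity)
    rw [EuclideanSpace.norm_sq_eq]
    calc _ ≤ ∑ _i : Fin d, (1 / ε) ^ 2 := by
          refine Finset.sum_le_sum fun i _ => ?_
          refine pow_le_pow_left₀ (norm_nonneg _) ?_ 2
          refine (ContinuousLinearMap.le_opNorm _ _).trans ?_
          simpa using h1
      _ = d * (1 / ε) ^ 2 := by simp

/-- Smooth functions that are small near the boundary are close to `H¹₀(Ω)`. -/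
lemma exists_mem_H10_sub_le (hΩ : IsOpen Ω) (hb : Bornology.IsBounded Ω) {ε : ℝ} (hε : 0 < ε)
    (φ : smoothFunctions Ω) : ∃ v ∈ H10 Ω, ‖restrictInterior Ω φ - v‖ₑ ^ 2 ≤
      (1 + 2 * ENNReal.ofReal (d * (1 / ε) ^ 2)) *
        (∫⁻ x in strip Ω (3 * ε), ‖(φ : EuclideanSpace ℝ (Fin d) → ℂ) x‖ₑ ^ 2) +
      2 * ∫⁻ x in strip Ω (3 * ε), ‖gradC (φ : EuclideanSpace ℝ (Fin d) → ℂ) x‖ₑ ^ 2 := by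
  obtain ⟨η, hη, h1, h2, h3⟩ := exists_cutoff hb hε
  set f : EuclideanSpace ℝ (Fin d) → ℂ := φ.1 with hf
  have hψ : IsTestFunction Ω fun x => η x * f x :=
    ⟨hη.smooth.mul φ.2.1, hη.compact.mul_right,
      (closure_mono fun x hx => left_ne_zero_of_mul hx).trans hη.support⟩
  set ψ : smoothFunctions Ω := ⟨_, hψ.mem_smoothFunctions hΩ⟩
  refine ⟨_, restrictInterior_mem_H10 ψ hψ, ?_⟩
  have hw : ((φ - ψ : smoothFunctions Ω) : EuclideanSpace ℝ (Fin d) → ℂ)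
      = fun x => (1 - η x) * f x := by
    ext x
    change f x - η x * f x = _
    ring
  have hη1 : ContDiff ℝ ∞ fun x => 1 - η x := contDiff_const.sub hη.smooth
  have hgη : ∀ x, gradC (fun x => 1 - η x) x = -gradC η x := fun x => by
    ext k
    simp [gradC, fderiv_const_sub]
  have hS : MeasurableSet (strip Ω (3 * ε)) := (isOpen_strip hΩ _).measurableSet
  -- The error `(1 - η) f` and its gradient vanish at distance at least `3 * ε`, so integrals over
  -- `Ω` reduce to the strip.
  have key : ∀ g h : EuclideanSpace ℝ (Fin d) → ℝ≥0∞,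
      (∀ x, 3 * ε ≤ infDist x Ωᶜ → g x = 0) → (∀ x, g x ≤ h x) →
      ∫⁻ x in Ω, g x ≤ ∫⁻ x in strip Ω (3 * ε), h x := by
    intro g h hg hgh
    rw [← lintegral_indicator hΩ.measurableSet, ← lintegral_indicator hS]
    refine lintegral_mono fun x => ?_
    by_cases hx : x ∈ strip Ω (3 * ε)
    · rw [indicator_of_mem hx, indicator_of_mem hx.1]; exact hgh x
    · rw [indicator_of_notMem hx]
      by_cases hxΩ : x ∈ Ω
      · rw [indicator_of_mem hxΩ, hg x (not_lt.1 fun hlt => hx ⟨hxΩ, hlt⟩)]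
      · rw [indicator_of_notMem hxΩ]
  rw [← map_sub, enorm_H1_sq, enorm_val_restrictInterior_sq, enorm_grad_restrictInterior_sq, hw]
  have e1 : ∫⁻ x in Ω, ‖(1 - η x) * f x‖ₑ ^ 2 ≤ ∫⁻ x in strip Ω (3 * ε), ‖f x‖ₑ ^ 2 := by
    refine key _ _ (fun x hx => by simp [(h2 x hx).1]) fun x => ?_
    gcongr
    rw [enorm_mul]
    refine mul_le_of_le_one_left' ?_
    rw [← ofReal_norm]
    exact ENNReal.ofReal_le_one.2 (h1 x)
  have e2 : ∫⁻ x in Ω, ‖gradC (fun x => (1 - η x) * f x) x‖ₑ ^ 2 ≤ ∫⁻ x in strip Ω (3 * ε),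
      (2 * ENNReal.ofReal (d * (1 / ε) ^ 2) * ‖f x‖ₑ ^ 2 + 2 * ‖gradC f x‖ₑ ^ 2) := by
    refine key _ _ (fun x hx => ?_) fun x => ?_
    · rw [gradC_mul hη1 φ.2.1, hgη, (h2 x hx).1, (h2 x hx).2]
      simp
    · rw [gradC_mul hη1 φ.2.1, hgη]
      refine (pow_le_pow_left' (enorm_add_le _ _) 2).trans ((ennreal_add_sq_le _ _).trans ?_)
      rw [enorm_smul, enorm_smul, enorm_neg, mul_pow, mul_pow, mul_assoc, mul_comm (‖f x‖ₑ ^ 2)]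
      gcongr
      · rw [← ofReal_norm, ← ENNReal.ofReal_pow (norm_nonneg _)]
        exact ENNReal.ofReal_le_ofReal (h3 x)
      · refine mul_le_of_le_one_left' (pow_le_one' ?_ 2)
        rw [← ofReal_norm]
        exact ENNReal.ofReal_le_one.2 (h1 x)
  have hm : Measurable fun x => ‖f x‖ₑ ^ 2 := (φ.2.1.continuous.measurable.enorm).pow_const 2
  have hm' : Measurable fun x => ‖gradC f x‖ₑ ^ 2 := ((measurable_gradC φ.2.1).enorm).pow_const 2
  rw [lintegral_add_left (hm.const_mul _), lintegral_const_mul _ hm, lintegral_const_mul _ hm'] at e2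
  refine (add_le_add e1 e2).trans (le_of_eq ?_)
  ring

end Cutoff

/-! ### The kernel of the trace -/

section Kernel

open scoped ENNReal NNReal
open Set Metric

variable {d : ℕ} {Ω : Set (EuclideanSpace ℝ (Fin d))}

lemma strip_mono (Ω : Set (EuclideanSpace ℝ (Fin d))) {s t : ℝ} (h : s ≤ t) :
    strip Ω s ⊆ strip Ω t :=
  fun _ hx => ⟨hx.1, (show infDist _ Ωᶜ < _ from hx.2).trans_le h⟩

lemma iInter_strip (hΩ : IsOpen Ω) (hne : Ωᶜ.Nonempty) :
    ⋂ n : ℕ, strip Ω (1 / ((n : ℝ) + 1)) = ∅ := by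
  refine eq_empty_of_forall_notMem fun x hx => ?_
  rw [mem_iInter] at hx
  have h1 : 0 < infDist x Ωᶜ :=
    (hΩ.isClosed_compl.notMem_iff_infDist_pos hne).1 fun h => h (hx 0).1
  obtain ⟨n, hn⟩ := exists_nat_one_div_lt h1
  exact lt_asymm hn (hx n).2

/-- The strips decrease to the empty set within finite volume, so this is absolute continuity of the
integral. -/
lemma exists_lintegral_strip_le (hΩ : IsOpen Ω) (hb : Bornology.IsBounded Ω) (hne : Ωᶜ.Nonempty)
    {f : EuclideanSpace ℝ (Fin d) → ℝ≥0∞} (hf : ∫⁻ x in Ω, f x ≠ ⊤) {δ : ℝ≥0∞} (hδ : 0 < δ) :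
    ∃ τ > 0, ∫⁻ x in strip Ω τ, f x ≤ δ := by
  have h1 : Filter.Tendsto (fun n : ℕ => volume (strip Ω (1 / ((n : ℝ) + 1)))) Filter.atTop (𝓝 0) := by
    have := tendsto_measure_iInter_atTop (μ := volume)
      (s := fun n : ℕ => strip Ω (1 / ((n : ℝ) + 1)))
      (fun n => (isOpen_strip hΩ _).measurableSet.nullMeasurableSet)
      (fun m n hmn => strip_mono Ω (one_div_le_one_div_of_le (by positivity)
        (by exact_mod_cast Nat.succ_le_succ hmn)))
      ⟨0, ((measure_mono inter_subset_left).trans_lt hb.measure_lt_top).ne⟩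
    rwa [iInter_strip hΩ hne, measure_empty] at this
  have h2 : ∀ n : ℕ, (volume.restrict Ω).restrict (strip Ω (1 / ((n : ℝ) + 1)))
      = volume.restrict (strip Ω (1 / ((n : ℝ) + 1))) := fun n =>
    Measure.restrict_restrict_of_subset inter_subset_left
  have h3 : Filter.Tendsto ((volume.restrict Ω) ∘ fun n : ℕ => strip Ω (1 / ((n : ℝ) + 1)))
      Filter.atTop (𝓝 0) := by
    refine h1.congr fun n => ?_
    rw [Function.comp_apply, ← Measure.restrict_apply_univ, ← h2, Measure.restrict_apply_univ]
  obtain ⟨n, hn⟩ := ((tendsto_setLIntegral_zero hf h3).eventually_le_const hδ).exists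
  exact ⟨_, Nat.one_div_pos_of_nat, by rwa [h2] at hn⟩

lemma lintegral_enorm_sq_le {F : Type*} [NormedAddCommGroup F] (f : Lp F 2 (volume.restrict Ω))
    {g : EuclideanSpace ℝ (Fin d) → F} (hg : MemLp g 2 (volume.restrict Ω))
    {S : Set (EuclideanSpace ℝ (Fin d))} (hS : S ⊆ Ω) :
    ∫⁻ x in S, ‖g x‖ₑ ^ 2 ≤ 2 * (∫⁻ x in S, ‖f x‖ₑ ^ 2) + 2 * ‖f - hg.toLp g‖ₑ ^ 2 := by
  have hm : AEMeasurable (fun x => ‖f x‖ₑ ^ 2) (volume.restrict S) :=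
    ((Lp.aestronglyMeasurable f).mono_measure (Measure.restrict_mono hS le_rfl)).enorm.pow_const 2
  have h1 : ∫⁻ x in S, ‖g x‖ₑ ^ 2 ≤ ∫⁻ x in S, (2 * ‖f x‖ₑ ^ 2 + 2 * ‖(f - hg.toLp g) x‖ₑ ^ 2) := by
    refine lintegral_mono_ae (ae_restrict_of_ae_restrict_of_subset hS ?_)
    filter_upwards [Lp.coeFn_sub f (hg.toLp g), hg.coeFn_toLp] with x hx hx'
    rw [hx, Pi.sub_apply, hx']
    calc ‖g x‖ₑ ^ 2 = ‖f x - (f x - g x)‖ₑ ^ 2 := by rw [sub_sub_cancel]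
      _ ≤ (‖f x‖ₑ + ‖f x - g x‖ₑ) ^ 2 := by gcongr; exact enorm_sub_le
      _ ≤ _ := ennreal_add_sq_le _ _
  rw [lintegral_add_left' (hm.const_mul 2), lintegral_const_mul'' _ hm,
    lintegral_const_mul' _ _ (by norm_num)] at h1
  refine h1.trans ?_
  rw [enorm_Lp_sq]
  gcongr

lemma IsBoundedLipschitzDomain.nonempty_compl (hΩ : IsBoundedLipschitzDomain Ω) (hd : 1 ≤ d) :
    Ωᶜ.Nonempty := by
  rw [Set.nonempty_compl]
  rintro rfl
  have : Nonempty (Fin d) := ⟨⟨0, hd⟩⟩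
  exact NormedSpace.unbounded_univ ℝ (EuclideanSpace ℝ (Fin d)) hΩ.isBounded

/-- Functions with vanishing trace belong to `H¹₀(Ω)`. -/
lemma IsBoundedLipschitzDomain.mem_H10 (hΩ : IsBoundedLipschitzDomain Ω) (hd : 1 ≤ d) {u : H1 Ω}
    (hu : trace Ω u = 0) : u ∈ H10 Ω := by
  obtain ⟨C, c, τ₀, hc, hτ₀, hstrip⟩ := hΩ.strip_estimate hd
  set B : ℝ≥0∞ := ENNReal.ofReal (d * (3 / c) ^ 2)
  set K : ℝ≥0∞ := 12 + 10 * C * B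
  have hK : K ≠ ⊤ := by finiteness
  -- H¹₀(Ω) is closed, so approximation suffices. It matters that `K` depends neither on `δ` nor on
  -- the width `τ` chosen below.
  suffices key : ∀ δ : ℝ≥0∞, 0 < δ → δ ≠ ⊤ → ∃ v ∈ H10 Ω, ‖u - v‖ₑ ^ 2 ≤ (2 + 2 * K) * δ by
    have hcl : IsClosed (H10 Ω : Set (H1 Ω)) := Submodule.isClosed_topologicalClosure _
    rw [← SetLike.mem_coe, ← hcl.closure_eq, Metric.mem_closure_iff]
    intro e he
    have hK0 : 2 + 2 * K ≠ 0 := by simp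
    have hK1 : 2 + 2 * K ≠ ⊤ := by finiteness
    obtain ⟨v, hv, hv'⟩ := key (ENNReal.ofReal (e / 2) ^ 2 / (2 + 2 * K))
      (ENNReal.div_pos (by simpa using he) hK1) (ENNReal.div_ne_top (by finiteness) hK0)
    rw [ENNReal.mul_div_cancel hK0 hK1, ENNReal.pow_le_pow_left_iff two_ne_zero, ← ofReal_norm,
      ENNReal.ofReal_le_ofReal_iff (by positivity)] at hv'
    exact ⟨v, hv, by rw [dist_eq_norm]; linarith⟩
  intro δ hδ hδ'
  have hfin : ∫⁻ x in Ω, (‖val Ω u x‖ₑ ^ 2 + ‖grad Ω u x‖ₑ ^ 2) ≠ ⊤ := by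
    rw [lintegral_add_left' ((Lp.aestronglyMeasurable (val Ω u)).enorm.pow_const 2),
      ← enorm_Lp_sq, ← enorm_Lp_sq]
    finiteness
  obtain ⟨τ₁, hτ₁, hu₁⟩ := exists_lintegral_strip_le hΩ.isOpen hΩ.isBounded (hΩ.nonempty_compl hd)
    hfin hδ
  set τ := min τ₀ (min τ₁ (τ₁ / c))
  have hτ : 0 < τ := lt_min hτ₀ (lt_min hτ₁ (by positivity))
  have hττ₁ : τ ≤ τ₁ := (min_le_right _ _).trans (min_le_left _ _)
  have hcτ : c * τ ≤ τ₁ := by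
    have : τ ≤ τ₁ / c := (min_le_right _ _).trans (min_le_right _ _)
    rwa [le_div_iff₀ hc, mul_comm] at this
  -- The approximation is chosen after `τ`, so that its trace is small even compared with `τ`. The
  -- strip estimate then bounds the mass of `φ` near the boundary by a multiple of `τ² δ`.
  obtain ⟨φ, hφ1, hφ2⟩ : ∃ φ, ‖u - restrictInterior Ω φ‖ₑ ^ 2 < δ ∧
      ‖trace Ω (restrictInterior Ω φ)‖ₑ ^ 2 < ENNReal.ofReal τ * δ := by
    refine (hΩ.denseRange_restrictInterior hd).exists_mem_open
      (s := {w | ‖u - w‖ₑ ^ 2 < δ ∧ ‖trace Ω w‖ₑ ^ 2 < ENNReal.ofReal τ * δ}) ?_ ⟨u, ?_, ?_⟩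
    · exact (isOpen_lt ((ENNReal.continuous_pow 2).comp (by fun_prop)) continuous_const).inter
        (isOpen_lt ((ENNReal.continuous_pow 2).comp (by fun_prop)) continuous_const)
    · rw [sub_self, ← ofReal_norm, norm_zero]
      simpa using hδ
    · rw [hu]
      simpa using ⟨hτ, hδ⟩
  set f : EuclideanSpace ℝ (Fin d) → ℂ := φ.1 with hf
  have hval : ‖val Ω u - (smoothFunctions_memLp Ω φ).toLp f‖ₑ ^ 2 ≤ δ := by
    refine le_trans ?_ hφ1.le
    rw [enorm_H1_sq, map_sub]
    exact le_self_add
  have hgrad : ‖grad Ω u - (smoothFunctions_memLp_grad Ω φ).toLp (gradC f)‖ₑ ^ 2 ≤ δ := by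
    refine le_trans ?_ hφ1.le
    rw [enorm_H1_sq, map_sub (grad Ω)]
    exact le_add_self
  have hf1 : ∫⁻ x in strip Ω τ₁, ‖f x‖ₑ ^ 2 ≤ 4 * δ := by
    calc _ ≤ _ := lintegral_enorm_sq_le (val Ω u) (smoothFunctions_memLp Ω φ) inter_subset_left
      _ ≤ 2 * δ + 2 * δ := by
        gcongr
        exact (lintegral_mono fun x => le_self_add).trans hu₁
      _ = 4 * δ := by ring
  have hf2 : ∫⁻ x in strip Ω τ₁, ‖gradC f x‖ₑ ^ 2 ≤ 4 * δ := by
    calc _ ≤ _ := lintegral_enorm_sq_le (grad Ω u) (smoothFunctions_memLp_grad Ω φ) inter_subset_left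
      _ ≤ 2 * δ + 2 * δ := by
        gcongr
        exact (lintegral_mono fun x => le_add_self).trans hu₁
      _ = 4 * δ := by ring
  have hf3 : ∫⁻ x in strip Ω (c * τ), ‖f x‖ₑ ^ 2 ≤ 5 * C * ENNReal.ofReal τ ^ 2 * δ := by
    calc _ ≤ _ := hstrip τ hτ (min_le_left _ _) f φ.2.1
      _ ≤ C * (ENNReal.ofReal τ * (ENNReal.ofReal τ * δ) + ENNReal.ofReal τ ^ 2 * (4 * δ)) := by
        gcongr
        · rw [← enorm_restrictBoundary_sq, ← hΩ.trace_restrictInterior hd]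
          exact hφ2.le
        · exact (lintegral_mono_set (strip_mono Ω hττ₁)).trans hf2
      _ = _ := by ring
  have hε : 0 < c * τ / 3 := by positivity
  obtain ⟨v, hv, hv'⟩ := exists_mem_H10_sub_le hΩ.isOpen hΩ.isBounded hε φ
  have h3ε : 3 * (c * τ / 3) = c * τ := by ring
  rw [h3ε] at hv'
  -- The squared gradient of the cut-off, of order `1 / τ²`, meets the factor `τ²` of the strip
  -- estimate, and the width cancels.
  have hB : ENNReal.ofReal (d * (1 / (c * τ / 3)) ^ 2) * ENNReal.ofReal τ ^ 2 = B := by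
    rw [← ENNReal.ofReal_pow hτ.le, ← ENNReal.ofReal_mul (by positivity)]
    congr 1
    field_simp
  refine ⟨v, hv, ?_⟩
  have h4 : ‖restrictInterior Ω φ - v‖ₑ ^ 2 ≤ K * δ := by
    refine hv'.trans ?_
    rw [add_mul, one_mul, mul_assoc]
    calc _ ≤ 4 * δ + 2 * (ENNReal.ofReal (d * (1 / (c * τ / 3)) ^ 2)
          * (5 * C * ENNReal.ofReal τ ^ 2 * δ)) + 2 * (4 * δ) := by
          gcongr
          · exact (lintegral_mono_set (strip_mono Ω hcτ)).trans hf1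
          · exact (lintegral_mono_set (strip_mono Ω hcτ)).trans hf2
      _ = 4 * δ + 10 * C * (ENNReal.ofReal (d * (1 / (c * τ / 3)) ^ 2) * ENNReal.ofReal τ ^ 2) * δ
          + 8 * δ := by ring
      _ = K * δ := by rw [hB]; ring
  calc ‖u - v‖ₑ ^ 2 = ‖(u - restrictInterior Ω φ) + (restrictInterior Ω φ - v)‖ₑ ^ 2 := by
        rw [sub_add_sub_cancel]
    _ ≤ (‖u - restrictInterior Ω φ‖ₑ + ‖restrictInterior Ω φ - v‖ₑ) ^ 2 := by
        gcongr; exact enorm_add_le _ _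
    _ ≤ _ := ennreal_add_sq_le _ _
    _ ≤ 2 * δ + 2 * (K * δ) := by gcongr
    _ = _ := by ring

lemma IsBoundedLipschitzDomain.trace_eq_zero_iff (hΩ : IsBoundedLipschitzDomain Ω) (hd : 1 ≤ d)
    (u : H1 Ω) : trace Ω u = 0 ↔ u ∈ H10 Ω :=
  ⟨hΩ.mem_H10 hd, hΩ.trace_eq_zero hd⟩

end Kernel

/-! ### Quantitative compactness of the embedding into L² -/

section Compactness

open scoped ENNReal NNReal
open Set Metric

variable {d : ℕ} {Ω : Set (EuclideanSpace ℝ (Fin d))}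

lemma two_mul_ofReal (a : ℝ) : 2 * ENNReal.ofReal a = ENNReal.ofReal (2 * a) := by
  rw [ENNReal.ofReal_mul zero_le_two, ENNReal.ofReal_ofNat]

/-- The difference is the integral of the derivative along the segment from `x` to `x - t`. After
Tonelli, each translate is an integral of the gradient over a part of `Ω`. -/
lemma lintegral_translate_sub_le (hΩ : MeasurableSet Ω) {φ : EuclideanSpace ℝ (Fin d) → ℂ}
    (hφ : ContDiff ℝ ∞ φ) {A : Set (EuclideanSpace ℝ (Fin d))} (hA : MeasurableSet A)
    {t : EuclideanSpace ℝ (Fin d)} (h : ∀ x ∈ A, ∀ θ ∈ Ioo (0 : ℝ) 1, x - θ • t ∈ Ω) :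
    ∫⁻ x in A, ‖φ (x - t) - φ x‖ₑ ^ 2 ≤ 2 * ‖t‖ₑ ^ 2 * ∫⁻ x in Ω, ‖gradC φ x‖ₑ ^ 2 := by
  have hg : Measurable fun x => ‖gradC φ x‖ₑ ^ 2 := (measurable_gradC hφ).enorm.pow_const 2
  have hg2 : Measurable fun q : EuclideanSpace ℝ (Fin d) × ℝ => ‖gradC φ (q.1 - q.2 • t)‖ₑ ^ 2 :=
    hg.comp (Continuous.measurable (by fun_prop))
  have hpt : ∀ x, ‖φ (x - t) - φ x‖ₑ ^ 2 ≤
      2 * ‖t‖ₑ ^ 2 * ∫⁻ θ in Ioo (0 : ℝ) 1, ‖gradC φ (x - θ • t)‖ₑ ^ 2 := by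
    intro x
    have hd : ∀ θ : ℝ, HasDerivAt (fun θ : ℝ => φ (x - θ • t) - φ x)
        (fderiv ℝ φ (x - θ • t) (-t)) θ := by
      intro θ
      have h1 : HasDerivAt (fun θ : ℝ => x - θ • t) (-t) θ := by
        simpa using ((hasDerivAt_id θ).smul_const t).const_sub x
      exact (((hφ.differentiable (by simp) (x - θ • t)).hasFDerivAt).comp_hasDerivAt θ h1).sub_const _
    have hc : Continuous fun θ : ℝ => fderiv ℝ φ (x - θ • t) (-t) :=
      ((hφ.continuous_fderiv (by simp)).comp (by fun_prop)).clm_apply continuous_const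
    have h1 := enorm_sq_le_of_hasDerivAt hd hc (s := 1) (a := 1) (b := 0) (by simp) (by simp)
    simp only [one_smul, zero_smul, sub_zero, sub_self, enorm_zero, ENNReal.ofReal_one] at h1
    refine h1.trans ?_
    have hm : Measurable fun θ : ℝ => ‖gradC φ (x - θ • t)‖ₑ ^ 2 :=
      hg.comp (Continuous.measurable (by fun_prop))
    rw [zero_pow two_ne_zero, mul_zero, zero_add, mul_one, mul_assoc, ← lintegral_const_mul _ hm]
    refine mul_le_mul' le_rfl (lintegral_mono fun θ => ?_)
    rw [← mul_pow]
    refine pow_le_pow_left' ?_ 2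
    rw [← ofReal_norm, ← ofReal_norm, ← ofReal_norm, ← ENNReal.ofReal_mul (norm_nonneg _)]
    exact ENNReal.ofReal_le_ofReal (by simpa using norm_fderiv_apply_le φ (x - θ • t) (-t))
  calc _ ≤ ∫⁻ x in A, 2 * ‖t‖ₑ ^ 2 * ∫⁻ θ in Ioo (0 : ℝ) 1, ‖gradC φ (x - θ • t)‖ₑ ^ 2 :=
        lintegral_mono hpt
    _ = 2 * ‖t‖ₑ ^ 2 * ∫⁻ θ in Ioo (0 : ℝ) 1, ∫⁻ x in A, ‖gradC φ (x - θ • t)‖ₑ ^ 2 := by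
        rw [lintegral_const_mul' _ _ (by finiteness), lintegral_lintegral_swap hg2.aemeasurable]
    _ ≤ 2 * ‖t‖ₑ ^ 2 * ∫⁻ θ in Ioo (0 : ℝ) 1, ∫⁻ x in Ω, ‖gradC φ x‖ₑ ^ 2 := by
        gcongr 2 * ‖t‖ₑ ^ 2 * ?_
        refine setLIntegral_mono measurable_const fun θ hθ => ?_
        rw [← lintegral_indicator hA, ← lintegral_indicator hΩ,
          ← lintegral_sub_right_eq_self (Ω.indicator fun x => ‖gradC φ x‖ₑ ^ 2) (θ • t)]
        refine lintegral_mono fun x => ?_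
        by_cases hx : x ∈ A
        · rw [indicator_of_mem hx, indicator_of_mem (h x hx θ hθ)]
        · rw [indicator_of_notMem hx]; exact zero_le
    _ = _ := by simp

/-- Away from the boundary, the `L²` norm is controlled by finitely many functionals up to a small
multiple of the `H¹` norm. -/
lemma exists_interior_estimate (hΩ : IsOpen Ω) (hb : Bornology.IsBounded Ω) {r ε : ℝ} (hr : 0 < r)
    (hε : 0 < ε) : ∃ t : Finset (L2 Ω), ∀ φ : smoothFunctions Ω,
      ∫⁻ x in Ω \ strip Ω r, ‖(φ : EuclideanSpace ℝ (Fin d) → ℂ) x‖ₑ ^ 2 ≤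
        ENNReal.ofReal ε * ‖restrictInterior Ω φ‖ₑ ^ 2 +
          4 * volume Ω * (∑ k ∈ t, ‖⟪k, val Ω (restrictInterior Ω φ)⟫_ℂ‖ₑ) ^ 2 := by
  classical
  have hV : volume Ω ≠ ⊤ := hb.measure_lt_top.ne
  -- `s < r` keeps the mollification inside `Ω` at points outside the strip, and `s ^ 2 ≤ ε / 8`
  -- makes the mollification error small relative to the gradient.
  set s := min (r / 2) (√(ε / 8))
  have hs : 0 < s := lt_min (by positivity) (by positivity)
  have hs2 : s ^ 2 ≤ ε / 8 := by
    calc s ^ 2 ≤ √(ε / 8) ^ 2 := by gcongr; exact min_le_right _ _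
      _ = ε / 8 := Real.sq_sqrt (by positivity)
  have hsr : s < r := (min_le_left _ _).trans_lt (by linarith)
  -- Small enough that `4 * volume Ω * η ≤ ε / 2`.
  set η := ε / (8 * ((volume Ω).toReal + 1))
  have hη : 0 < η := by positivity
  have hVη : 4 * (volume Ω * ENNReal.ofReal η) ≤ ENNReal.ofReal (ε / 2) := by
    rw [← ENNReal.ofReal_toReal hV, ← ENNReal.ofReal_mul ENNReal.toReal_nonneg,
      show (4 : ℝ≥0∞) = ENNReal.ofReal 4 by simp, ← ENNReal.ofReal_mul (by norm_num)]
    refine ENNReal.ofReal_le_ofReal ?_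
    have : (volume Ω).toReal / ((volume Ω).toReal + 1) ≤ 1 :=
      div_le_one_of_le₀ (by linarith) (by positivity)
    calc 4 * ((volume Ω).toReal * η) = ε / 2 * ((volume Ω).toReal / ((volume Ω).toReal + 1)) := by
          simp only [η]; field_simp; ring
      _ ≤ ε / 2 * 1 := by gcongr
      _ = ε / 2 := mul_one _
  obtain ⟨ρ, hρ, hρs⟩ := exists_isMollifier (0 : EuclideanSpace ℝ (Fin d)) hs
  have hρL : MemLp ρ 2 volume := hρ.smooth.continuous.memLp_of_hasCompactSupport hρ.compact
  have hkm : ∀ x, MemLp (fun t => (ρ (x - t) : ℂ)) 2 (volume.restrict Ω) := fun x => by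
    refine (MemLp.ofReal ?_).restrict Ω
    exact hρL.comp_measurePreserving (Measure.measurePreserving_sub_left volume x)
  set k : EuclideanSpace ℝ (Fin d) → L2 Ω := fun x => (hkm x).toLp _
  obtain ⟨δ, hδ, hδ'⟩ := exists_lintegral_translate_sub_le hρL
    (ε := ENNReal.ofReal η) (by simpa using hη)
  have hk : ∀ x y, dist x y < δ → ‖k x - k y‖ₑ ^ 2 ≤ ENNReal.ofReal η := by
    intro x y hxy
    rw [← MemLp.toLp_sub, enorm_toLp_sq]
    refine (setLIntegral_le_lintegral _ _).trans ?_
    refine le_trans (le_of_eq ?_) (hδ' (y - x) (by rwa [← dist_eq_norm, dist_comm]))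
    rw [← lintegral_sub_left_eq_self _ y]
    refine lintegral_congr fun t => ?_
    rw [Pi.sub_apply, ← Complex.ofReal_sub, ← ofReal_norm, Complex.norm_real, ofReal_norm]
    rw [sub_sub_cancel, show x - (y - t) = t - (y - x) by abel]
  -- The mollified value at `x` is the inner product with `k x`, and `k` is uniformly continuous
  -- into L². By compactness finitely many kernels approximate all of them; these are the
  -- functionals.
  obtain ⟨F, -, hF, hcov⟩ := hb.isCompact_closure.finite_cover_balls hδ
  refine ⟨hF.toFinset.image k, fun φ => ?_⟩
  set f : EuclideanSpace ℝ (Fin d) → ℂ := φ.1 with hf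
  set w := restrictInterior Ω φ
  set S := ∑ k ∈ hF.toFinset.image k, ‖⟪k, val Ω w⟫_ℂ‖ₑ
  have hA : MeasurableSet (Ω \ strip Ω r) := hΩ.measurableSet.diff (isOpen_strip hΩ r).measurableSet
  have hfar : ∀ x ∈ Ω \ strip Ω r, ∀ y, dist x y ≤ s → y ∈ Ω := by
    intro x hx y hy
    by_contra hyΩ
    exact hx.2 ⟨hx.1, infDist_compl_lt hyΩ (hy.trans_lt hsr)⟩
  have hmol : ∀ x ∈ Ω \ strip Ω r, mollify ρ f x = ⟪k x, val Ω w⟫_ℂ := by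
    intro x hx
    rw [mollify_eq_swap, L2.inner_def, ← setIntegral_eq_integral_of_forall_compl_eq_zero (s := Ω)]
    · refine integral_congr_ae ?_
      filter_upwards [(hkm x).coeFn_toLp, val_restrictInterior_coeFn φ] with t h1 h2
      rw [h1, h2]
      simp [RCLike.inner_apply, mul_comm, hf]
    · intro t ht
      rw [image_eq_zero_of_notMem_tsupport (f := ρ), zero_smul]
      rw [hρs, mem_closedBall_zero_iff, ← dist_eq_norm]
      exact fun h => ht (hfar x hx t h)
  have hmol' : ∀ x ∈ Ω \ strip Ω r, ‖mollify ρ f x‖ₑ ^ 2 ≤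
      2 * (ENNReal.ofReal η * ‖val Ω w‖ₑ ^ 2) + 2 * S ^ 2 := by
    intro x hx
    obtain ⟨y, hy, hxy⟩ := mem_iUnion₂.1 (hcov (subset_closure hx.1))
    rw [hmol x hx]
    have h1 : ‖⟪k y, val Ω w⟫_ℂ‖ₑ ≤ S :=
      Finset.single_le_sum (f := fun k => ‖⟪k, val Ω w⟫_ℂ‖ₑ) (fun _ _ => zero_le)
        (Finset.mem_image_of_mem k (hF.mem_toFinset.2 hy))
    have h2 : ‖⟪k x - k y, val Ω w⟫_ℂ‖ₑ ≤ ‖k x - k y‖ₑ * ‖val Ω w‖ₑ := by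
      rw [← ofReal_norm, ← ofReal_norm, ← ofReal_norm, ← ENNReal.ofReal_mul (norm_nonneg _)]
      exact ENNReal.ofReal_le_ofReal (norm_inner_le_norm _ _)
    calc ‖⟪k x, val Ω w⟫_ℂ‖ₑ ^ 2 = ‖⟪k x - k y, val Ω w⟫_ℂ + ⟪k y, val Ω w⟫_ℂ‖ₑ ^ 2 := by
          rw [inner_sub_left, sub_add_cancel]
      _ ≤ (‖k x - k y‖ₑ * ‖val Ω w‖ₑ + S) ^ 2 := by
          gcongr
          exact (enorm_add_le _ _).trans (add_le_add h2 h1)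
      _ ≤ 2 * (‖k x - k y‖ₑ * ‖val Ω w‖ₑ) ^ 2 + 2 * S ^ 2 := ennreal_add_sq_le _ _
      _ ≤ _ := by
          rw [mul_pow]
          gcongr
          exact hk x y hxy
  have hd : ∫⁻ x in Ω \ strip Ω r, ‖mollify ρ f x - f x‖ₑ ^ 2 ≤
      ENNReal.ofReal (ε / 4) * ‖grad Ω w‖ₑ ^ 2 := by
    refine hρ.lintegral_mollify_sub_le φ.2.1.continuous.measurable
      φ.2.1.continuous.locallyIntegrable fun t ht => ?_
    have hts : ‖t‖ ≤ s := by rwa [hρs, mem_closedBall_zero_iff] at ht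
    refine (lintegral_translate_sub_le hΩ.measurableSet φ.2.1 hA fun x hx θ hθ =>
      hfar x hx _ ?_).trans ?_
    · rw [dist_eq_norm, sub_sub_cancel, norm_smul, Real.norm_of_nonneg hθ.1.le]
      exact (mul_le_of_le_one_left (norm_nonneg _) hθ.2.le).trans hts
    · rw [enorm_grad_restrictInterior_sq]
      gcongr
      rw [← ofReal_norm, ← ENNReal.ofReal_pow (norm_nonneg _), two_mul_ofReal]
      refine ENNReal.ofReal_le_ofReal ?_
      have : ‖t‖ ^ 2 ≤ s ^ 2 := by gcongr
      linarith
  have hmm : Measurable fun x => ‖mollify ρ f x - f x‖ₑ ^ 2 :=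
    (((hρ.contDiff_mollify φ.2.1.continuous.locallyIntegrable).continuous.sub
      φ.2.1.continuous).measurable.enorm).pow_const 2
  calc ∫⁻ x in Ω \ strip Ω r, ‖f x‖ₑ ^ 2
      ≤ ∫⁻ x in Ω \ strip Ω r, (2 * ‖mollify ρ f x - f x‖ₑ ^ 2
        + 2 * (2 * (ENNReal.ofReal η * ‖val Ω w‖ₑ ^ 2) + 2 * S ^ 2)) := by
        refine setLIntegral_mono ((hmm.const_mul 2).add_const _) fun x hx => ?_
        calc ‖f x‖ₑ ^ 2 = ‖mollify ρ f x - (mollify ρ f x - f x)‖ₑ ^ 2 := by rw [sub_sub_cancel]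
          _ ≤ (‖mollify ρ f x‖ₑ + ‖mollify ρ f x - f x‖ₑ) ^ 2 := by gcongr; exact enorm_sub_le
          _ ≤ _ := (ennreal_add_sq_le _ _).trans (by
            rw [add_comm]
            gcongr
            exact hmol' x hx)
    _ = 2 * (∫⁻ x in Ω \ strip Ω r, ‖mollify ρ f x - f x‖ₑ ^ 2)
        + 2 * (2 * (ENNReal.ofReal η * ‖val Ω w‖ₑ ^ 2) + 2 * S ^ 2) * volume (Ω \ strip Ω r) := by
        rw [lintegral_add_left (hmm.const_mul 2), lintegral_const_mul _ hmm, setLIntegral_const]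
    _ ≤ 2 * (ENNReal.ofReal (ε / 4) * ‖grad Ω w‖ₑ ^ 2)
        + 2 * (2 * (ENNReal.ofReal η * ‖val Ω w‖ₑ ^ 2) + 2 * S ^ 2) * volume Ω := by
        gcongr
        exact sdiff_subset
    _ = 2 * ENNReal.ofReal (ε / 4) * ‖grad Ω w‖ₑ ^ 2
        + 4 * (volume Ω * ENNReal.ofReal η) * ‖val Ω w‖ₑ ^ 2 + 4 * volume Ω * S ^ 2 := by ring
    _ ≤ ENNReal.ofReal ε * ‖grad Ω w‖ₑ ^ 2 + ENNReal.ofReal ε * ‖val Ω w‖ₑ ^ 2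
        + 4 * volume Ω * S ^ 2 := by
        gcongr
        · rw [two_mul_ofReal]
          exact ENNReal.ofReal_le_ofReal (by linarith)
        · exact hVη.trans (ENNReal.ofReal_le_ofReal (by linarith))
    _ = _ := by rw [enorm_H1_sq w]; ring

/-- The `L²` norm is controlled by the trace and finitely many functionals, up to a small multiple
of the `H¹` norm. -/
lemma IsBoundedLipschitzDomain.le_trace (hΩ : IsBoundedLipschitzDomain Ω) (hd : 1 ≤ d) {ε : ℝ}
    (hε : 0 < ε) : ∃ (t : Finset (H1 Ω)) (C : ℝ), ∀ u,
      ‖valL Ω u‖ ≤ ε * ‖u‖ + C * ‖trace Ω u‖ + C * ∑ b ∈ t, ‖⟪b, u⟫_ℂ‖ := by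
  classical
  obtain ⟨C, c, τ₀, hc, hτ₀, hstrip⟩ := hΩ.strip_estimate hd
  have hV : volume Ω ≠ ⊤ := hΩ.isBounded.measure_lt_top.ne
  -- The strip of width `c * τ` costs `C * τ ^ 2 ≤ ε ^ 2 / 2` and the interior estimate another `ε ^
  -- 2 / 2`, which add up to `ε ^ 2` after squaring.
  set τ := min τ₀ (min 1 (ε ^ 2 / (2 * (C + 1))))
  have hτ : 0 < τ := lt_min hτ₀ (lt_min one_pos (by positivity))
  have hτ1 : τ ≤ 1 := (min_le_right _ _).trans (min_le_left _ _)
  have hCτ : C * τ ^ 2 ≤ ε ^ 2 / 2 := by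
    calc C * τ ^ 2 ≤ (C + 1) * τ := by
          gcongr
          · linarith
          · nlinarith
      _ ≤ (C + 1) * (ε ^ 2 / (2 * (C + 1))) := by
          gcongr
          exact (min_le_right _ _).trans (min_le_right _ _)
      _ = ε ^ 2 / 2 := by field_simp
  obtain ⟨t, ht⟩ := exists_interior_estimate hΩ.isOpen hΩ.isBounded (mul_pos hc hτ)
    (show 0 < ε ^ 2 / 2 by positivity)
  set V := (volume Ω).toReal
  have hV0 : 0 ≤ V := ENNReal.toReal_nonneg
  set D : ℝ := 1 + C + 4 * V
  -- As `D ≥ 1`, its square dominates both coefficients `C * τ` and `4 * V` in the squared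
  -- inequality.
  have hD : D ≤ D ^ 2 := by
    have : 1 ≤ D := by simp only [D]; linarith [C.2]
    nlinarith
  set adj := ContinuousLinearMap.adjoint (valL Ω)
  have key : ∀ φ : smoothFunctions Ω, ‖valL Ω (restrictInterior Ω φ)‖ ≤
      ε * ‖restrictInterior Ω φ‖ + D * ‖trace Ω (restrictInterior Ω φ)‖
        + D * ∑ k ∈ t, ‖⟪k, val Ω (restrictInterior Ω φ)⟫_ℂ‖ := by
    intro φ
    set w := restrictInterior Ω φ
    set T := ‖trace Ω w‖
    set S := ∑ k ∈ t, ‖⟪k, val Ω w⟫_ℂ‖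
    have hS : (∑ k ∈ t, ‖⟪k, val Ω w⟫_ℂ‖ₑ) = ENNReal.ofReal S := by
      rw [ENNReal.ofReal_sum_of_nonneg fun _ _ => norm_nonneg _]
      simp
    have hS0 : 0 ≤ S := Finset.sum_nonneg fun _ _ => norm_nonneg _
    have h1 : ‖val Ω w‖ₑ ^ 2 ≤ C * (ENNReal.ofReal τ * ‖trace Ω w‖ₑ ^ 2
        + ENNReal.ofReal τ ^ 2 * ‖w‖ₑ ^ 2) +
        (ENNReal.ofReal (ε ^ 2 / 2) * ‖w‖ₑ ^ 2 + 4 * volume Ω * ENNReal.ofReal S ^ 2) := by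
      rw [enorm_val_restrictInterior_sq, ← lintegral_inter_add_sdiff _ Ω
        (isOpen_strip hΩ.isOpen (c * τ)).measurableSet,
        inter_eq_self_of_subset_right (show strip Ω (c * τ) ⊆ Ω from inter_subset_left)]
      refine add_le_add ((hstrip τ hτ (min_le_left _ _) _ φ.2.1).trans ?_) (hS ▸ ht φ)
      rw [hΩ.trace_restrictInterior hd, enorm_restrictBoundary_sq]
      gcongr
      rw [enorm_H1_sq, enorm_grad_restrictInterior_sq]
      exact (lintegral_mono_set inter_subset_left).trans le_add_self
    have h2 := ENNReal.toReal_mono (by finiteness) h1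
    rw [ENNReal.toReal_add (by finiteness) (by finiteness), ENNReal.toReal_mul,
      ENNReal.toReal_add (by finiteness) (by finiteness),
      ENNReal.toReal_add (by finiteness) (by finiteness)] at h2
    simp only [ENNReal.toReal_mul, ENNReal.toReal_pow, toReal_enorm, ENNReal.toReal_ofReal hτ.le,
      ENNReal.coe_toReal, ENNReal.toReal_ofReal hS0,
      ENNReal.toReal_ofReal (show 0 ≤ ε ^ 2 / 2 by positivity), ENNReal.toReal_ofNat] at h2
    refine abs_le_of_sq_le_sq' ?_ (by positivity) |>.2
    rw [valL_apply]
    have hT0 : 0 ≤ T := norm_nonneg _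
    have h3 : C * τ ^ 2 * ‖w‖ ^ 2 ≤ ε ^ 2 / 2 * ‖w‖ ^ 2 := by gcongr
    have h4 : C * τ * T ^ 2 ≤ D ^ 2 * T ^ 2 := by
      gcongr
      refine le_trans ?_ hD
      simp only [D]
      nlinarith [C.2]
    have h5 : 4 * V * S ^ 2 ≤ D ^ 2 * S ^ 2 := by
      gcongr
      refine le_trans ?_ hD
      simp only [D]
      linarith [C.2]
    have hw0 := norm_nonneg w
    have hD0 : 0 ≤ D := by positivity
    have h6 : 0 ≤ ε * ‖w‖ * (D * T) := by positivity
    have h7 : 0 ≤ ε * ‖w‖ * (D * S) := by positivity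
    have h8 : 0 ≤ D * T * (D * S) := by positivity
    nlinarith
  have key' : ∀ u : H1 Ω, ‖valL Ω u‖ ≤
      ε * ‖u‖ + D * ‖trace Ω u‖ + D * ∑ k ∈ t, ‖⟪k, valL Ω u⟫_ℂ‖ := fun u =>
    (hΩ.denseRange_restrictInterior hd).induction_on
      (p := fun u => ‖valL Ω u‖ ≤
        ε * ‖u‖ + D * ‖trace Ω u‖ + D * ∑ k ∈ t, ‖⟪k, valL Ω u⟫_ℂ‖) u
      (isClosed_le (by fun_prop) (by fun_prop)) key
  -- Functionals on L²(Ω) become functionals on H¹(Ω) through the adjoint of the embedding.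
  -- Different ones may coincide there, hence the cardinality factor.
  refine ⟨t.image adj, D * (t.card + 1), fun u => (key' u).trans ?_⟩
  have hD0 : 0 ≤ D := by positivity
  have hsum : ∑ k ∈ t, ‖⟪k, valL Ω u⟫_ℂ‖ ≤ t.card * ∑ b ∈ t.image adj, ‖⟪b, u⟫_ℂ‖ := by
    rw [← nsmul_eq_mul]
    refine Finset.sum_le_card_nsmul _ _ _ fun k hk => ?_
    rw [← ContinuousLinearMap.adjoint_inner_left]
    exact Finset.single_le_sum (f := fun b => ‖⟪b, u⟫_ℂ‖) (fun _ _ => norm_nonneg _)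
      (Finset.mem_image_of_mem adj hk)
  have hsum0 : 0 ≤ ∑ b ∈ t.image adj, ‖⟪b, u⟫_ℂ‖ := Finset.sum_nonneg fun _ _ => norm_nonneg _
  have h1 : D * ‖trace Ω u‖ ≤ D * (t.card + 1) * ‖trace Ω u‖ := by
    gcongr
    exact le_mul_of_one_le_right hD0 (by simp)
  have h2 : D * ∑ k ∈ t, ‖⟪k, valL Ω u⟫_ℂ‖ ≤
      D * (t.card + 1) * ∑ b ∈ t.image adj, ‖⟪b, u⟫_ℂ‖ := by
    rw [mul_assoc]
    refine mul_le_mul_of_nonneg_left (hsum.trans ?_) hD0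
    gcongr
    simp
  linarith

end Compactness

lemma IsBoundedLipschitzDomain.isTraceSetting {d : ℕ} {Ω : Set (EuclideanSpace ℝ (Fin d))}
    (hΩ : IsBoundedLipschitzDomain Ω) (hd : 1 ≤ d) :
    IsTraceSetting (valL Ω) (trace Ω) (pullInner (grad Ω)) (H10 Ω) where
  inner_eq := inner_H1
  injective := hΩ.injective_val
  denseRange := hΩ.denseRange_val_H10
  denseRange_trace := hΩ.denseRange_trace hd
  ker_trace := hΩ.trace_eq_zero_iff hd
  trace_le _ hε := hΩ.trace_le hd hε
  le_trace _ hε := hΩ.le_trace hd hε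

end RobinDN

theorem theorem7p5 {d : ℕ} (hd : 2 ≤ d) {Ω : Set (EuclideanSpace ℝ (Fin d))}
    (hΩ : RobinDN.IsBoundedLipschitzDomain Ω) (α lam : ℂ)
    (hlam : lam ∈ RobinDN.resolventSet (RobinDN.dirichletLaplacian Ω)) :
    (lam ∈ RobinDN.opSpectrum (RobinDN.robinLaplacian Ω α) ↔
      α ∈ RobinDN.opSpectrum (RobinDN.dnOperator Ω lam)) ∧
    (RobinDN.IsEigenvalue (RobinDN.robinLaplacian Ω α) lam ↔
      RobinDN.IsEigenvalue (RobinDN.dnOperator Ω lam) α) ∧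
    (∀ u : RobinDN.H1 Ω,
      RobinDN.IsEigenfunction (RobinDN.robinLaplacian Ω α) lam (RobinDN.val Ω u) ↔
        u ∈ RobinDN.helmholtzSpace Ω lam ∧
          RobinDN.IsEigenfunction (RobinDN.dnOperator Ω lam) α (RobinDN.trace Ω u)) :=
  -- The concrete spaces and operators are instances of the abstract ones by definition, including
  -- the description of H¹(λ) as `W`.
  RobinDN.IsTraceSetting.main α (hΩ.isTraceSetting (by omega)) (fun _ => Iff.rfl) hlam rfl rfl
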